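/- Let $n\ge 0$ and $k\ge 2$, let $\mathfrak h_n$ be the Siegel upper half space of symmetric complex $n\times n$ matrices with positive definite imaginary part, on which $\mathbf{Sp}(2n,\mathbb R)$ acts by $\left(\begin{smallmatrix}A&B\\C&D\end{smallmatrix}\right)Z=(AZ+B)(CZ+D)^{-1}$, and let $\Gamma=\Gamma(2^k)\subset\mathbf{Sp}(2n,\mathbb Z)$ be the principal congruence subgroup of level $2^k$. Let $\overline{\mathfrak h}_n$ be the Satake partial compactification of $\mathfrak h_n$, i.e. the union of all rational boundary components (including $\mathfrak h_n$ itself) with the Satake topology. Each rational boundary component is a translate $gF_q$, with $g\in\mathbf{Sp}(2n,\mathbb Q)$ and $0\le q\le n$, of the standard component $F_q\cong\mathfrak h_q$ consisting of the limits $\lim_{Y\to\infty}\left(\begin{smallmatrix}Z&0\\0&iY\end{smallmatrix}\right)$, $Z\in\mathfrak h_q$. The group $\mathbf{Sp}(2n,\mathbb Q)$ and the involution $\tau(Z)=-\overline Z$ act on $\overline{\mathfrak h}_n$. Let $V=\Gamma\backslash\overline{\mathfrak h}_n$, with the quotient topology, be the Baily–Borel compactification of $X=\Gamma\backslash\mathfrak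 h_n\subset V$. The involution $\tau$ passes to complex conjugation on $V$; let $V_{\mathbb R}$ and $X_{\mathbb R}=V_{\mathbb R}\cap X$ be its fixed points in $V$ and in $X$. For $\gamma\in\Gamma$ put $\mathfrak h_n^{\gamma}=\{Z\in\mathfrak h_n : \gamma Z=\tau(Z)\}$ and, for a rational boundary component $F$, put $F^{\gamma}=\{x\in F : \tau(x)=\gamma x\}$. A real boundary pair $(F,\gamma)$ consists of a rational boundary component $F$ and an element $\gamma\in\Gamma$ with $F^{\gamma}\neq\emptyset$. **Theorem.** 1. For every real boundary pair $(F,\gamma)$ there exists $\gamma_1\in\Gamma$ such that $F^{\gamma}=F^{\gamma_1}$ and $F^{\gamma_1}$ is contained in the closure of $\mathfrak h_n^{\gamma_1}$ in $\overline{\mathfrak h}_n$. 2. The closure of $X_{\mathbb R}$ in $V$ equals $V_{\mathbb R}$. -/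

import Mathlib

namespace RealSiegel

open Matrix Topology

/-! ### The symplectic groups, their involution, and the principal congruence subgroups -/

/-- `Sp(2n, R)`. -/
abbrev Sp (n : ℕ) (R : Type) [CommRing R] : Type := Matrix.symplecticGroup (Fin n) R

/-- The matrix `I₋ = diag(-1, 1)`. -/
def Iminus (n : ℕ) (R : Type) [CommRing R] : Matrix (Fin n ⊕ Fin n) (Fin n ⊕ Fin n) R :=
  Matrix.fromBlocks (-1) 0 0 1

theorem Iminus_mul_self (n : ℕ) (R : Type) [CommRing R] : Iminus n R * Iminus n R = 1 := by
  simp [Iminus, Matrix.fromBlocks_multiply]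

theorem Iminus_J (n : ℕ) (R : Type) [CommRing R] :
    Iminus n R * Matrix.J (Fin n) R * Iminus n R = -Matrix.J (Fin n) R := by
  simp [Iminus, Matrix.J, Matrix.fromBlocks_multiply, Matrix.fromBlocks_neg]

theorem Iminus_transpose (n : ℕ) (R : Type) [CommRing R] : (Iminus n R)ᵀ = Iminus n R := by
  simp [Iminus, Matrix.fromBlocks_transpose]

theorem tau_mem {n : ℕ} {R : Type} [CommRing R] (g : Sp n R) :
    Iminus n R * g.1 * Iminus n R ∈ Matrix.symplecticGroup (Fin n) R := by
  have hg := SymplecticGroup.mem_iff.1 g.2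
  rw [SymplecticGroup.mem_iff, Matrix.transpose_mul, Matrix.transpose_mul, Iminus_transpose]
  calc Iminus n R * g.1 * Iminus n R * Matrix.J (Fin n) R * (Iminus n R * (g.1ᵀ * Iminus n R))
      = Iminus n R * g.1 * (Iminus n R * Matrix.J (Fin n) R * Iminus n R) * g.1ᵀ * Iminus n R := by
        simp only [Matrix.mul_assoc]
    _ = -(Iminus n R * (g.1 * Matrix.J (Fin n) R * g.1ᵀ) * Iminus n R) := by
        rw [Iminus_J]; simp only [Matrix.mul_assoc, Matrix.mul_neg, Matrix.neg_mul]
    _ = Matrix.J (Fin n) R := by rw [hg, Iminus_J, neg_neg]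

/-- The involution `τ(g) = I₋ g I₋` of `Sp(2n, R)`. -/
def tauSp {n : ℕ} {R : Type} [CommRing R] : Sp n R →* Sp n R where
  toFun g := ⟨Iminus n R * g.1 * Iminus n R, tau_mem g⟩
  map_one' := Subtype.ext (by simp [Iminus_mul_self])
  map_mul' g h := Subtype.ext (by
    change Iminus n R * (g.1 * h.1) * Iminus n R
      = Iminus n R * g.1 * Iminus n R * (Iminus n R * h.1 * Iminus n R)
    calc Iminus n R * (g.1 * h.1) * Iminus n R
        = Iminus n R * g.1 * 1 * (h.1 * Iminus n R) := by
          simp only [Matrix.mul_assoc, Matrix.one_mul]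
      _ = _ := by rw [← Iminus_mul_self]; simp only [Matrix.mul_assoc])

/-- The inclusion `Sp(2n, ℤ) → Sp(2n, ℚ)`. -/
def toRat {n : ℕ} : Sp n ℤ →* Sp n ℚ where
  toFun g := ⟨g.1.map (Int.castRingHom ℚ), SymplecticGroup.map_mem g.2 _⟩
  map_one' := Subtype.ext (by simp)
  map_mul' g h := Subtype.ext (by
    change (g.1 * h.1).map _ = g.1.map _ * h.1.map _
    rw [Matrix.map_mul])

/-- The principal congruence subgroup `Γ(N) = {γ ∈ Sp(2n, ℤ) | γ ≡ I mod N}`. -/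
def Gam (n N : ℕ) : Subgroup (Sp n ℤ) where
  carrier := {γ | γ.1.map (Int.castRingHom (ZMod N)) = 1}
  one_mem' := by simp
  mul_mem' {a b} ha hb := by
    change (a.1 * b.1).map _ = 1
    rw [Matrix.map_mul]
    change a.1.map _ = 1 at ha
    change b.1.map _ = 1 at hb
    rw [ha, hb, one_mul]
  inv_mem' {a} ha := by
    change a.1.map _ = 1 at ha
    change (a⁻¹).1.map _ = 1
    have h : (a⁻¹).1 * a.1 = 1 := congrArg Subtype.val (inv_mul_cancel a)
    have h2 := congrArg (fun M => M.map (Int.castRingHom (ZMod N))) h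
    simp only [Matrix.map_mul] at h2
    rw [ha, mul_one] at h2
    rw [h2]
    simp

/-! ### The Siegel upper half space -/

/-- The Siegel upper half space `𝔥_n` of symmetric complex `n × n` matrices with positive definite
imaginary part, with its usual topology. -/
abbrev Siegel (n : ℕ) : Type :=
  {Z : Matrix (Fin n) (Fin n) ℂ // Z.IsSymm ∧ (Z.map Complex.im).PosDef}

/-- The antiholomorphic involution `τ(Z) = -Z̄` of `𝔥_n`. -/
def Siegel.tau {n : ℕ} (Z : Siegel n) : Siegel n :=
  ⟨-(Z.1.map (starRingEnd ℂ)), by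
    constructor
    · have h : Z.1ᵀ = Z.1 := Z.2.1
      change (-(Z.1.map (starRingEnd ℂ)))ᵀ = _
      rw [Matrix.transpose_neg, ← Matrix.transpose_map, h]
    · have h : (-(Z.1.map (starRingEnd ℂ))).map Complex.im = Z.1.map Complex.im := by
        ext i j; simp
      rw [h]; exact Z.2.2⟩

/-- The set `𝔥_n^γ = {Z | γ Z = τ(Z)}` of `γ`-real points of `𝔥_n`, where
`γ Z = (A Z + B) (C Z + D)⁻¹` for `γ = (A B; C D)`. -/
noncomputable def siegelRealPoints {n : ℕ} (γ : Sp n ℤ) : Set (Siegel n) :=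
  {Z | let M := γ.1.map (Int.castRingHom ℂ)
       (M.toBlocks₁₁ * Z.1 + M.toBlocks₁₂) * (M.toBlocks₂₁ * Z.1 + M.toBlocks₂₂)⁻¹ = Z.tau.1}

/-! ### The compact dual: Lagrangian subspaces of `ℂ^{2n}`

A point `Z ∈ 𝔥_n` is identified with the Lagrangian subspace `{(Z v, v)}` of `ℂ^{2n}`. The linear
action of `Sp(2n)` on subspaces induces the fractional linear action on `𝔥_n`, and
`u ↦ I₋ ū` induces `Z ↦ -Z̄`. -/

/-- `ℂ^{2n}`; the summand `inl` is the first block of `n` coordinates. -/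
abbrev V (n : ℕ) : Type := (Fin n ⊕ Fin n) → ℂ

/-- The action of `Sp(2n, ℚ)` on subspaces of `ℂ^{2n}`. -/
noncomputable def actSub {n : ℕ} (g : Sp n ℚ) (L : Submodule ℂ (V n)) : Submodule ℂ (V n) :=
  L.map (Matrix.mulVecLin (g.1.map (algebraMap ℚ ℂ)))

theorem actSub_one {n : ℕ} (L : Submodule ℂ (V n)) : actSub 1 L = L := by
  simp [actSub]

theorem actSub_mul {n : ℕ} (g h : Sp n ℚ) (L : Submodule ℂ (V n)) :
    actSub (g * h) L = actSub g (actSub h L) := by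
  unfold actSub
  rw [← Submodule.map_comp, ← Matrix.mulVecLin_mul, ← Matrix.map_mul]
  rfl

/-- The antilinear involution `u ↦ I₋ ū` of `ℂ^{2n}`. -/
noncomputable def sigma (n : ℕ) : V n →ₛₗ[starRingEnd ℂ] V n where
  toFun u := Sum.elim (fun i => -(starRingEnd ℂ) (u (Sum.inl i)))
    (fun i => (starRingEnd ℂ) (u (Sum.inr i)))
  map_add' u v := by
    ext (i | i) <;> simp [add_comm]
  map_smul' c u := by
    ext (i | i) <;> simp

theorem sigma_sigma {n : ℕ} (u : V n) : sigma n (sigma n u) = u := by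
  ext (i | i) <;> simp [sigma]

theorem sigma_eq {n : ℕ} (u : V n) :
    sigma n u = (Iminus n ℂ).mulVec (fun i => (starRingEnd ℂ) (u i)) := by
  ext (i | i) <;> simp [sigma, Iminus, Matrix.mulVec, dotProduct, Matrix.one_apply]

theorem sigma_mulVec {n : ℕ} (g : Sp n ℚ) (u : V n) :
    sigma n ((g.1.map (algebraMap ℚ ℂ)).mulVec u)
      = ((tauSp g).1.map (algebraMap ℚ ℂ)).mulVec (sigma n u) := by
  have hI : (Iminus n ℚ).map (algebraMap ℚ ℂ) = Iminus n ℂ := by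
    simp [Iminus, Matrix.fromBlocks_map, Matrix.map_neg]
  have ht : (tauSp g).1.map (algebraMap ℚ ℂ)
      = Iminus n ℂ * g.1.map (algebraMap ℚ ℂ) * Iminus n ℂ := by
    change (Iminus n ℚ * g.1 * Iminus n ℚ).map _ = _
    rw [Matrix.map_mul, Matrix.map_mul, hI]
  have hc : (fun i => (starRingEnd ℂ) ((g.1.map (algebraMap ℚ ℂ)).mulVec u i))
      = (g.1.map (algebraMap ℚ ℂ)).mulVec (fun i => (starRingEnd ℂ) (u i)) := by
    ext i
    simp [Matrix.mulVec, dotProduct]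
  rw [sigma_eq, sigma_eq, hc, ht, Matrix.mulVec_mulVec, Matrix.mulVec_mulVec,
    Matrix.mul_assoc, Iminus_mul_self, mul_one]

/-- The involution `τ` on subspaces of `ℂ^{2n}`; the subspace `τ L` is the image of `L` under the
involution `u ↦ I₋ ū`, which is also its preimage. -/
noncomputable def tauSub {n : ℕ} (L : Submodule ℂ (V n)) : Submodule ℂ (V n) :=
  L.comap (sigma n)

theorem tauSub_actSub {n : ℕ} (g : Sp n ℚ) (L : Submodule ℂ (V n)) :
    tauSub (actSub g L) = actSub (tauSp g) (tauSub L) := by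
  ext u
  constructor
  · rintro ⟨l, hl, h⟩
    refine ⟨sigma n l, ?_, ?_⟩
    · change sigma n (sigma n l) ∈ L
      rw [sigma_sigma]; exact hl
    · rw [Matrix.mulVecLin_apply] at h ⊢
      rw [← sigma_mulVec, h, sigma_sigma]
  · rintro ⟨l, hl, h⟩
    refine ⟨sigma n l, hl, ?_⟩
    rw [Matrix.mulVecLin_apply] at h ⊢
    rw [← h, sigma_mulVec]
    congr 2
    have h2 : tauSp (tauSp g) = g := by
      apply Subtype.ext
      change Iminus n ℚ * (Iminus n ℚ * g.1 * Iminus n ℚ) * Iminus n ℚ = g.1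
      calc _ = (Iminus n ℚ * Iminus n ℚ) * g.1 * (Iminus n ℚ * Iminus n ℚ) := by
            simp only [Matrix.mul_assoc]
        _ = g.1 := by rw [Iminus_mul_self]; simp
    rw [← h2, h2]
    simp [h2]

/-! ### Rational boundary components and the Satake partial compactification -/

/-- The map `φ : 𝔥_q → compact dual`, `φ(Z) = lim_{Y → ∞} (Z 0; 0 iY)`. In terms of Lagrangian
subspaces this limit is `{(Z v, w; v, 0)}`. For `q = n` it is the inclusion of `𝔥_n`. -/
def phi {n q : ℕ} (hq : q ≤ n) (Z : Siegel q) : Submodule ℂ (V n) where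
  carrier := {u |
    (∀ i : Fin q, u (Sum.inl (Fin.castLE hq i))
      = ∑ j : Fin q, Z.1 i j * u (Sum.inr (Fin.castLE hq j))) ∧
    (∀ i : Fin n, q ≤ (i : ℕ) → u (Sum.inr i) = 0)}
  zero_mem' := by simp
  add_mem' {u v} hu hv := by
    refine ⟨fun i => ?_, fun i hi => ?_⟩
    · simp [hu.1 i, hv.1 i, mul_add, Finset.sum_add_distrib]
    · simp [hu.2 i hi, hv.2 i hi]
  smul_mem' c u hu := by
    refine ⟨fun i => ?_, fun i hi => ?_⟩
    · simp only [Pi.smul_apply, smul_eq_mul, hu.1 i, Finset.mul_sum]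
      exact Finset.sum_congr rfl (fun j _ => by ring)
    · simp [hu.2 i hi]

theorem tauSub_phi {n q : ℕ} (hq : q ≤ n) (Z : Siegel q) :
    tauSub (phi hq Z) = phi hq Z.tau := by
  ext u
  change ((∀ i : Fin q, -(starRingEnd ℂ) (u (Sum.inl (Fin.castLE hq i)))
      = ∑ j : Fin q, Z.1 i j * (starRingEnd ℂ) (u (Sum.inr (Fin.castLE hq j)))) ∧
    (∀ i : Fin n, q ≤ (i : ℕ) → (starRingEnd ℂ) (u (Sum.inr i)) = 0)) ↔
    ((∀ i : Fin q, u (Sum.inl (Fin.castLE hq i))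
      = ∑ j : Fin q, (-(starRingEnd ℂ) (Z.1 i j)) * u (Sum.inr (Fin.castLE hq j))) ∧
    (∀ i : Fin n, q ≤ (i : ℕ) → u (Sum.inr i) = 0))
  refine and_congr (forall_congr' fun i => ?_) (by simp)
  rw [← (starRingEnd ℂ).injective.eq_iff]
  simp only [map_neg, map_sum, map_mul, Complex.conj_conj, neg_mul, Finset.sum_neg_distrib]
  rw [neg_eq_iff_eq_neg]

/-- The set underlying the Satake partial compactification of `𝔥_n`: the union of all rational
boundary components, i.e. of the `Sp(2n, ℚ)`-translates of the standard components `φ(𝔥_q)`,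
`0 ≤ q ≤ n`. The component for `q = n` is `𝔥_n` itself. -/
def Satake (n : ℕ) : Type :=
  {L : Submodule ℂ (V n) // ∃ (q : ℕ) (hq : q ≤ n) (g : Sp n ℚ) (Z : Siegel q),
    L = actSub g (phi hq Z)}

noncomputable instance (n : ℕ) : MulAction (Sp n ℚ) (Satake n) where
  smul g x := ⟨actSub g x.1, by
    obtain ⟨q, hq, h, Z, hx⟩ := x.2
    exact ⟨q, hq, g * h, Z, by rw [hx, actSub_mul]⟩⟩
  one_smul x := Subtype.ext (actSub_one x.1)
  mul_smul g h x := Subtype.ext (actSub_mul g h x.1)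

noncomputable instance (n : ℕ) : MulAction (Sp n ℤ) (Satake n) :=
  MulAction.compHom (Satake n) (toRat (n := n))

/-- The involution `τ` on the Satake partial compactification. -/
noncomputable def Satake.tau {n : ℕ} (x : Satake n) : Satake n :=
  ⟨tauSub x.1, by
    obtain ⟨q, hq, g, Z, hx⟩ := x.2
    exact ⟨q, hq, tauSp g, Z.tau, by rw [hx, tauSub_actSub, tauSub_phi]⟩⟩

/-- The embedding `φ` of `𝔥_q` as the standard boundary component `F_q`. -/
noncomputable def stdPoint {n q : ℕ} (hq : q ≤ n) (Z : Siegel q) : Satake n :=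
  ⟨phi hq Z, q, hq, 1, Z, (actSub_one _).symm⟩

/-- The embedding of `𝔥_n` in its Satake partial compactification. -/
noncomputable def incl {n : ℕ} (Z : Siegel n) : Satake n := stdPoint le_rfl Z

/-- `F` is a rational boundary component: `F = g F_q` for some `0 ≤ q ≤ n`, `g ∈ Sp(2n, ℚ)`. -/
def IsRationalBoundaryComponent {n : ℕ} (F : Set (Satake n)) : Prop :=
  ∃ (q : ℕ) (hq : q ≤ n) (g : Sp n ℚ), F = Set.range (fun Z : Siegel q => g • stdPoint hq Z)

/-- `F^γ = {x ∈ F | τ(x) = γ x}`. -/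
def realPoints {n : ℕ} (F : Set (Satake n)) (γ : Sp n ℤ) : Set (Satake n) :=
  {x | x ∈ F ∧ x.tau = γ • x}

/-- `(F, γ)` is a `Γ(N)`-real boundary pair: `F` is a rational boundary component and `γ ∈ Γ(N)`
is such that `F^γ` is nonempty. -/
def IsRealBoundaryPair {n : ℕ} (N : ℕ) (F : Set (Satake n)) (γ : Sp n ℤ) : Prop :=
  IsRationalBoundaryComponent F ∧ γ ∈ Gam n N ∧ (realPoints F γ).Nonempty

/-! ### The Satake topology -/

/-- The isotropic subspace `W_q ⊆ ℂ^{2n}` spanned by `e_{q+1}, …, e_n`, which is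
`φ(Z) ∩ conj(φ(Z))` for every `Z ∈ 𝔥_q`. -/
def stdIsotropic (n q : ℕ) : Submodule ℂ (V n) where
  carrier := {u | (∀ i : Fin n, (i : ℕ) < q → u (Sum.inl i) = 0) ∧ ∀ i : Fin n, u (Sum.inr i) = 0}
  zero_mem' := by simp
  add_mem' {u v} hu hv :=
    ⟨fun i hi => by simp [hu.1 i hi, hv.1 i hi], fun i => by simp [hu.2 i, hv.2 i]⟩
  smul_mem' c u hu := ⟨fun i hi => by simp [hu.1 i hi], fun i => by simp [hu.2 i]⟩

/-- The orthogonal complement of `W_q` for the symplectic form. -/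
def stdIsotropicPerp (n q : ℕ) : Submodule ℂ (V n) where
  carrier := {u | ∀ i : Fin n, q ≤ (i : ℕ) → u (Sum.inr i) = 0}
  zero_mem' := by simp
  add_mem' {u v} hu hv := fun i hi => by simp [hu i hi, hv i hi]
  smul_mem' c u hu := fun i hi => by simp [hu i hi]

/-- The symplectic reduction `L ↦ (L ∩ W_q^⊥) + W_q`. On `𝔥_n` this is the projection
`(Z₁ Z₁₂; ᵗZ₁₂ Z₂) ↦ φ(Z₁)` onto the standard boundary component `F_q`. -/
def reduce {n : ℕ} (q : ℕ) (L : Submodule ℂ (V n)) : Submodule ℂ (V n) :=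
  (L ⊓ stdIsotropicPerp n q) ⊔ stdIsotropic n q

/-- The Hermitian form `(1/2i) (u₁ · ū₂ - u₂ · ū₁) = Im (u₁ · ū₂)` on `ℂ^{2n}`. It is positive
semidefinite on each `L` in the Satake partial compactification, and on `L = {(Z v, v)}` it is
`v ↦ ᵗv̄ Im(Z) v`. -/
noncomputable def herm {n : ℕ} (u : V n) : ℝ :=
  (∑ i : Fin n, u (Sum.inl i) * (starRingEnd ℂ) (u (Sum.inr i))).im

/-- The integral vectors in `W_q` of size less than `ε` for the quadratic form which `L` induces on
real vectors, `v = l + l̄ ↦ herm l` for `l ∈ L`. If `L` is the point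
`Z = X + iY = (Z₁ Z₁₂; ᵗZ₁₂ Z₂)` of `𝔥_n` then this form is `(a, 0) ↦ (1/4) ᵗa Y⁻¹ a`, so that its
restriction to `W_q` is one quarter of the inverse of `Y' = Y₂ - ᵗY₁₂ Y₁⁻¹ Y₁₂`. -/
def shortVectors {n : ℕ} (q : ℕ) (ε : ℝ) (L : Submodule ℂ (V n)) : Set (V n) :=
  {v | v ∈ stdIsotropic n q ∧ (∃ a : (Fin n ⊕ Fin n) → ℤ, v = fun i => (a i : ℂ)) ∧
    ∃ l ∈ L, (∀ i, l i + (starRingEnd ℂ) (l i) = v i) ∧ herm l < ε}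

/-- The basic neighbourhood of the points `φ(Z)`, `Z ∈ U`, in the Satake topology. In `𝔥_n` it
consists of the `(Z₁ Z₁₂; ᵗZ₁₂ Z₂)` with `Z₁ ∈ U` such that `(Y')⁻¹` takes values less than `4ε` on
`n - q` linearly independent vectors of `ℤ^{n-q}`, where `Y' = Y₂ - ᵗY₁₂ Y₁⁻¹ Y₁₂`. Up to a change of
`ε` the second condition says that `ᵗT Y' T > ε⁻¹ I` for some `T ∈ GL(n - q, ℤ)`, so that
these are the cylindrical sets `{Z₁ ∈ U, Y' > K}`, saturated under the pointwise stabilizer of `F_q`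
in `Sp(2n, ℤ)`. The points in the boundary components adjacent to `F_q` are treated on the
same footing. -/
def basicNhd {n q : ℕ} (hq : q ≤ n) (U : Set (Siegel q)) (ε : ℝ) : Set (Satake n) :=
  {y | (∃ Z ∈ U, reduce q y.1 = phi hq Z) ∧
    Submodule.span ℂ (shortVectors q ε y.1) = stdIsotropic n q}

theorem basicNhd_mono {n q : ℕ} (hq : q ≤ n) {U U' : Set (Siegel q)} {ε ε' : ℝ} (hU : U ⊆ U')
    (hε : ε ≤ ε') : basicNhd (n := n) hq U ε ⊆ basicNhd hq U' ε' := by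
  rintro y ⟨⟨Z, hZ, h⟩, hs⟩
  refine ⟨⟨Z, hU hZ, h⟩, le_antisymm (Submodule.span_le.2 fun v hv => hv.1) ?_⟩
  rw [← hs]
  refine Submodule.span_mono ?_
  rintro v ⟨h1, h2, l, hl, h3, h4⟩
  exact ⟨h1, h2, l, hl, h3, h4.trans_le hε⟩

/-- The Satake topology: a set `O` is open if for each of its points `g φ(Z)`, with
`g ∈ Sp(2n, ℚ)` and `Z ∈ 𝔥_q`, it contains the `g`-translate of some basic neighbourhood
of `φ(Z)`. -/
instance (n : ℕ) : TopologicalSpace (Satake n) where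
  IsOpen O := ∀ (q : ℕ) (hq : q ≤ n) (g : Sp n ℚ) (Z : Siegel q), g • stdPoint hq Z ∈ O →
    ∃ U ∈ 𝓝 Z, ∃ ε > 0, ∀ y ∈ basicNhd hq U ε, g • y ∈ O
  isOpen_univ _ _ _ _ _ := ⟨Set.univ, Filter.univ_mem, 1, one_pos, fun _ _ => trivial⟩
  isOpen_inter O O' hO hO' q hq g Z hx := by
    obtain ⟨U, hU, ε, hε, h⟩ := hO q hq g Z hx.1
    obtain ⟨U', hU', ε', hε', h'⟩ := hO' q hq g Z hx.2
    exact ⟨U ∩ U', Filter.inter_mem hU hU', min ε ε', lt_min hε hε', fun y hy =>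
      ⟨h y (basicNhd_mono hq Set.inter_subset_left (min_le_left _ _) hy),
        h' y (basicNhd_mono hq Set.inter_subset_right (min_le_right _ _) hy)⟩⟩
  isOpen_sUnion S hS q hq g Z := by
    rintro ⟨O, hO, hx⟩
    obtain ⟨U, hU, ε, hε, h⟩ := hS O hO q hq g Z hx
    exact ⟨U, hU, ε, hε, fun y hy => ⟨O, hO, h y hy⟩⟩

/-! ### The Baily-Borel compactification and its real points -/

/-- The Baily-Borel compactification of `Γ(N) \ 𝔥_n`: the quotient of the Satake partial
compactification by `Γ(N)`, with the quotient topology. -/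
noncomputable def BailyBorel (n N : ℕ) : Type := Quotient (MulAction.orbitRel (Gam n N) (Satake n))

noncomputable instance (n N : ℕ) : TopologicalSpace (BailyBorel n N) :=
  inferInstanceAs (TopologicalSpace (Quotient (MulAction.orbitRel (Gam n N) (Satake n))))

/-- The projection `π`. -/
noncomputable def proj {n : ℕ} (N : ℕ) (x : Satake n) : BailyBorel n N := Quotient.mk _ x

theorem tauSp_mem_Gam {n N : ℕ} {γ : Sp n ℤ} (hγ : γ ∈ Gam n N) : tauSp γ ∈ Gam n N := by
  change γ.1.map _ = 1 at hγ
  change (Iminus n ℤ * γ.1 * Iminus n ℤ).map _ = 1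
  rw [Matrix.map_mul, Matrix.map_mul, hγ, mul_one, ← Matrix.map_mul, Iminus_mul_self]
  simp

theorem Satake.tau_smul {n : ℕ} (γ : Sp n ℤ) (x : Satake n) :
    (γ • x).tau = tauSp γ • x.tau := by
  have h : toRat (tauSp γ) = tauSp (toRat γ) := by
    apply Subtype.ext
    change (Iminus n ℤ * γ.1 * Iminus n ℤ).map _ = Iminus n ℚ * γ.1.map _ * Iminus n ℚ
    have hI : (Iminus n ℤ).map (Int.castRingHom ℚ) = Iminus n ℚ := by
      simp [Iminus, Matrix.fromBlocks_map, Matrix.map_neg]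
    rw [Matrix.map_mul, Matrix.map_mul, hI]
  apply Subtype.ext
  change tauSub (actSub (toRat γ) x.1) = actSub (toRat (tauSp γ)) (tauSub x.1)
  rw [tauSub_actSub, h]

/-- Complex conjugation on the Baily-Borel compactification, induced by `τ`. -/
noncomputable def BailyBorel.tau {n N : ℕ} : BailyBorel n N → BailyBorel n N :=
  Quotient.map Satake.tau (by
    rintro x y ⟨γ, h⟩
    exact ⟨⟨tauSp γ.1, tauSp_mem_Gam γ.2⟩, by rw [← h]; exact (Satake.tau_smul γ.1 y).symm⟩)

/-- `V_ℝ`: the fixed points of complex conjugation on the Baily-Borel compactification `V`. -/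
def VR (n N : ℕ) : Set (BailyBorel n N) := {v | v.tau = v}

/-- `X_ℝ`: the fixed points of complex conjugation on `X = Γ(N) \ 𝔥_n = π(𝔥_n) ⊆ V`. -/
def XR (n N : ℕ) : Set (BailyBorel n N) :=
  {v | v ∈ Set.range (fun Z : Siegel n => proj N (incl Z)) ∧ v.tau = v}

end RealSiegel

namespace RealSiegel

open Matrix Topology

/-! A point of the Satake space is a Lagrangian subspace of ℂ^{2n} on which the Hermitian form `om u
(cj u) / 2i` is positive semidefinite; its radical is a rational isotropic subspace, a translate
gW_q, which determines the boundary component. In this language τ(x) = γx is a linear condition. For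
an integral g adapted to F = gF_q (`exists_integral_flag`) it reads δφ(Z) = φ(τZ) with δ = τ(g)⁻¹γg,
and σ = I₋δ is an integral antisymplectic matrix, block triangular for the flag W_q ⊆ W_q^⊥.

Part 1. Since γ ≡ 1 modulo 2^k, σ = 2M - 1, where modulo 2^(k-1) the matrix M is conjugate to the
projector (1 + I₋)/2; there it is idempotent and satisfies adj M = 1 - M. The matrix σ² = 1 + 4(M² -
M) fixes a point of F_q, so the powers of its middle block are bounded; being congruent to 1 modulo
4, that block equals 1 (`blk_eq_one_of_fixes`). Hence the middle block of M is an exact idempotent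
(`mid_block_idempotent`). The block on W_q is lifted to an exact idempotent
(`exists_idempotent_lift`), duality prescribes the remaining diagonal block, and an integral
unipotent u removes the off-diagonal blocks modulo 2^(k-1) (`exists_levi`). This gives an exact
block diagonal idempotent E. Transporting 2E - 1 by gu gives γ₁ in Γ(2^k) with the same middle block
as γ, hence the same real points on F (`exists_blockDiagonal`). On W_q the involution 2E - 1 is some
integral A; it is compatible with the positive form Y = 1 + A Aᵀ, so the points diag(Z, itY) are
real for γ₁ (`actSub_conePoint`), and they tend to φ(Z) as t → ∞ (`exists_conePoint_mem`).

Part 2. Density of X_ℝ in V_ℝ follows from part 1. The other inclusion says that V_ℝ is closed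
(`isClosed_VR`). If a point y near φ(Z) satisfies δy = τy, then δ carries short integral vectors of
y to short vectors with bounded denominators, and those lie in W_q because small integral symplectic
pairings vanish. So δ stabilizes W_q and y projects to a real point of F_q; the middle block of δ
has bounded entries and bounded denominators, so only finitely many closed conditions on Z can occur
(`exists_nhds_not_real`). -/

/-! ### The symplectic form on `ℂ^{2n}` -/

/-- The standard symplectic form on `ℂ^{2n}`. -/
def om {n : ℕ} (u v : V n) : ℂ :=
  ∑ i : Fin n, (u (Sum.inl i) * v (Sum.inr i) - u (Sum.inr i) * v (Sum.inl i))

/-- Complex conjugation on `ℂ^{2n}`. -/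
def cj {n : ℕ} (u : V n) : V n := fun i => (starRingEnd ℂ) (u i)

/-- A rational symplectic matrix as a linear endomorphism of `ℂ^{2n}`. -/
noncomputable def cLin {n : ℕ} (g : Sp n ℚ) : V n →ₗ[ℂ] V n :=
  Matrix.mulVecLin (g.1.map (algebraMap ℚ ℂ))

theorem cLin_mem_actSub {n : ℕ} (g : Sp n ℚ) {L : Submodule ℂ (V n)} {l : V n} (hl : l ∈ L) :
    cLin g l ∈ actSub g L := ⟨l, hl, rfl⟩

theorem cLin_mul {n : ℕ} (g h : Sp n ℚ) (u : V n) : cLin (g * h) u = cLin g (cLin h u) := by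
  unfold cLin
  rw [← LinearMap.comp_apply, ← Matrix.mulVecLin_mul, ← Matrix.map_mul]
  rfl

theorem cLin_one {n : ℕ} (u : V n) : cLin (1 : Sp n ℚ) u = u := by
  simp [cLin]

theorem cLin_inv_apply {n : ℕ} (g : Sp n ℚ) (u : V n) : cLin g⁻¹ (cLin g u) = u := by
  rw [← cLin_mul, inv_mul_cancel, cLin_one]

theorem actSub_inv_actSub {n : ℕ} (g : Sp n ℚ) (L : Submodule ℂ (V n)) :
    actSub g⁻¹ (actSub g L) = L := by
  rw [← actSub_mul, inv_mul_cancel, actSub_one]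

theorem actSub_mono {n : ℕ} (g : Sp n ℚ) {L M : Submodule ℂ (V n)} (h : L ≤ M) :
    actSub g L ≤ actSub g M := Submodule.map_mono h

theorem finrank_actSub {n : ℕ} (g : Sp n ℚ) (L : Submodule ℂ (V n)) :
    Module.finrank ℂ (actSub g L) = Module.finrank ℂ L := by
  have h : Function.Injective (cLin g) := fun u v h => by
    rw [← cLin_inv_apply g u, h, cLin_inv_apply]
  exact (Submodule.equivMapOfInjective (cLin g) h L).finrank_eq.symm

theorem actSub_eq_of_le {n : ℕ} {g : Sp n ℚ} {L : Submodule ℂ (V n)} (h : actSub g L ≤ L) :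
    actSub g L = L := Submodule.eq_of_le_of_finrank_eq h (finrank_actSub g L)

/-! ### Invariance of the symplectic and Hermitian forms; Cauchy–Schwarz. -/

theorem om_add_left {n : ℕ} (u v w : V n) : om (u + v) w = om u w + om v w := by
  simp only [om, ← Finset.sum_add_distrib, Pi.add_apply]
  exact Finset.sum_congr rfl fun i _ => by ring

theorem om_smul_left {n : ℕ} (c : ℂ) (u w : V n) : om (c • u) w = c * om u w := by
  simp only [om, Finset.mul_sum, Pi.smul_apply, smul_eq_mul]
  exact Finset.sum_congr rfl fun i _ => by ring

theorem om_swap {n : ℕ} (u v : V n) : om v u = -om u v := by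
  simp only [om, ← Finset.sum_neg_distrib]
  exact Finset.sum_congr rfl fun i _ => by ring

theorem om_add_right {n : ℕ} (u v w : V n) : om u (v + w) = om u v + om u w := by
  rw [om_swap, om_add_left, om_swap u, om_swap u]; ring

theorem om_smul_right {n : ℕ} (c : ℂ) (u w : V n) : om u (c • w) = c * om u w := by
  rw [om_swap, om_smul_left, om_swap u]; ring

theorem om_cj {n : ℕ} (u v : V n) : om (cj u) (cj v) = (starRingEnd ℂ) (om u v) := by
  simp [om, cj]

theorem cj_cj {n : ℕ} (u : V n) : cj (cj u) = u := by
  ext i; simp [cj]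

theorem cj_add {n : ℕ} (u v : V n) : cj (u + v) = cj u + cj v := by
  ext i; simp [cj]

theorem cj_smul {n : ℕ} (c : ℂ) (u : V n) : cj (c • u) = (starRingEnd ℂ) c • cj u := by
  ext i; simp [cj]

theorem om_eq_dotProduct {n : ℕ} (u v : V n) :
    om u v = -(u ⬝ᵥ (Matrix.J (Fin n) ℂ *ᵥ v)) := by
  simp [om, Matrix.J, dotProduct, Matrix.fromBlocks_mulVec, Matrix.neg_mulVec,
    Finset.sum_sub_distrib]
  ring

theorem om_cLin {n : ℕ} (g : Sp n ℚ) (u v : V n) : om (cLin g u) (cLin g v) = om u v := by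
  have hg : g.1.map (algebraMap ℚ ℂ) ∈ Matrix.symplecticGroup (Fin n) ℂ :=
    SymplecticGroup.map_mem g.2 _
  rw [SymplecticGroup.mem_iff'] at hg
  rw [om_eq_dotProduct, om_eq_dotProduct]
  unfold cLin
  rw [Matrix.mulVecLin_apply, Matrix.mulVecLin_apply, Matrix.mulVec_mulVec,
    Matrix.dotProduct_mulVec, ← Matrix.mulVec_transpose, Matrix.mulVec_mulVec,
    ← Matrix.vecMul_transpose, ← Matrix.dotProduct_mulVec]
  simp only [Matrix.transpose_mul, Matrix.transpose_transpose, Matrix.J_transpose,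
    Matrix.transpose_neg, neg_neg]
  rw [← Matrix.mul_assoc, hg]

theorem cLin_cj {n : ℕ} (g : Sp n ℚ) (u : V n) : cLin g (cj u) = cj (cLin g u) := by
  ext i
  simp [cLin, cj, Matrix.mulVec, dotProduct]

/-- This identity expresses the Hermitian form through the symplectic form and conjugation, so each
transformation rule of `herm` below is read off from the corresponding rule of `om`. -/
theorem om_self_cj {n : ℕ} (u : V n) : om u (cj u) = 2 * Complex.I * herm u := by
  apply Complex.ext
  · simp [om, cj, mul_comm]
  · simp only [om, cj, herm, Complex.im_sum, Complex.mul_im, Complex.sub_im, Complex.conj_re,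
      Complex.conj_im]
    simp [Finset.mul_sum]
    rw [← Finset.sum_sub_distrib]
    exact Finset.sum_congr rfl fun i _ => by ring

theorem herm_eq_im {n : ℕ} (u : V n) : herm u = (om u (cj u)).im / 2 := by
  rw [om_self_cj]; simp

theorem herm_cLin {n : ℕ} (g : Sp n ℚ) (u : V n) : herm (cLin g u) = herm u := by
  rw [herm_eq_im, herm_eq_im, ← cLin_cj, om_cLin]

theorem om_sigma {n : ℕ} (u v : V n) :
    om (sigma n u) (sigma n v) = -(starRingEnd ℂ) (om u v) := by
  simp only [om, sigma, map_sum, map_sub, map_mul, ← Finset.sum_neg_distrib]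
  exact Finset.sum_congr rfl fun i _ => by
    simp; ring

theorem cj_sigma {n : ℕ} (u : V n) : cj (sigma n u) = sigma n (cj u) := by
  ext (i | i) <;> simp [cj, sigma]

theorem herm_sigma {n : ℕ} (u : V n) : herm (sigma n u) = herm u := by
  rw [herm_eq_im, herm_eq_im, cj_sigma, om_sigma]; simp

theorem herm_smul {n : ℕ} (c : ℂ) (u : V n) : herm (c • u) = Complex.normSq c * herm u := by
  rw [herm_eq_im, herm_eq_im, cj_smul, om_smul_left, om_smul_right, ← mul_assoc,
    Complex.mul_conj, Complex.im_ofReal_mul]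
  ring

theorem herm_add {n : ℕ} (u v : V n) :
    herm (u + v) = herm u + herm v + (om u (cj v)).im := by
  have h : om v (cj u) = -(starRingEnd ℂ) (om u (cj v)) := by
    rw [om_swap, ← om_cj, cj_cj]
  rw [herm_eq_im, herm_eq_im, herm_eq_im, cj_add, om_add_left, om_add_right, om_add_right, h]
  simp; ring

/-- A subspace is isotropic if the symplectic form vanishes on it. -/
def IsIso {n : ℕ} (L : Submodule ℂ (V n)) : Prop := ∀ u ∈ L, ∀ v ∈ L, om u v = 0

/-- The Hermitian form is positive semidefinite on the subspace. -/
def IsNonneg {n : ℕ} (L : Submodule ℂ (V n)) : Prop := ∀ u ∈ L, 0 ≤ herm u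

/-- Cauchy–Schwarz for a semidefinite form. The polarization of `herm` is `om l (cj m) / 2i`, whence
the factor 4. -/
theorem IsNonneg.norm_om_cj_sq_le {n : ℕ} {L : Submodule ℂ (V n)} (hL : IsNonneg L) {l m : V n}
    (hl : l ∈ L) (hm : m ∈ L) : ‖om l (cj m)‖ ^ 2 ≤ 4 * herm l * herm m := by
  set w := om l (cj m) with hw
  by_cases h0 : w = 0
  · rw [h0]; simp; exact mul_nonneg (mul_nonneg (by norm_num) (hL l hl)) (hL m hm)
  have key : ∀ t : ℝ, 0 ≤ herm m * (t * t) + ‖w‖ * t + herm l := by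
    intro t
    -- The phase of z makes the cross term equal to t‖w‖, so nonnegativity of `herm (l + z • m)`
    -- becomes that of a real quadratic polynomial in t, and its discriminant is at most zero.
    set z : ℂ := t * (-Complex.I * w / ‖w‖) with hz
    have hn : (‖w‖ : ℂ) ≠ 0 := by simpa using h0
    have hn' : ‖w‖ ≠ 0 := by simpa using h0
    have h1 := hL (l + z • m) (L.add_mem hl (L.smul_mem z hm))
    have hzn : Complex.normSq z = t * t := by
      rw [Complex.normSq_eq_norm_sq, hz]
      simp only [norm_mul, norm_div, norm_neg, Complex.norm_I, Complex.norm_real,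
        Real.norm_eq_abs, abs_norm, one_mul]
      rw [div_self hn', mul_one, sq_abs]; ring
    have hzw : ((starRingEnd ℂ) z * w) = ((t * ‖w‖ : ℝ) : ℂ) * Complex.I := by
      rw [hz]
      simp only [map_mul, map_div₀, map_neg, Complex.conj_I, Complex.conj_ofReal]
      have : (starRingEnd ℂ) w * w = (‖w‖ : ℂ) ^ 2 := by
        rw [Complex.conj_mul']
      push_cast
      field_simp
      linear_combination (t : ℂ) * this
    have hzw' : (om l (cj (z • m))).im = t * ‖w‖ := by
      rw [cj_smul, om_smul_right, ← hw, hzw]; simp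
    rw [herm_add, herm_smul, hzn, hzw'] at h1
    linarith
  have := discrim_le_zero key
  simp only [discrim] at this
  linarith

/-! ### The standard flag and the standard boundary components -/

/-- The position of a coordinate of `ℂ^{2n}` in the flag `W_q ⊆ W_q^⊥ ⊆ ℂ^{2n}`. -/
def lev (n q : ℕ) : Fin n ⊕ Fin n → ℕ :=
  Sum.elim (fun i => if (i : ℕ) < q then 1 else 0) (fun i => if (i : ℕ) < q then 1 else 2)

theorem lev_le_two {n q : ℕ} (a : Fin n ⊕ Fin n) : lev n q a ≤ 2 := by
  rcases a with i | i <;> simp only [lev, Sum.elim_inl, Sum.elim_inr] <;> split_ifs <;> omega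

theorem mem_stdIsotropic {n q : ℕ} {u : V n} :
    u ∈ stdIsotropic n q ↔ ∀ a, lev n q a ≠ 0 → u a = 0 := by
  change ((∀ i : Fin n, (i : ℕ) < q → u (Sum.inl i) = 0) ∧ ∀ i : Fin n, u (Sum.inr i) = 0) ↔ _
  rw [Sum.forall]
  refine and_congr (forall_congr' fun i => ?_) (forall_congr' fun i => ?_)
  · simp only [lev, Sum.elim_inl]; split_ifs with h <;> simp [h]
  · simp only [lev, Sum.elim_inr]; split_ifs with h <;> simp

theorem mem_stdIsotropicPerp {n q : ℕ} {u : V n} :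
    u ∈ stdIsotropicPerp n q ↔ ∀ a, lev n q a = 2 → u a = 0 := by
  change (∀ i : Fin n, q ≤ (i : ℕ) → u (Sum.inr i) = 0) ↔ _
  rw [Sum.forall]
  constructor
  · intro h
    refine ⟨fun i hi => ?_, fun i hi => h i ?_⟩
    · simp only [lev, Sum.elim_inl] at hi; split_ifs at hi; all_goals omega
    · simp only [lev, Sum.elim_inr] at hi; split_ifs at hi <;> omega
  · rintro ⟨-, h⟩ i hi
    refine h i ?_
    simp [lev, hi]

theorem mem_phi {n q : ℕ} {hq : q ≤ n} {Z : Siegel q} {u : V n} :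
    u ∈ phi hq Z ↔ (fun i => u (Sum.inl (Fin.castLE hq i)))
        = Z.1 *ᵥ (fun j => u (Sum.inr (Fin.castLE hq j))) ∧ u ∈ stdIsotropicPerp n q := by
  rw [funext_iff]
  rfl

theorem phi_le_stdIsotropicPerp {n q : ℕ} (hq : q ≤ n) (Z : Siegel q) :
    phi hq Z ≤ stdIsotropicPerp n q := fun _ hu => hu.2

theorem stdIsotropic_le_phi {n q : ℕ} (hq : q ≤ n) (Z : Siegel q) :
    stdIsotropic n q ≤ phi hq Z := fun u hu =>
  ⟨fun i => by
    rw [hu.1 (Fin.castLE hq i) i.2]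
    simp [hu.2], fun i _ => hu.2 i⟩

theorem sum_castLE {n q : ℕ} (hq : q ≤ n) {M : Type*} [AddCommMonoid M] (f : Fin n → M)
    (hf : ∀ i : Fin n, q ≤ (i : ℕ) → f i = 0) :
    ∑ i, f i = ∑ i : Fin q, f (Fin.castLE hq i) := by
  refine Eq.trans ?_ (Finset.sum_map Finset.univ (Fin.castLEEmb hq) f)
  symm
  refine Finset.sum_subset (Finset.subset_univ _) fun i _ hi => hf i ?_
  by_contra h
  exact hi (Finset.mem_map.2 ⟨⟨i, by omega⟩, Finset.mem_univ _, rfl⟩)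

/-- The coordinates of `W_q^⊥ / W_q` among those of `ℂ^{2n}`. -/
def hIdx {n q : ℕ} (hq : q ≤ n) : Fin q ⊕ Fin q → Fin n ⊕ Fin n :=
  Sum.map (Fin.castLE hq) (Fin.castLE hq)

theorem lev_hIdx {n q : ℕ} (hq : q ≤ n) (a : Fin q ⊕ Fin q) : lev n q (hIdx hq a) = 1 := by
  rcases a with i | i <;> simp [lev, hIdx]

theorem exists_hIdx {n q : ℕ} (hq : q ≤ n) {a : Fin n ⊕ Fin n} (ha : lev n q a = 1) :
    ∃ b, hIdx hq b = a := by
  rcases a with i | i <;> simp only [lev, Sum.elim_inl, Sum.elim_inr] at ha <;>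
    split_ifs at ha with h
  · exact ⟨Sum.inl ⟨i, h⟩, rfl⟩
  · exact ⟨Sum.inr ⟨i, h⟩, rfl⟩
  · omega

theorem sum_hIdx {n q : ℕ} (hq : q ≤ n) {M : Type*} [AddCommMonoid M] (f : Fin n ⊕ Fin n → M)
    (hf : ∀ a, lev n q a ≠ 1 → f a = 0) :
    ∑ a, f a = ∑ b, f (hIdx hq b) := by
  rw [Fintype.sum_sum_type, Fintype.sum_sum_type, sum_castLE hq, sum_castLE hq]
  · rfl
  · intro i hi
    exact hf _ (by simp [lev, hi])
  · intro i hi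
    exact hf _ (by simp [lev, hi])

theorem om_of_mem_perp {n q : ℕ} (hq : q ≤ n) {u v : V n} (hu : u ∈ stdIsotropicPerp n q)
    (hv : v ∈ stdIsotropicPerp n q) :
    om u v = om (fun a => u (hIdx hq a)) (fun a => v (hIdx hq a)) := by
  unfold om
  rw [sum_castLE hq]
  · rfl
  · intro i hi
    rw [hu i hi, hv i hi]; ring

theorem cj_mem_stdIsotropicPerp {n q : ℕ} {u : V n} (hu : u ∈ stdIsotropicPerp n q) :
    cj u ∈ stdIsotropicPerp n q := fun i hi => by simp [cj, hu i hi]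

theorem cj_mem_stdIsotropic {n q : ℕ} {u : V n} (hu : u ∈ stdIsotropic n q) :
    cj u ∈ stdIsotropic n q :=
  ⟨fun i hi => by simp [cj, hu.1 i hi], fun i => by simp [cj, hu.2 i]⟩

theorem sigma_mem_stdIsotropic {n q : ℕ} {u : V n} (hu : u ∈ stdIsotropic n q) :
    sigma n u ∈ stdIsotropic n q :=
  ⟨fun i hi => by simp [sigma, hu.1 i hi], fun i => by simp [sigma, hu.2 i]⟩

theorem om_eq_zero_of_mem {n q : ℕ} {u v : V n} (hu : u ∈ stdIsotropic n q)
    (hv : v ∈ stdIsotropicPerp n q) : om u v = 0 := by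
  refine Finset.sum_eq_zero fun i _ => ?_
  rw [hu.2 i]
  rcases lt_or_ge (i : ℕ) q with h | h
  · rw [hu.1 i h]; ring
  · rw [hv i h]; ring

theorem om_single_inl {n : ℕ} (i : Fin n) (u : V n) :
    om (Pi.single (Sum.inl i) 1) u = u (Sum.inr i) := by
  simp [om, Pi.single_apply]

theorem om_single_inr {n : ℕ} (i : Fin n) (u : V n) :
    om (Pi.single (Sum.inr i) 1) u = -u (Sum.inl i) := by
  simp [om, Pi.single_apply]

theorem single_mem_stdIsotropic {n q : ℕ} {a : Fin n ⊕ Fin n} (ha : lev n q a = 0) (c : ℂ) :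
    (Pi.single a c : V n) ∈ stdIsotropic n q := by
  rw [mem_stdIsotropic]
  intro b hb
  rw [Pi.single_eq_of_ne]
  rintro rfl
  exact hb ha

theorem single_mem_stdIsotropicPerp {n q : ℕ} {a : Fin n ⊕ Fin n} (ha : lev n q a ≠ 2) (c : ℂ) :
    (Pi.single a c : V n) ∈ stdIsotropicPerp n q := by
  rw [mem_stdIsotropicPerp]
  intro b hb
  rw [Pi.single_eq_of_ne]
  rintro rfl
  exact ha hb

theorem mem_stdIsotropicPerp_of_om {n q : ℕ} {u : V n}
    (h : ∀ w ∈ stdIsotropic n q, om w u = 0) : u ∈ stdIsotropicPerp n q := by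
  intro i hi
  rw [← om_single_inl i u]
  exact h _ (single_mem_stdIsotropic (by simp [lev, hi]) 1)

/-- The vector of `φ(Z)` with coordinates `(Z c, 0; c, 0)`. -/
def phiVec {n q : ℕ} (Z : Siegel q) (c : Fin q → ℂ) : V n :=
  Sum.elim (fun i => if h : (i : ℕ) < q then (Z.1 *ᵥ c) ⟨i, h⟩ else 0)
    (fun i => if h : (i : ℕ) < q then c ⟨i, h⟩ else 0)

theorem phiVec_inl {n q : ℕ} (hq : q ≤ n) (Z : Siegel q) (c : Fin q → ℂ) (i : Fin q) :
    phiVec (n := n) Z c (Sum.inl (Fin.castLE hq i)) = (Z.1 *ᵥ c) i := by simp [phiVec]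

theorem phiVec_inr {n q : ℕ} (hq : q ≤ n) (Z : Siegel q) (c : Fin q → ℂ) (i : Fin q) :
    phiVec (n := n) Z c (Sum.inr (Fin.castLE hq i)) = c i := by simp [phiVec]

theorem phiVec_eq_zero {n q : ℕ} (Z : Siegel q) (c : Fin q → ℂ) {a : Fin n ⊕ Fin n}
    (ha : lev n q a ≠ 1) : phiVec Z c a = 0 := by
  rcases a with i | i <;> simp only [lev, Sum.elim_inl, Sum.elim_inr] at ha <;>
    split_ifs at ha with h <;> simp_all [phiVec]

theorem phiVec_mem {n q : ℕ} (hq : q ≤ n) (Z : Siegel q) (c : Fin q → ℂ) :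
    phiVec Z c ∈ phi hq Z := by
  rw [mem_phi, mem_stdIsotropicPerp]
  refine ⟨?_, fun a ha => phiVec_eq_zero Z c (by omega)⟩
  simp only [phiVec_inl, phiVec_inr]

/-- The Lagrangian coordinates of the standard chart at `F_q`. -/
def slot (n q : ℕ) : V n →ₗ[ℂ] (Fin n → ℂ) where
  toFun u i := if (i : ℕ) < q then u (Sum.inr i) else u (Sum.inl i)
  map_add' u v := by ext i; simp only [Pi.add_apply]; split_ifs <;> rfl
  map_smul' c u := by ext i; simp only [Pi.smul_apply, RingHom.id_apply]; split_ifs <;> rfl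

theorem slot_apply {n q : ℕ} (u : V n) (i : Fin n) :
    slot n q u i = if (i : ℕ) < q then u (Sum.inr i) else u (Sum.inl i) := rfl

/-- With `finrank_actSub`, this turns every inclusion between translates of such subspaces into an
equality. -/
theorem finrank_phi {n q : ℕ} (hq : q ≤ n) (Z : Siegel q) :
    Module.finrank ℂ (phi hq Z) = n := by
  have hb : Function.Bijective ((slot n q).comp (phi hq Z).subtype) := by
    constructor
    · rw [injective_iff_map_eq_zero]
      rintro ⟨u, hu⟩ h
      have h1 : ∀ i : Fin n, u (Sum.inr i) = 0 := fun i => by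
        have h2 := congrFun h i
        simp only [LinearMap.comp_apply, Submodule.subtype_apply, slot_apply] at h2
        split_ifs at h2 with h3
        · exact h2
        · exact hu.2 i (by omega)
      apply Subtype.ext
      ext (i | i)
      · have h2 := congrFun h i
        simp only [LinearMap.comp_apply, Submodule.subtype_apply, slot_apply] at h2
        split_ifs at h2 with h3
        · have := hu.1 ⟨i, h3⟩
          simp only [h1, mul_zero, Finset.sum_const_zero] at this
          exact this
        · exact h2
      · exact h1 i
    · intro c
      refine ⟨⟨phiVec Z (fun i => c (Fin.castLE hq i))
        + Sum.elim (fun i : Fin n => if (i : ℕ) < q then 0 else c i) 0, ?_⟩, ?_⟩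
      · refine Submodule.add_mem _ (phiVec_mem hq Z _) (stdIsotropic_le_phi hq Z ?_)
        exact ⟨fun i hi => by simp [hi], fun i => rfl⟩
      · ext i
        simp only [LinearMap.comp_apply, Submodule.subtype_apply, slot_apply, phiVec,
          Pi.add_apply, Sum.elim_inl, Sum.elim_inr]
        split_ifs with h <;> simp
  rw [(LinearEquiv.ofBijective _ hb).finrank_eq]
  simp

/-- The terms containing the real part of Z are antisymmetric in the two summation indices, so they
cancel; the imaginary part acts separately on the real and imaginary parts of c. -/
theorem herm_of_symm {q : ℕ} {Z : Matrix (Fin q) (Fin q) ℂ} (hZ : Z.IsSymm) (c : Fin q → ℂ) :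
    herm (Sum.elim (Z *ᵥ c) c) =
      (fun i => (c i).re) ⬝ᵥ (Z.map Complex.im *ᵥ (fun i => (c i).re))
      + (fun i => (c i).im) ⬝ᵥ (Z.map Complex.im *ᵥ (fun i => (c i).im)) := by
  have h : ∀ i j, Z i j = Z j i := fun i j => (hZ.apply i j).symm
  simp only [herm, Sum.elim_inl, Sum.elim_inr, mulVec, dotProduct, Finset.sum_mul,
    Finset.mul_sum, Complex.im_sum, Matrix.map_apply]
  have hd : ∑ i, ∑ j, ((Z i j * c j * (starRingEnd ℂ) (c i)).im
      - ((c i).re * ((Z i j).im * (c j).re) + (c i).im * ((Z i j).im * (c j).im))) = 0 := by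
    have : ∀ i j, ((Z i j * c j * (starRingEnd ℂ) (c i)).im
      - ((c i).re * ((Z i j).im * (c j).re) + (c i).im * ((Z i j).im * (c j).im)))
      = (Z i j).re * ((c j).im * (c i).re - (c j).re * (c i).im) := by
      intro i j
      simp; ring
    simp only [this]
    have h2 : ∀ S : ℝ, S = -S → S = 0 := fun S hS => by linarith
    apply h2
    conv_rhs => rw [Finset.sum_comm]
    simp only [← Finset.sum_neg_distrib]
    refine Finset.sum_congr rfl fun i _ => Finset.sum_congr rfl fun j _ => ?_
    rw [h i j]; ring
  simp only [Finset.sum_sub_distrib, Finset.sum_add_distrib] at hd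
  linarith

theorem herm_of_mem_perp {n q : ℕ} (hq : q ≤ n) {u : V n} (hu : u ∈ stdIsotropicPerp n q) :
    herm u = herm (fun a => u (hIdx hq a)) := by
  rw [herm_eq_im, herm_eq_im, om_of_mem_perp hq hu (cj_mem_stdIsotropicPerp hu)]
  rfl

theorem herm_of_mem_phi {n q : ℕ} {hq : q ≤ n} {Z : Siegel q} {u : V n} (hu : u ∈ phi hq Z) :
    herm u = herm (Sum.elim (Z.1 *ᵥ (fun j => u (Sum.inr (Fin.castLE hq j))))
      (fun j => u (Sum.inr (Fin.castLE hq j)))) := by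
  rw [herm_of_mem_perp hq hu.2]
  congr 1
  ext (i | i)
  · exact hu.1 i
  · rfl

theorem quad_nonneg {q : ℕ} {Y : Matrix (Fin q) (Fin q) ℝ} (hY : Y.PosDef) (x : Fin q → ℝ) :
    0 ≤ x ⬝ᵥ (Y *ᵥ x) := by
  by_cases hx : x = 0
  · simp [hx]
  · simpa using (hY.dotProduct_mulVec_pos hx).le

theorem quad_eq_zero {q : ℕ} {Y : Matrix (Fin q) (Fin q) ℝ} (hY : Y.PosDef) {x : Fin q → ℝ}
    (h : x ⬝ᵥ (Y *ᵥ x) ≤ 0) : x = 0 := by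
  by_contra hx
  have := hY.dotProduct_mulVec_pos hx
  simp only [star_trivial] at this
  linarith

theorem isNonneg_phi {n q : ℕ} (hq : q ≤ n) (Z : Siegel q) : IsNonneg (phi hq Z) := by
  intro u hu
  rw [herm_of_mem_phi hu, herm_of_symm Z.2.1]
  exact add_nonneg (quad_nonneg Z.2.2 _) (quad_nonneg Z.2.2 _)

/-- W_q is the radical of the Hermitian form on φ(Z), so it can be recovered from φ(Z) alone. This
is why a group element that carries one point of F_q into F_q must preserve W_q. -/
theorem mem_stdIsotropic_of_herm {n q : ℕ} {hq : q ≤ n} {Z : Siegel q} {u : V n}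
    (hu : u ∈ phi hq Z) (h : herm u ≤ 0) : u ∈ stdIsotropic n q := by
  rw [herm_of_mem_phi hu, herm_of_symm Z.2.1] at h
  have h1 := quad_nonneg Z.2.2 (fun i => (u (Sum.inr (Fin.castLE hq i))).re)
  have h2 := quad_nonneg Z.2.2 (fun i => (u (Sum.inr (Fin.castLE hq i))).im)
  have h3 := quad_eq_zero Z.2.2 (x := fun i => (u (Sum.inr (Fin.castLE hq i))).re) (by linarith)
  have h4 := quad_eq_zero Z.2.2 (x := fun i => (u (Sum.inr (Fin.castLE hq i))).im) (by linarith)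
  have h5 : ∀ i : Fin q, u (Sum.inr (Fin.castLE hq i)) = 0 := fun i =>
    Complex.ext (congrFun h3 i) (congrFun h4 i)
  refine ⟨fun i hi => ?_, fun i => ?_⟩
  · have := hu.1 ⟨i, hi⟩
    simp only [h5, mul_zero, Finset.sum_const_zero] at this
    exact this
  · by_cases hi : (i : ℕ) < q
    · exact h5 ⟨i, hi⟩
    · exact hu.2 i (by omega)

theorem isIso_phi {n q : ℕ} (hq : q ≤ n) (Z : Siegel q) : IsIso (phi hq Z) := by
  intro u hu v hv
  rw [om_of_mem_perp hq hu.2 hv.2]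
  have hu1 := (mem_phi.1 hu).1
  have hv1 := (mem_phi.1 hv).1
  change ∑ i : Fin q, ((fun i => u (Sum.inl (Fin.castLE hq i))) i * v (Sum.inr (Fin.castLE hq i))
    - u (Sum.inr (Fin.castLE hq i)) * (fun i => v (Sum.inl (Fin.castLE hq i))) i) = 0
  rw [hu1, hv1, Finset.sum_sub_distrib, sub_eq_zero]
  change (Z.1 *ᵥ _) ⬝ᵥ (fun i => v (Sum.inr (Fin.castLE hq i)))
    = (fun i => u (Sum.inr (Fin.castLE hq i))) ⬝ᵥ (Z.1 *ᵥ _)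
  rw [dotProduct_mulVec, ← mulVec_transpose, Z.2.1]

theorem IsIso.actSub {n : ℕ} {L : Submodule ℂ (V n)} (h : IsIso L) (g : Sp n ℚ) :
    IsIso (actSub g L) := by
  rintro _ ⟨u, hu, rfl⟩ _ ⟨v, hv, rfl⟩
  exact (om_cLin g u v).trans (h u hu v hv)

theorem IsNonneg.actSub {n : ℕ} {L : Submodule ℂ (V n)} (h : IsNonneg L) (g : Sp n ℚ) :
    IsNonneg (actSub g L) := by
  rintro _ ⟨u, hu, rfl⟩
  exact (h u hu).trans_eq (herm_cLin g u).symm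

theorem Satake.isIso {n : ℕ} (x : Satake n) : IsIso x.1 := by
  obtain ⟨L, q, hq, g, Z, rfl⟩ := x
  exact (isIso_phi hq Z).actSub g

theorem Satake.isNonneg {n : ℕ} (x : Satake n) : IsNonneg x.1 := by
  obtain ⟨L, q, hq, g, Z, rfl⟩ := x
  exact (isNonneg_phi hq Z).actSub g

/-- A Lagrangian subspace containing `W_q` on which the Hermitian form is positive off `W_q` is a
point of the standard boundary component `F_q`. -/
theorem exists_eq_phi {n q : ℕ} (hq : q ≤ n) {L : Submodule ℂ (V n)} (hiso : IsIso L)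
    (hdim : Module.finrank ℂ L = n) (hW : stdIsotropic n q ≤ L)
    (hpos : ∀ u ∈ L, herm u ≤ 0 → u ∈ stdIsotropic n q) : ∃ Z : Siegel q, L = phi hq Z := by
  have hperp : L ≤ stdIsotropicPerp n q := fun u hu =>
    mem_stdIsotropicPerp_of_om fun w hw => hiso w (hW hw) u hu
  have hinj : Function.Injective ((slot n q).comp L.subtype) := by
    rw [injective_iff_map_eq_zero]
    rintro ⟨u, hu⟩ h
    have h1 : ∀ i : Fin n, u (Sum.inr i) = 0 := fun i => by
      have h2 := congrFun h i
      simp only [LinearMap.comp_apply, Submodule.subtype_apply, slot_apply] at h2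
      split_ifs at h2 with h3
      · exact h2
      · exact hperp hu i (by omega)
    have h4 := hpos u hu (by simp [herm, h1])
    apply Subtype.ext
    ext (i | i)
    · have h2 := congrFun h i
      simp only [LinearMap.comp_apply, Submodule.subtype_apply, slot_apply] at h2
      split_ifs at h2 with h3
      · exact h4.1 i h3
      · exact h2
    · exact h1 i
  have hsurj : Function.Surjective ((slot n q).comp L.subtype) := by
    rw [← LinearMap.injective_iff_surjective_of_finrank_eq_finrank]
    · exact hinj
    · rw [hdim]; simp
  -- The normalized frame of L: the second half of e_j is the j-th unit vector, and its first half
  -- will be the j-th row of the period matrix. Isotropy of L makes that matrix symmetric.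
  choose e he using fun j : Fin q => hsurj (Pi.single (Fin.castLE hq j) 1)
  have her : ∀ j i : Fin q, (e j).1 (Sum.inr (Fin.castLE hq i)) = if i = j then 1 else 0 := by
    intro j i
    have := congrFun (he j) (Fin.castLE hq i)
    simpa [slot_apply, Pi.single_apply] using this
  have homr : ∀ u ∈ L, ∀ j, u (Sum.inl (Fin.castLE hq j))
      = ∑ i : Fin q, (e j).1 (Sum.inl (Fin.castLE hq i)) * u (Sum.inr (Fin.castLE hq i)) := by
    intro u hu j
    have h := hiso u hu (e j).1 (e j).2
    rw [om_of_mem_perp hq (hperp hu) (hperp (e j).2)] at h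
    change ∑ i : Fin q, (u (Sum.inl (Fin.castLE hq i)) * (e j).1 (Sum.inr (Fin.castLE hq i))
      - u (Sum.inr (Fin.castLE hq i)) * (e j).1 (Sum.inl (Fin.castLE hq i))) = 0 at h
    rw [Finset.sum_sub_distrib, sub_eq_zero] at h
    simp only [her, mul_ite, mul_one, mul_zero, Finset.sum_ite_eq', Finset.mem_univ, if_true] at h
    rw [h]
    exact Finset.sum_congr rfl fun i _ => mul_comm _ _
  set Z : Matrix (Fin q) (Fin q) ℂ := fun i j => (e i).1 (Sum.inl (Fin.castLE hq j)) with hZ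
  have hsymm : Z.IsSymm := by
    refine Matrix.IsSymm.ext fun i j => ?_
    have := homr (e j).1 (e j).2 i
    simpa only [her, mul_ite, mul_one, mul_zero, Finset.sum_ite_eq', Finset.mem_univ, if_true]
      using this
  have hmem : ∀ u ∈ L, (fun a => u (hIdx hq a))
      = Sum.elim (Z *ᵥ (fun j => u (Sum.inr (Fin.castLE hq j))))
        (fun j => u (Sum.inr (Fin.castLE hq j))) := by
    intro u hu
    ext (i | i)
    · exact homr u hu i
    · rfl
  have hY : (Z.map Complex.im).PosDef := by
    refine Matrix.PosDef.of_dotProduct_mulVec_pos ?_ fun x hx => ?_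
    · ext i j
      simp [hsymm.apply i j]
    · set u : V n := ∑ j, ((x j : ℝ) : ℂ) • (e j).1 with hu
      have huL : u ∈ L := Submodule.sum_mem _ fun j _ => L.smul_mem _ (e j).2
      have hur : ∀ i : Fin q, u (Sum.inr (Fin.castLE hq i)) = (x i : ℂ) := by
        intro i
        simp [hu, her]
      have h1 : herm u = x ⬝ᵥ (Z.map Complex.im *ᵥ x) := by
        rw [herm_of_mem_perp hq (hperp huL), hmem u huL, herm_of_symm hsymm]
        simp [hur, mulVec, dotProduct]
      rw [star_trivial, ← h1]
      by_contra hneg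
      refine hx (funext fun i => ?_)
      have := (hpos u huL (by linarith)).2 (Fin.castLE hq i)
      rw [hur] at this
      exact_mod_cast this
  refine ⟨⟨Z, hsymm, hY⟩, Submodule.eq_of_le_of_finrank_eq (fun u hu => ?_) ?_⟩
  · exact ⟨fun j => homr u hu j, fun i hi => hperp hu i hi⟩
  · rw [hdim, finrank_phi]

/-! ### The stabilizer of a standard boundary component -/

theorem cLin_apply {n : ℕ} (g : Sp n ℚ) (u : V n) (a : Fin n ⊕ Fin n) :
    cLin g u a = ∑ b, ((g.1 a b : ℚ) : ℂ) * u b := rfl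

theorem cLin_single {n : ℕ} (g : Sp n ℚ) (a b : Fin n ⊕ Fin n) :
    cLin g (Pi.single b 1) a = ((g.1 a b : ℚ) : ℂ) := by
  simp [cLin_apply, Pi.single_apply]

/-- An element preserving W_q also preserves its orthogonal complement, because `om` is invariant.
The two conditions together are block triangularity: entries whose row level exceeds their column
level vanish. -/
theorem blockTriangular_of_actSub_le {n q : ℕ} {g : Sp n ℚ}
    (h : actSub g (stdIsotropic n q) ≤ stdIsotropic n q) : g.1.BlockTriangular (lev n q) := by
  have heq := actSub_eq_of_le h
  intro a b hab
  suffices h' : ((g.1 a b : ℚ) : ℂ) = 0 by exact_mod_cast h'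
  rw [← cLin_single]
  by_cases hb : lev n q b = 0
  · exact mem_stdIsotropic.1 (h (cLin_mem_actSub g (single_mem_stdIsotropic hb 1))) a (by omega)
  · have h2 := lev_le_two (q := q) a
    suffices h3 : cLin g (Pi.single b 1) ∈ stdIsotropicPerp n q from
      mem_stdIsotropicPerp.1 h3 a (by omega)
    refine mem_stdIsotropicPerp_of_om fun w hw => ?_
    rw [← heq] at hw
    obtain ⟨w', hw', rfl⟩ := hw
    exact (om_cLin g w' _).trans
      (om_eq_zero_of_mem hw' (single_mem_stdIsotropicPerp (by omega) 1))

theorem cLin_mem_stdIsotropicPerp {n q : ℕ} {g : Sp n ℚ} (h : g.1.BlockTriangular (lev n q))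
    {u : V n} (hu : u ∈ stdIsotropicPerp n q) : cLin g u ∈ stdIsotropicPerp n q := by
  rw [mem_stdIsotropicPerp] at hu ⊢
  intro a ha
  rw [cLin_apply]
  refine Finset.sum_eq_zero fun b _ => ?_
  by_cases hb : lev n q b = 2
  · rw [hu b hb, mul_zero]
  · have := lev_le_two (q := q) b
    rw [h (i := a) (j := b) (by omega)]; simp

/-- The block of a matrix acting on `W_q^⊥ / W_q`. -/
def blk {n q : ℕ} (hq : q ≤ n) {R : Type*} (T : Matrix (Fin n ⊕ Fin n) (Fin n ⊕ Fin n) R) :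
    Matrix (Fin q ⊕ Fin q) (Fin q ⊕ Fin q) R := T.submatrix (hIdx hq) (hIdx hq)

theorem cLin_hIdx {n q : ℕ} (hq : q ≤ n) {g : Sp n ℚ} (h : g.1.BlockTriangular (lev n q))
    {u : V n} (hu : u ∈ stdIsotropicPerp n q) :
    (fun b => cLin g u (hIdx hq b))
      = (blk hq g.1).map (algebraMap ℚ ℂ) *ᵥ (fun b => u (hIdx hq b)) := by
  ext b
  rw [cLin_apply, sum_hIdx hq]
  · rfl
  · intro a ha
    by_cases h2 : lev n q a = 2
    · rw [mem_stdIsotropicPerp.1 hu a h2, mul_zero]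
    · have := lev_le_two (q := q) a
      rw [h (i := hIdx hq b) (j := a) (by rw [lev_hIdx]; omega)]; simp

/-- The matrix `T = (A B; C D)` satisfies `A Z₁ + B = Z₂ (C Z₁ + D)`. -/
def Rel {q : ℕ} (T : Matrix (Fin q ⊕ Fin q) (Fin q ⊕ Fin q) ℂ) (Z₁ Z₂ : Siegel q) : Prop :=
  T.toBlocks₁₁ * Z₁.1 + T.toBlocks₁₂ = Z₂.1 * (T.toBlocks₂₁ * Z₁.1 + T.toBlocks₂₂)

theorem phi_eq_of_le {n q : ℕ} {hq : q ≤ n} {g : Sp n ℚ} {Z₁ Z₂ : Siegel q}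
    (h : actSub g (phi hq Z₁) ≤ phi hq Z₂) : actSub g (phi hq Z₁) = phi hq Z₂ := by
  refine Submodule.eq_of_le_of_finrank_eq h ?_
  rw [finrank_actSub, finrank_phi, finrank_phi]

theorem blocks_mulVec {q : ℕ} (T : Matrix (Fin q ⊕ Fin q) (Fin q ⊕ Fin q) ℂ)
    (Z : Matrix (Fin q) (Fin q) ℂ) (c : Fin q → ℂ) :
    T *ᵥ (Sum.elim (Z *ᵥ c) c) = Sum.elim ((T.toBlocks₁₁ * Z + T.toBlocks₁₂) *ᵥ c)
      ((T.toBlocks₂₁ * Z + T.toBlocks₂₂) *ᵥ c) := by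
  conv_lhs => rw [← fromBlocks_toBlocks T, fromBlocks_mulVec]
  simp [add_mulVec]

theorem phi_hIdx {n q : ℕ} {hq : q ≤ n} {Z : Siegel q} {u : V n} (hu : u ∈ phi hq Z) :
    (fun b => u (hIdx hq b)) = Sum.elim (Z.1 *ᵥ (fun j => u (Sum.inr (Fin.castLE hq j))))
      (fun j => u (Sum.inr (Fin.castLE hq j))) := by
  ext (i | i)
  · exact hu.1 i
  · rfl

/-- In W_q^⊥/W_q the point φ(Z) is the graph of Z, and only the middle block of g acts there.
Writing the fractional linear action as `Rel` avoids inverting CZ + D. -/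
theorem actSub_phi_iff {n q : ℕ} (hq : q ≤ n) {g : Sp n ℚ} (h : g.1.BlockTriangular (lev n q))
    (Z₁ Z₂ : Siegel q) :
    actSub g (phi hq Z₁) = phi hq Z₂ ↔ Rel ((blk hq g.1).map (algebraMap ℚ ℂ)) Z₁ Z₂ := by
  set T := (blk hq g.1).map (algebraMap ℚ ℂ) with hT
  have key : ∀ u ∈ phi hq Z₁, (fun b => cLin g u (hIdx hq b))
      = Sum.elim ((T.toBlocks₁₁ * Z₁.1 + T.toBlocks₁₂) *ᵥ (fun j => u (Sum.inr (Fin.castLE hq j))))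
      ((T.toBlocks₂₁ * Z₁.1 + T.toBlocks₂₂) *ᵥ (fun j => u (Sum.inr (Fin.castLE hq j)))) := by
    intro u hu
    rw [cLin_hIdx hq h (phi_le_stdIsotropicPerp hq Z₁ hu), ← hT, phi_hIdx hu, blocks_mulVec]
  constructor
  · intro heq
    unfold Rel
    refine Matrix.ext_of_mulVec_single fun j => ?_
    set c : Fin q → ℂ := Pi.single j 1
    have hu := phiVec_mem hq Z₁ c
    have h1 := key _ hu
    have h2 : cLin g (phiVec Z₁ c) ∈ phi hq Z₂ := heq ▸ cLin_mem_actSub g hu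
    rw [mem_phi] at h2
    have h3 := h2.1
    simp only [phiVec_inr] at h1
    rw [← Matrix.mulVec_mulVec]
    have ha : (fun i => cLin g (phiVec Z₁ c) (Sum.inl (Fin.castLE hq i)))
        = (T.toBlocks₁₁ * Z₁.1 + T.toBlocks₁₂) *ᵥ c := by
      ext i; exact congrFun h1 (Sum.inl i)
    have hb : (fun i => cLin g (phiVec Z₁ c) (Sum.inr (Fin.castLE hq i)))
        = (T.toBlocks₂₁ * Z₁.1 + T.toBlocks₂₂) *ᵥ c := by
      ext i; exact congrFun h1 (Sum.inr i)
    rw [← ha, ← hb, h3]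
  · intro hR
    refine phi_eq_of_le ?_
    rintro _ ⟨u, hu, rfl⟩
    have h1 := key u hu
    set c := fun j => u (Sum.inr (Fin.castLE hq j))
    have ha : (fun i => cLin g u (Sum.inl (Fin.castLE hq i)))
        = (T.toBlocks₁₁ * Z₁.1 + T.toBlocks₁₂) *ᵥ c := by
      ext i; exact congrFun h1 (Sum.inl i)
    have hb : (fun i => cLin g u (Sum.inr (Fin.castLE hq i)))
        = (T.toBlocks₂₁ * Z₁.1 + T.toBlocks₂₂) *ᵥ c := by
      ext i; exact congrFun h1 (Sum.inr i)
    refine mem_phi.2 ⟨?_, cLin_mem_stdIsotropicPerp h (phi_le_stdIsotropicPerp hq Z₁ hu)⟩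
    change (fun i => cLin g u (Sum.inl (Fin.castLE hq i)))
      = Z₂.1 *ᵥ (fun i => cLin g u (Sum.inr (Fin.castLE hq i)))
    rw [ha, hb, hR, Matrix.mulVec_mulVec]

/-- An element carrying a point of `F_q` to a point of `F_q` stabilizes `W_q`. -/
theorem blockTriangular_of_actSub_phi {n q : ℕ} {hq : q ≤ n} {g : Sp n ℚ} {Z₁ Z₂ : Siegel q}
    (h : actSub g (phi hq Z₁) = phi hq Z₂) : g.1.BlockTriangular (lev n q) := by
  refine blockTriangular_of_actSub_le ?_
  rintro _ ⟨u, hu, rfl⟩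
  refine mem_stdIsotropic_of_herm (hq := hq) (Z := Z₂) ?_ ?_
  · rw [← h]; exact ⟨u, stdIsotropic_le_phi hq Z₁ hu, rfl⟩
  · change herm (cLin g u) ≤ 0
    rw [herm_cLin]
    simp [herm, hu.2]

/-- The stabilizer of `W_q` acts on `F_q`. -/
theorem exists_actSub_phi {n q : ℕ} (hq : q ≤ n) {g : Sp n ℚ}
    (h : actSub g (stdIsotropic n q) = stdIsotropic n q) (Z : Siegel q) :
    ∃ Z' : Siegel q, actSub g (phi hq Z) = phi hq Z' := by
  refine exists_eq_phi hq ((isIso_phi hq Z).actSub g) ?_ ?_ ?_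
  · rw [finrank_actSub, finrank_phi]
  · rw [← h]; exact actSub_mono g (stdIsotropic_le_phi hq Z)
  · rintro _ ⟨u, hu, rfl⟩ hle
    rw [← h]
    refine cLin_mem_actSub g (mem_stdIsotropic_of_herm hu ?_)
    rw [← herm_cLin g]; exact hle

theorem exists_smul_incl {n : ℕ} (g : Sp n ℚ) (Z : Siegel n) :
    ∃ Z' : Siegel n, g • incl Z = incl Z' := by
  have h0 : stdIsotropic n n = ⊥ := by
    rw [eq_bot_iff]
    intro u hu
    rw [Submodule.mem_bot]
    ext (i | i)
    · exact hu.1 i i.2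
    · exact hu.2 i
  obtain ⟨Z', h⟩ := exists_actSub_phi le_rfl (g := g) (q := n) (by simp [h0, actSub]) Z
  exact ⟨Z', Subtype.ext h⟩

/-- Two points related as `τ(Z) = γ Z` in the Satake compactification are related by the fractional
linear action. -/
theorem mem_siegelRealPoints {n : ℕ} {γ : Sp n ℤ} {Z : Siegel n}
    (h : (incl Z).tau = γ • incl Z) : Z ∈ siegelRealPoints γ := by
  have h1 : actSub (toRat γ) (phi le_rfl Z) = phi le_rfl Z.tau := by
    rw [← tauSub_phi]
    exact (congrArg Subtype.val h).symm
  have hbt := blockTriangular_of_actSub_phi h1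
  rw [actSub_phi_iff _ hbt] at h1
  have hm : (blk le_rfl (toRat γ).1).map (algebraMap ℚ ℂ) = γ.1.map (Int.castRingHom ℂ) := by
    ext (i | i) (j | j) <;> simp [blk, hIdx, toRat]
  rw [hm] at h1
  change (_ * Z.1 + _) * (_ * Z.1 + _)⁻¹ = Z.tau.1
  set T := γ.1.map (Int.castRingHom ℂ) with hT
  unfold Rel at h1
  rw [h1]
  -- Invertibility of CZ + D: if it kills c, the relation shows that AZ + B kills c as well, so the
  -- invertible matrix T kills (Zc, c).
  refine Matrix.mul_nonsing_inv_cancel_right _ _ ?_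
  rw [← Matrix.isUnit_iff_isUnit_det, ← Matrix.mulVec_injective_iff_isUnit,
    ← Matrix.coe_mulVecLin, injective_iff_map_eq_zero]
  intro c hc
  rw [Matrix.mulVecLin_apply] at hc
  have h2 : T *ᵥ (Sum.elim (Z.1 *ᵥ c) c) = 0 := by
    rw [blocks_mulVec, h1, ← Matrix.mulVec_mulVec, hc, Matrix.mulVec_zero]
    ext (i | i) <;> rfl
  have h3 : Function.Injective (T *ᵥ ·) := by
    rw [Matrix.mulVec_injective_iff_isUnit, Matrix.isUnit_iff_isUnit_det]
    exact SymplecticGroup.symplectic_det (SymplecticGroup.map_mem γ.2 _)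
  have h4 : Sum.elim (Z.1 *ᵥ c) c = 0 := h3 (by simpa using h2)
  ext i
  exact congrFun h4 (Sum.inr i)

/-! ### Bounds that are locally uniform on `𝔥_q` -/

/-- With Z = X + iY and c = (y + ib)/2, twice the real part of (Zc, c) is (Xy - Yb, y). Solving Xy -
Yb = x gives b = Y⁻¹(Xy - x), so every real vector (x, y) is l + l̄ for an l depending continuously
on Z. -/
theorem exists_decomp {n q : ℕ} (hq : q ≤ n) (Z : Siegel q) (x y : Fin q → ℝ) :
    (∀ i : Fin q ⊕ Fin q, phiVec (n := n) Z (fun i => ((y i / 2 : ℝ) : ℂ) + Complex.I *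
        ((((Z.1.map Complex.im)⁻¹ *ᵥ (Z.1.map Complex.re *ᵥ y - x)) i / 2 : ℝ) : ℂ)) (hIdx hq i)
      + cj (phiVec (n := n) Z (fun i => ((y i / 2 : ℝ) : ℂ) + Complex.I *
        ((((Z.1.map Complex.im)⁻¹ *ᵥ (Z.1.map Complex.re *ᵥ y - x)) i / 2 : ℝ) : ℂ))) (hIdx hq i)
      = ((Sum.elim x y i : ℝ) : ℂ)) := by
  set b : Fin q → ℝ := (Z.1.map Complex.im)⁻¹ *ᵥ (Z.1.map Complex.re *ᵥ y - x) with hb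
  have hYb : Z.1.map Complex.im *ᵥ b = Z.1.map Complex.re *ᵥ y - x := by
    rw [hb, Matrix.mulVec_mulVec, Matrix.mul_nonsing_inv _
      ((Matrix.isUnit_iff_isUnit_det _).1 Z.2.2.isUnit), Matrix.one_mulVec]
  rintro (i | i)
  · have h1 := congrFun hYb i
    simp only [cj, hIdx, Sum.map_inl, phiVec_inl, Complex.add_conj, Sum.elim_inl]
    norm_cast
    simp only [mulVec, dotProduct, Matrix.map_apply, Pi.sub_apply] at h1
    have h2 : ∑ j, Z.1 i j * (((y j / 2 : ℝ) : ℂ) + Complex.I * ((b j / 2 : ℝ) : ℂ)) =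
      ((∑ j, (Z.1 i j).re * y j - ∑ j, (Z.1 i j).im * b j) / 2 : ℝ)
      + Complex.I * ((∑ j, (Z.1 i j).im * y j + ∑ j, (Z.1 i j).re * b j) / 2 : ℝ) := by
      rw [← Finset.sum_sub_distrib, ← Finset.sum_add_distrib, Finset.sum_div, Finset.sum_div]
      push_cast
      rw [Finset.mul_sum, ← Finset.sum_add_distrib]
      refine Finset.sum_congr rfl fun j _ => ?_
      conv_lhs => rw [← Complex.re_add_im (Z.1 i j)]
      ring_nf
      rw [Complex.I_sq]
      ring
    simp only [mulVec, dotProduct]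
    rw [h2, h1]
    simp
    ring
  · simp only [cj, hIdx, Sum.map_inr, phiVec_inr, Complex.add_conj, Sum.elim_inr]
    simp
    ring

/-- Each coordinate vector of `W_q^⊥ / W_q` is `l + l̄` for some `l ∈ φ(Z)` with `herm l ≤ b`. -/
def Good {q : ℕ} (n : ℕ) (hq : q ≤ n) (b : ℝ) (Z : Siegel q) : Prop :=
  ∀ i : Fin q ⊕ Fin q, ∃ l ∈ phi hq Z,
    (l + cj l = Pi.single (hIdx hq i) 1) ∧ herm l ≤ b

theorem hIdx_injective {n q : ℕ} (hq : q ≤ n) : Function.Injective (hIdx hq) :=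
  Sum.map_injective.2 ⟨Fin.castLE_injective hq, Fin.castLE_injective hq⟩

theorem continuous_inv_im {q : ℕ} : Continuous fun Z : Siegel q => (Z.1.map Complex.im)⁻¹ := by
  have hc : Continuous fun Z : Siegel q => Z.1.map Complex.im :=
    continuous_subtype_val.matrix_map Complex.continuous_im
  simp only [Matrix.inv_def, Ring.inverse_eq_inv']
  refine Continuous.smul (Continuous.inv₀ hc.matrix_det fun Z => ?_) hc.matrix_adjugate
  exact ((Matrix.isUnit_iff_isUnit_det _).1 Z.2.2.isUnit).ne_zero

/-- The explicit l of `exists_decomp` and its Hermitian norm are continuous in Z, so finitely many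
strict bounds at Z persist nearby. The maximum with 1 only makes the bound positive. -/
theorem eventually_good {n q : ℕ} (hq : q ≤ n) (Z : Siegel q) :
    ∃ b : ℝ, 0 < b ∧ ∀ᶠ Z' in 𝓝 Z, Good n hq b Z' := by
  set f : (Fin q ⊕ Fin q) → Siegel q → (Fin q → ℂ) := fun k Z => fun i =>
    ((((Pi.single k 1 : Fin q ⊕ Fin q → ℝ) (Sum.inr i)) / 2 : ℝ) : ℂ) + Complex.I *
        ((((Z.1.map Complex.im)⁻¹ *ᵥ (Z.1.map Complex.re *ᵥ
        (fun i => (Pi.single k 1 : Fin q ⊕ Fin q → ℝ) (Sum.inr i)) -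
        (fun i => (Pi.single k 1 : Fin q ⊕ Fin q → ℝ) (Sum.inl i)))) i / 2 : ℝ) : ℂ) with hf
  have hfc : ∀ k, Continuous (f k) := by
    intro k
    have hc : Continuous fun Z : Siegel q => Z.1.map Complex.re :=
      continuous_subtype_val.matrix_map Complex.continuous_re
    have h1 : Continuous fun Z : Siegel q => (Z.1.map Complex.im)⁻¹ *ᵥ (Z.1.map Complex.re *ᵥ
        (fun i => (Pi.single k 1 : Fin q ⊕ Fin q → ℝ) (Sum.inr i)) -
        (fun i => (Pi.single k 1 : Fin q ⊕ Fin q → ℝ) (Sum.inl i))) :=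
      continuous_inv_im.matrix_mulVec ((hc.matrix_mulVec continuous_const).sub continuous_const)
    refine continuous_pi fun i => continuous_const.add (continuous_const.mul ?_)
    exact Complex.continuous_ofReal.comp (((continuous_apply i).comp h1).div_const 2)
  have hh : ∀ k, Continuous fun Z : Siegel q => herm (Sum.elim (Z.1 *ᵥ f k Z) (f k Z)) := by
    intro k
    have h1 : Continuous fun Z : Siegel q => Z.1 *ᵥ f k Z :=
      continuous_subtype_val.matrix_mulVec (hfc k)
    unfold herm
    refine Complex.continuous_im.comp (continuous_finsetSum _ fun i _ => ?_)
    exact ((continuous_apply i).comp h1).mul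
      (Complex.continuous_conj.comp ((continuous_apply i).comp (hfc k)))
  obtain ⟨b, hb⟩ : ∃ b : ℝ, ∀ k, herm (Sum.elim (Z.1 *ᵥ f k Z) (f k Z)) < b := by
    obtain ⟨b, hb⟩ := (Set.finite_range fun k => herm (Sum.elim (Z.1 *ᵥ f k Z) (f k Z))).bddAbove
    exact ⟨b + 1, fun k => (hb ⟨k, rfl⟩).trans_lt (by linarith)⟩
  refine ⟨max b 1, by positivity, ?_⟩
  have hev : ∀ᶠ Z' in 𝓝 Z, ∀ k, herm (Sum.elim (Z'.1 *ᵥ f k Z') (f k Z')) < b :=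
    Filter.eventually_all.2 fun k => (hh k).continuousAt.eventually_lt continuousAt_const (hb k)
  filter_upwards [hev] with Z' hZ' k
  refine ⟨phiVec Z' (f k Z'), phiVec_mem hq Z' _, ?_, ?_⟩
  · have h1 := exists_decomp hq Z' (fun i => (Pi.single k 1 : Fin q ⊕ Fin q → ℝ) (Sum.inl i))
      (fun i => (Pi.single k 1 : Fin q ⊕ Fin q → ℝ) (Sum.inr i))
    ext a
    by_cases ha : lev n q a = 1
    · obtain ⟨i, rfl⟩ := exists_hIdx hq ha
      refine (h1 i).trans ?_
      have h2 : (Pi.single (hIdx hq k) 1 : V n) (hIdx hq i) = (Pi.single k 1 : _ → ℂ) i := by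
        simp only [Pi.single_apply, (hIdx_injective hq).eq_iff]
      rw [h2]
      rcases i with i | i <;> simp only [Sum.elim_inl, Sum.elim_inr, Pi.single_apply] <;>
        split_ifs <;> simp
    · rw [Pi.single_eq_of_ne (by rintro rfl; exact ha (lev_hIdx hq k))]
      simp [cj, phiVec_eq_zero Z' _ ha]
  · rw [herm_of_mem_phi (phiVec_mem hq Z' _)]
    simp only [phiVec_inr]
    exact (hZ' k).le.trans (le_max_left _ _)

/-- The coordinates of `W_q^⊥ / W_q` are bounded on `φ(Z)` by the Hermitian form. -/
theorem Good.norm_sq_le {n q : ℕ} {hq : q ≤ n} {b : ℝ} {Z : Siegel q} (hZ : Good n hq b Z)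
    {u : V n} (hu : u ∈ phi hq Z) (i : Fin q ⊕ Fin q) :
    ‖u (hIdx hq i)‖ ^ 2 ≤ 4 * b * herm u := by
  have key : ∀ k : Fin q ⊕ Fin q,
      ‖om (Pi.single (hIdx hq k) 1) (cj u)‖ ^ 2 ≤ 4 * b * herm u := by
    intro k
    obtain ⟨l, hl, h1, h2⟩ := hZ k
    -- A coordinate of u is, up to sign and conjugation, the pairing of a unit vector l + l̄ with ū.
    -- Isotropy removes the l̄ term, and Cauchy–Schwarz bounds the other.
    rw [← h1, om_add_left, om_cj, isIso_phi hq Z l hl u hu, map_zero, add_zero]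
    refine ((isNonneg_phi hq Z).norm_om_cj_sq_le hl hu).trans ?_
    have := isNonneg_phi hq Z u hu
    gcongr
  rcases i with i | i
  · have := key (Sum.inr i)
    simpa [hIdx, om_single_inr, cj] using this
  · have := key (Sum.inl i)
    simpa [hIdx, om_single_inl, cj] using this

/-- A middle entry of g is a coordinate of gl plus its conjugate, where l + l̄ is a unit vector and
`herm l ≤ b`. As g preserves `herm`, each summand is at most 2b. -/
theorem norm_entry_le {n q : ℕ} {hq : q ≤ n} {b : ℝ} (hb : 0 ≤ b) {Z₁ : Siegel q}
    {L : Submodule ℂ (V n)}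
    (h₁ : Good n hq b Z₁) (h₂ : ∀ u ∈ L, ∀ i, ‖u (hIdx hq i)‖ ^ 2 ≤ 4 * b * herm u) {g : Sp n ℚ}
    (hg : actSub g (phi hq Z₁) ≤ L) (i j : Fin q ⊕ Fin q) :
    |((g.1 (hIdx hq i) (hIdx hq j) : ℚ) : ℝ)| ≤ 4 * b := by
  obtain ⟨l, hl, hl1, hl2⟩ := h₁ j
  have h3 := h₂ _ (hg (cLin_mem_actSub g hl)) i
  rw [herm_cLin] at h3
  have h4 : ‖cLin g l (hIdx hq i)‖ ≤ 2 * b := by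
    refine le_of_sq_le_sq ?_ (by positivity)
    nlinarith
  have h5 : ((g.1 (hIdx hq i) (hIdx hq j) : ℚ) : ℂ)
      = cLin g l (hIdx hq i) + (starRingEnd ℂ) (cLin g l (hIdx hq i)) := by
    rw [← cLin_single, ← hl1, map_add, cLin_cj]
    rfl
  have h6 : |((g.1 (hIdx hq i) (hIdx hq j) : ℚ) : ℝ)|
      = ‖((g.1 (hIdx hq i) (hIdx hq j) : ℚ) : ℂ)‖ := by
    rw [Complex.norm_ratCast]
  rw [h6, h5]
  refine (norm_add_le _ _).trans ?_
  rw [RCLike.norm_conj]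
  linarith

/-! ### The real points of the Baily-Borel compactification form a closed set -/

theorem exists_common_denominator {ι : Type*} [Finite ι] (M : Matrix ι ι ℚ) :
    ∃ d : ℕ, 0 < d ∧ ∃ G : Matrix ι ι ℤ, (d : ℚ) • M = G.map (Int.castRingHom ℚ) := by
  cases nonempty_fintype ι
  refine ⟨∏ x : ι × ι, (M x.1 x.2).den, Finset.prod_pos fun x _ => (M x.1 x.2).den_pos, ?_⟩
  have h : ∀ i j, ∃ m : ℤ, ((∏ x : ι × ι, (M x.1 x.2).den : ℕ) : ℚ) * M i j = m := by
    intro i j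
    obtain ⟨c, hc⟩ := Finset.dvd_prod_of_mem (fun x : ι × ι => (M x.1 x.2).den)
      (Finset.mem_univ (i, j))
    refine ⟨c * (M i j).num, ?_⟩
    rw [hc]
    push_cast
    rw [mul_comm ((M i j).den : ℚ), mul_assoc, mul_comm ((M i j).den : ℚ), Rat.mul_den_eq_num]
  choose G hG using h
  refine ⟨G, ?_⟩
  ext i j
  exact hG i j

/-! ### Integral pairings smaller than one vanish. -/

theorem om_int {n : ℕ} (a b : Fin n ⊕ Fin n → ℤ) :
    ∃ m : ℤ, om (fun i => (a i : ℂ)) (fun i => (b i : ℂ)) = m :=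
  ⟨∑ i, (a (Sum.inl i) * b (Sum.inr i) - a (Sum.inr i) * b (Sum.inl i)), by
    simp [om]⟩

/-- Isotropy kills two of the four terms of the pairing; the others are conjugate up to sign,
leaving twice the real part of `om l (cj m)`. The constant 16 is 2² times the 4 of Cauchy–Schwarz.
-/
theorem norm_om_real_sq_le {n : ℕ} {L : Submodule ℂ (V n)} (hiso : IsIso L) (hL : IsNonneg L)
    {l m : V n} (hl : l ∈ L) (hm : m ∈ L) {a b : ℝ} (ha : herm l ≤ a) (hb : herm m ≤ b) :
    ‖om (l + cj l) (m + cj m)‖ ^ 2 ≤ 16 * a * b := by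
  have h1 : om (l + cj l) (m + cj m) = om l (cj m) + (starRingEnd ℂ) (om l (cj m)) := by
    rw [om_add_left, om_add_right, om_add_right, hiso l hl m hm, om_cj, hiso l hl m hm,
      ← om_cj l (cj m), cj_cj]
    simp
  have h2 : ‖om (l + cj l) (m + cj m)‖ ≤ 2 * ‖om l (cj m)‖ := by
    rw [h1]
    refine (norm_add_le _ _).trans_eq ?_
    rw [RCLike.norm_conj, two_mul]
  have h3 := hL.norm_om_cj_sq_le hl hm
  have h4 : herm l * herm m ≤ a * b :=
    mul_le_mul ha hb (hL m hm) ((hL l hl).trans ha)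
  calc ‖om (l + cj l) (m + cj m)‖ ^ 2 ≤ (2 * ‖om l (cj m)‖) ^ 2 := by gcongr
    _ ≤ 16 * a * b := by nlinarith

theorem eq_zero_of_norm_sq_lt_one {z : ℂ} (h : ∃ m : ℤ, z = m) (hz : ‖z‖ ^ 2 < 1) : z = 0 := by
  obtain ⟨m, rfl⟩ := h
  rw [Complex.norm_intCast, sq_abs] at hz
  have h1 : m ^ 2 < 1 := by exact_mod_cast hz
  have h2 : m = 0 := by nlinarith [sq_nonneg (m - 1), sq_nonneg (m + 1)]
  simp [h2]

theorem mem_reduce {n q : ℕ} {L : Submodule ℂ (V n)} {u : V n} :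
    u ∈ reduce q L ↔ ∃ m ∈ L, m ∈ stdIsotropicPerp n q ∧ ∃ w ∈ stdIsotropic n q, m + w = u := by
  unfold reduce
  rw [Submodule.mem_sup]
  constructor
  · rintro ⟨m, hm, w, hw, h⟩; exact ⟨m, hm.1, hm.2, w, hw, h⟩
  · rintro ⟨m, hm, hm', w, hw, h⟩; exact ⟨m, ⟨hm, hm'⟩, w, hw, h⟩

theorem om_cj_eq_zero {n q : ℕ} {u w : V n} (hu : u ∈ stdIsotropicPerp n q)
    (hw : w ∈ stdIsotropic n q) : om u (cj w) = 0 := by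
  rw [om_swap, om_eq_zero_of_mem (cj_mem_stdIsotropic hw) hu, neg_zero]

/-- A short integral vector of a point close to `F_q` lies in `W_q`. -/
theorem short_mem_stdIsotropic {n q : ℕ} {hq : q ≤ n} {b ε ε' : ℝ} {Z : Siegel q}
    (hZ : Good n hq b Z) {y : Satake n} (hy : y ∈ basicNhd hq {Z} ε)
    (h1 : 16 * ε' * ε < 1) (h2 : 16 * ε' * b < 1) {l : V n} (hl : l ∈ y.1)
    (hle : herm l ≤ ε') {a : Fin n ⊕ Fin n → ℤ} (ha : l + cj l = fun i => (a i : ℂ)) :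
    l + cj l ∈ stdIsotropic n q := by
  obtain ⟨⟨_, rfl, hred⟩, hspan⟩ := hy
  -- The short integral vectors span W_q, and each has an integral pairing with l + l̄ of absolute
  -- value less than one.
  have hperp : l + cj l ∈ stdIsotropicPerp n q := by
    refine mem_stdIsotropicPerp_of_om fun w hw => ?_
    rw [← hspan] at hw
    induction hw using Submodule.span_induction with
    | mem v hv =>
      obtain ⟨-, ⟨c, hc⟩, m, hm, hmv, hmε⟩ := hv
      have hv' : v = m + cj m := by ext i; exact (hmv i).symm
      refine eq_zero_of_norm_sq_lt_one ?_ ?_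
      · rw [ha, hc]; exact om_int _ _
      · rw [om_swap, norm_neg, hv']
        exact (norm_om_real_sq_le y.isIso y.isNonneg hl hm hle hmε.le).trans_lt h1
    | zero => simp [om]
    | add u v _ _ hu hv => rw [om_add_left, hu, hv, add_zero]
    | smul c u _ hu => rw [om_smul_left, hu, mul_zero]
  -- The same argument against the unit vectors of W_q^⊥/W_q, which are not small but of size at
  -- most b; hence the second smallness hypothesis.
  have key : ∀ i : Fin q ⊕ Fin q, om (l + cj l) (Pi.single (hIdx hq i) 1) = 0 := by
    intro i
    obtain ⟨m, hm, hme, hmb⟩ := hZ i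
    refine eq_zero_of_norm_sq_lt_one ?_ ?_
    · rw [ha]
      obtain ⟨k, hk⟩ := om_int a (Pi.single (hIdx hq i) 1)
      refine ⟨k, ?_⟩
      rw [← hk]
      congr 1
      ext j
      simp only [Pi.single_apply]
      split_ifs <;> simp
    · rw [← hred, mem_reduce] at hm
      obtain ⟨m', hm', hm'p, w, hw, rfl⟩ := hm
      -- The representative m of φ(Z) is replaced by m' in y. They differ by an element of W_q,
      -- which affects neither the pairing with W_q^⊥ nor the Hermitian norm.
      have h3 : om (l + cj l) (Pi.single (hIdx hq i) 1) = om (l + cj l) (m' + cj m') := by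
        rw [← hme, cj_add, om_add_right, om_add_right, om_add_right, om_add_right,
          om_cj_eq_zero hperp hw, om_swap w, om_eq_zero_of_mem hw hperp]
        ring
      have h4 : herm m' ≤ b := by
        rw [herm_add, om_cj_eq_zero hm'p hw] at hmb
        have : herm w = 0 := by simp [herm, hw.2]
        rw [this] at hmb
        simpa using hmb
      rw [h3]
      exact (norm_om_real_sq_le y.isIso y.isNonneg hl hm' hle h4).trans_lt h2
  rw [mem_stdIsotropic]
  intro c hc
  by_cases hc2 : lev n q c = 2
  · exact mem_stdIsotropicPerp.1 hperp c hc2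
  · have := lev_le_two (q := q) c
    obtain ⟨i, rfl⟩ := exists_hIdx hq (a := c) (by omega)
    rcases i with i | i
    · have h5 := key (Sum.inr i)
      rw [om_swap] at h5
      simp only [hIdx, Sum.map_inr, Sum.map_inl] at h5 ⊢
      rw [om_single_inr] at h5
      simpa using h5
    · have h5 := key (Sum.inl i)
      rw [om_swap] at h5
      simp only [hIdx, Sum.map_inr, Sum.map_inl] at h5 ⊢
      rw [om_single_inl] at h5
      exact neg_eq_zero.1 h5

theorem mem_tauSub {n : ℕ} {L : Submodule ℂ (V n)} {u : V n} :
    u ∈ tauSub L ↔ sigma n u ∈ L := Iff.rfl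

theorem sigma_mem_stdIsotropicPerp {n q : ℕ} {u : V n} (hu : u ∈ stdIsotropicPerp n q) :
    sigma n u ∈ stdIsotropicPerp n q := fun i hi => by simp [sigma, hu i hi]

/-- If `δ` has bounded denominators and `δ y = τ y` for some `y` close to `φ(Z)` that projects to
`φ(Z)`, then `δ` stabilizes `W_q`. -/
theorem actSub_stdIsotropic_le {n q : ℕ} {hq : q ≤ n} {b ε : ℝ} {Z : Siegel q} {D : ℕ}
    (hD : 0 < D) (hZ : Good n hq b Z) {y : Satake n} (hy : y ∈ basicNhd hq {Z} ε)
    (h1 : 16 * (D ^ 2 * ε) * ε < 1) (h2 : 16 * (D ^ 2 * ε) * b < 1) {δ : Sp n ℚ}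
    {G : Matrix (Fin n ⊕ Fin n) (Fin n ⊕ Fin n) ℤ}
    (hG : (D : ℚ) • δ.1 = G.map (Int.castRingHom ℚ)) (hδ : actSub δ y.1 = tauSub y.1) :
    actSub δ (stdIsotropic n q) ≤ stdIsotropic n q := by
  suffices h : stdIsotropic n q ≤ (stdIsotropic n q).comap (cLin δ) from Submodule.map_le_iff_le_comap.2 h
  conv_lhs => rw [← hy.2]
  refine Submodule.span_le.2 fun v hv => ?_
  obtain ⟨hvW, ⟨a, ha⟩, l, hl, hlv, hlε⟩ := hv
  have hv' : v = l + cj l := by ext i; exact (hlv i).symm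
  change cLin δ v ∈ stdIsotropic n q
  have hDC : (D : ℂ) ≠ 0 := by exact_mod_cast hD.ne'
  -- Since δy = τy, the vector σ(Dδl) is again in y. Its double real part is Dδv up to signs, hence
  -- integral, and its Hermitian norm is that of l multiplied by D².
  set l' : V n := sigma n ((D : ℂ) • cLin δ l) with hl'
  have hl'y : l' ∈ y.1 := by
    refine mem_tauSub.1 (Submodule.smul_mem _ _ ?_)
    rw [← hδ]
    exact cLin_mem_actSub δ hl
  have hherm : herm l' ≤ D ^ 2 * ε := by
    rw [hl', herm_sigma, herm_smul, herm_cLin, Complex.normSq_natCast, ← sq]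
    gcongr
  have hsum : l' + cj l' = sigma n ((D : ℂ) • cLin δ v) := by
    rw [hl', cj_sigma, cj_smul, ← cLin_cj, ← map_add, hv', map_add (cLin δ), smul_add]
    simp
  have hint : (D : ℂ) • cLin δ v = fun i => ((G *ᵥ a) i : ℂ) := by
    ext i
    simp only [Pi.smul_apply, smul_eq_mul, cLin_apply, mulVec, dotProduct, Finset.mul_sum, ha,
      Int.cast_sum, Int.cast_mul]
    refine Finset.sum_congr rfl fun j _ => ?_
    have h3 := congrFun (congrFun hG i) j
    simp only [Matrix.smul_apply, Matrix.map_apply, smul_eq_mul] at h3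
    have h4 : (D : ℂ) * ((δ.1 i j : ℚ) : ℂ) = (G i j : ℂ) := by
      have := congrArg (fun x : ℚ => (x : ℂ)) h3
      simpa using this
    rw [← mul_assoc, h4]
  have hmem := short_mem_stdIsotropic hZ hy h1 h2 hl'y hherm
    (a := Sum.elim (fun i => -(G *ᵥ a) (Sum.inl i)) (fun i => (G *ᵥ a) (Sum.inr i))) (by
      rw [hsum, hint]
      ext (i | i) <;> simp [sigma])
  rw [hsum] at hmem
  have h5 := sigma_mem_stdIsotropic hmem
  rw [sigma_sigma] at h5
  exact (Submodule.smul_mem_iff _ hDC).1 h5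

/-- The reduction L ↦ (L ∩ W_q^⊥) + W_q is compatible with τ and with the stabilizer of W_q, so
reality of a nearby point descends to its projection on F_q. -/
theorem actSub_phi_of_reduce {n q : ℕ} {hq : q ≤ n} {Z : Siegel q} {L : Submodule ℂ (V n)}
    (hL : reduce q L = phi hq Z) {δ : Sp n ℚ} (hδ : actSub δ L = tauSub L)
    (hW : actSub δ (stdIsotropic n q) ≤ stdIsotropic n q) :
    actSub δ (phi hq Z) = phi hq Z.tau := by
  have hbt := blockTriangular_of_actSub_le hW
  refine phi_eq_of_le ?_
  rintro _ ⟨u, hu, rfl⟩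
  rw [← tauSub_phi]
  rw [← hL] at hu ⊢
  obtain ⟨m, hm, hmp, w, hw, rfl⟩ := mem_reduce.1 hu
  change sigma n (cLin δ (m + w)) ∈ reduce q L
  refine mem_reduce.2 ⟨sigma n (cLin δ m), ?_, ?_, sigma n (cLin δ w), ?_, ?_⟩
  · refine mem_tauSub.1 ?_
    rw [← hδ]
    exact cLin_mem_actSub δ hm
  · exact sigma_mem_stdIsotropicPerp (cLin_mem_stdIsotropicPerp hbt hmp)
  · exact sigma_mem_stdIsotropic (hW (cLin_mem_actSub δ hw))
  · rw [← map_add, ← map_add]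

/-- Pulling back by g replaces γ by τ(g)⁻¹γg; the left factor is τ(g) because τ(gy) = τ(g)τ(y). -/
theorem tau_smul_eq_iff {n : ℕ} (g : Sp n ℚ) (γ : Sp n ℤ) (y : Satake n) :
    (g • y).tau = γ • g • y ↔ actSub ((tauSp g)⁻¹ * toRat γ * g) y.1 = tauSub y.1 := by
  refine (Subtype.ext_iff (a1 := (g • y).tau) (a2 := γ • g • y)).trans ?_
  change tauSub (actSub g y.1) = actSub (toRat γ) (actSub g y.1) ↔ _
  rw [tauSub_actSub, actSub_mul, actSub_mul]
  constructor
  · intro h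
    rw [← h, actSub_inv_actSub]
  · intro h
    rw [← h]
    simpa only [inv_inv] using actSub_inv_actSub (tauSp g)⁻¹ (actSub (toRat γ) (actSub g y.1))

/-- The denominator comes only from g and τ(g)⁻¹, so a single D serves for every γ. -/
theorem exists_conj_denominator {n : ℕ} (g : Sp n ℚ) : ∃ D : ℕ, 0 < D ∧ ∀ γ : Sp n ℤ,
    ∃ G : Matrix (Fin n ⊕ Fin n) (Fin n ⊕ Fin n) ℤ,
      (D : ℚ) • ((tauSp g)⁻¹ * toRat γ * g).1 = G.map (Int.castRingHom ℚ) := by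
  obtain ⟨d, hd, G, hG⟩ := exists_common_denominator g.1
  obtain ⟨d', hd', G', hG'⟩ := exists_common_denominator ((tauSp g)⁻¹).1
  refine ⟨d' * d, Nat.mul_pos hd' hd, fun γ => ⟨G' * γ.1 * G, ?_⟩⟩
  rw [Matrix.map_mul, Matrix.map_mul, ← hG, ← hG']
  change _ • (((tauSp g)⁻¹).1 * γ.1.map (Int.castRingHom ℚ) * g.1) = _
  simp only [Nat.cast_mul, mul_smul, Matrix.smul_mul, Matrix.mul_smul]
  rw [smul_comm]

theorem continuous_siegel_tau {q : ℕ} : Continuous (Siegel.tau (n := q)) :=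
  Continuous.subtype_mk ((continuous_subtype_val.matrix_map Complex.continuous_conj).neg) _

theorem isClosed_rel {q : ℕ} (T : Matrix (Fin q ⊕ Fin q) (Fin q ⊕ Fin q) ℂ) :
    IsClosed {Z : Siegel q | Rel T Z Z.tau} := by
  have h1 : Continuous fun Z : Siegel q => Z.1 := continuous_subtype_val
  have h2 : Continuous fun Z : Siegel q => Z.tau.1 :=
    continuous_subtype_val.comp continuous_siegel_tau
  refine isClosed_eq ?_ ?_
  · exact (continuous_const.matrix_mul h1).add continuous_const
  · exact h2.matrix_mul ((continuous_const.matrix_mul h1).add continuous_const)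

theorem Good.norm_sq_le_tau {n q : ℕ} {hq : q ≤ n} {b : ℝ} {Z : Siegel q} (hZ : Good n hq b Z)
    {u : V n} (hu : u ∈ phi hq Z.tau) (i : Fin q ⊕ Fin q) :
    ‖u (hIdx hq i)‖ ^ 2 ≤ 4 * b * herm u := by
  rw [← tauSub_phi] at hu
  have h := hZ.norm_sq_le (mem_tauSub.1 hu) i
  rw [herm_sigma] at h
  refine le_trans (le_of_eq ?_) h
  rcases i with i | i <;> simp [sigma, hIdx]

/-- A real point close to gφ(Z) forces the matrix δ to preserve W_q and to have a middle block in a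
fixed finite set. For a given block, reality of the projection is a closed condition, so shrinking
the neighbourhood of Z excludes every block. -/
theorem exists_nhds_not_real {n N q : ℕ} (hq : q ≤ n) (g : Sp n ℚ) (Z : Siegel q)
    (h : ¬∃ γ ∈ Gam n N, (g • stdPoint hq Z).tau = γ • g • stdPoint hq Z) :
    ∃ U ∈ 𝓝 Z, ∃ ε > 0, ∀ y ∈ basicNhd hq U ε,
      ¬∃ γ ∈ Gam n N, (g • y).tau = γ • g • y := by
  obtain ⟨D, hD, hint⟩ := exists_conj_denominator g
  obtain ⟨b, hb, hgood⟩ := eventually_good (n := n) hq Z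
  have hDR : (0 : ℝ) < D := by exact_mod_cast hD
  obtain ⟨ε, hε, h1, h2⟩ : ∃ ε : ℝ, 0 < ε ∧ 16 * (D ^ 2 * ε) * ε < 1 ∧
      16 * (D ^ 2 * ε) * b < 1 := by
    refine ⟨min 1 (1 / (32 * D ^ 2 * (1 + b))), by positivity, ?_, ?_⟩
    all_goals
      set ε := min 1 (1 / (32 * D ^ 2 * (1 + b))) with hε
      have hε0 : 0 < ε := by positivity
      have hε1 : ε ≤ 1 := min_le_left _ _
      have hε2 : ε * (32 * D ^ 2 * (1 + b)) ≤ 1 := by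
        rw [← le_div_iff₀ (by positivity)]
        exact min_le_right _ _
      have h3 : 0 < D ^ 2 * ε := by positivity
      nlinarith [mul_pos h3 hb]
  -- The relation sees γ only through the block T, but S also records that T is realized by some γ.
  -- If Z were in the closure of S T, then S T would be nonempty and that γ would make gφ(Z) real.
  set S : Matrix (Fin q ⊕ Fin q) (Fin q ⊕ Fin q) ℚ → Set (Siegel q) := fun T =>
    {Z' | ∃ γ ∈ Gam n N, ((tauSp g)⁻¹ * toRat γ * g).1.BlockTriangular (lev n q) ∧
      blk hq ((tauSp g)⁻¹ * toRat γ * g).1 = T ∧ Rel (T.map (algebraMap ℚ ℂ)) Z' Z'.tau} with hS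
  have hclos : ∀ T, Z ∉ closure (S T) := by
    intro T hZ
    obtain ⟨Z₀, γ, hγ, hbt, hT, -⟩ : (S T).Nonempty := closure_nonempty_iff.1 ⟨Z, hZ⟩
    have hsub : S T ⊆ {Z' | Rel (T.map (algebraMap ℚ ℂ)) Z' Z'.tau} := by
      rintro Z' ⟨-, -, -, -, h⟩; exact h
    have hR : Rel (T.map (algebraMap ℚ ℂ)) Z Z.tau :=
      closure_minimal hsub (isClosed_rel _) hZ
    refine h ⟨γ, hγ, ?_⟩
    rw [tau_smul_eq_iff]
    change actSub _ (phi hq Z) = tauSub (phi hq Z)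
    rw [tauSub_phi, actSub_phi_iff hq hbt, hT]
    exact hR
  obtain ⟨K, hK⟩ := exists_nat_ge ((D : ℝ) * (4 * b))
  -- Blocks with denominators dividing D and entries of absolute value at most K/D, where K bounds D
  -- times the estimate 4b of `norm_entry_le`.
  set F : Set (Matrix (Fin q ⊕ Fin q) (Fin q ⊕ Fin q) ℚ) :=
    (fun m : (Fin q ⊕ Fin q) → (Fin q ⊕ Fin q) → ℤ => fun i j => (m i j : ℚ) / D) ''
      (Set.univ.pi fun _ => Set.univ.pi fun _ => Set.Icc (-(K : ℤ)) K) with hF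
  have hFfin : F.Finite := Set.Finite.image _
    (Set.Finite.pi' fun _ => Set.Finite.pi' fun _ => Set.finite_Icc _ _ |>.subset subset_rfl)
    |>.subset (by
      refine Set.image_mono fun m hm i j => hm i trivial j trivial)
  refine ⟨{Z' | Good n hq b Z'} ∩ ⋂ T ∈ F, (closure (S T))ᶜ, ?_, ε, hε, ?_⟩
  · refine Filter.inter_mem hgood ((Filter.biInter_mem hFfin).2 fun T _ => ?_)
    exact isClosed_closure.isOpen_compl.mem_nhds (hclos T)
  · rintro y ⟨⟨Z', ⟨hZ'g, hZ'F⟩, hred⟩, hsp⟩ ⟨γ, hγ, hreal⟩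
    rw [tau_smul_eq_iff] at hreal
    obtain ⟨G, hG⟩ := hint γ
    set δ := (tauSp g)⁻¹ * toRat γ * g with hδ
    have hW := actSub_stdIsotropic_le (hq := hq) hD hZ'g (y := y) ⟨⟨Z', rfl, hred⟩, hsp⟩ h1 h2
      hG hreal
    have hbt := blockTriangular_of_actSub_le hW
    have hφ := actSub_phi_of_reduce hred hreal hW
    have hmem : blk hq δ.1 ∈ F := by
      refine ⟨fun i j => G (hIdx hq i) (hIdx hq j), fun i _ j _ => ?_, ?_⟩
      · have h3 := norm_entry_le hb.le hZ'g (fun u hu i => hZ'g.norm_sq_le_tau hu i) hφ.le i j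
        have h4 := congrFun (congrFun hG (hIdx hq i)) (hIdx hq j)
        simp only [Matrix.smul_apply, Matrix.map_apply, smul_eq_mul] at h4
        have h5 : |(G (hIdx hq i) (hIdx hq j) : ℝ)| ≤ K := by
          have h6 : (G (hIdx hq i) (hIdx hq j) : ℝ)
              = D * ((δ.1 (hIdx hq i) (hIdx hq j) : ℚ) : ℝ) := by
            have := congrArg (fun x : ℚ => (x : ℝ)) h4
            simpa using this.symm
          rw [h6, abs_mul, abs_of_pos hDR]
          exact (mul_le_mul_of_nonneg_left h3 hDR.le).trans hK
        rw [abs_le] at h5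
        exact ⟨by exact_mod_cast h5.1, by exact_mod_cast h5.2⟩
      · ext i j
        have h4 := congrFun (congrFun hG (hIdx hq i)) (hIdx hq j)
        simp only [Matrix.smul_apply, Matrix.map_apply, smul_eq_mul] at h4
        have hDQ : (D : ℚ) ≠ 0 := by exact_mod_cast hD.ne'
        rw [div_eq_iff hDQ, mul_comm]
        exact h4.symm
    refine Set.mem_iInter₂.1 hZ'F _ hmem (subset_closure ⟨γ, hγ, hbt, rfl, ?_⟩)
    rwa [actSub_phi_iff hq hbt] at hφ

theorem proj_tau_eq_iff {n N : ℕ} (x : Satake n) :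
    (proj N x).tau = proj N x ↔ ∃ γ ∈ Gam n N, x.tau = γ • x := by
  change (Quotient.mk _ x.tau : Quotient (MulAction.orbitRel (Gam n N) (Satake n)))
    = Quotient.mk _ x ↔ _
  rw [Quotient.eq]
  constructor
  · rintro ⟨γ, h⟩; exact ⟨γ.1, γ.2, h.symm⟩
  · rintro ⟨γ, hγ, h⟩; exact ⟨⟨γ, hγ⟩, h.symm⟩

theorem continuous_proj (n N : ℕ) : Continuous (proj (n := n) N) := continuous_quotient_mk'

theorem isClosed_VR (n N : ℕ) : IsClosed (VR n N) := by
  have hq : IsQuotientMap (proj (n := n) N) := isQuotientMap_quotient_mk'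
  rw [← hq.isClosed_preimage, ← isOpen_compl_iff]
  intro q hq g Z hx
  have hx' : ¬∃ γ ∈ Gam n N, (g • stdPoint hq Z).tau = γ • g • stdPoint hq Z := by
    rw [← proj_tau_eq_iff]; exact hx
  obtain ⟨U, hU, ε, hε, h⟩ := exists_nhds_not_real hq g Z hx'
  refine ⟨U, hU, ε, hε, fun y hy => ?_⟩
  have := h y hy
  rw [← proj_tau_eq_iff] at this
  exact this

/-! ### Lifting idempotents -/

/-- A value f(x) not divisible by 2 has an odd coordinate. It is fixed by f modulo 2^j and can be
corrected to be primitive, which splits off a line on which f acts as 1. -/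
theorem exists_fixed_covector {M : Type*} [AddCommGroup M] [Module.Free ℤ M] [Module.Finite ℤ M]
    {j : ℕ} {f : M →ₗ[ℤ] M} (hf : ∀ x, ∃ y, f (f x) - f x = (2 ^ j : ℤ) • y)
    (h : ∃ x, ∀ y, f x ≠ (2 : ℤ) • y) :
    ∃ (v : M) (φ : M →ₗ[ℤ] ℤ), φ v = 1 ∧ ∃ y, f v - v = (2 ^ j : ℤ) • y := by
  obtain ⟨x, hx⟩ := h
  set b := Module.Free.chooseBasis ℤ M
  obtain ⟨i, hi⟩ : ∃ i, ¬(2 : ℤ) ∣ b.repr (f x) i := by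
    by_contra! hcon
    choose c hc using hcon
    refine hx (∑ i, c i • b i) ?_
    rw [Finset.smul_sum]
    conv_lhs => rw [← b.sum_repr (f x)]
    refine Finset.sum_congr rfl fun i _ => ?_
    rw [hc i, mul_smul]
  have hcop : IsCoprime (b.repr (f x) i) (2 ^ j) :=
    ((Int.prime_two.coprime_iff_not_dvd.2 hi).symm).pow_right
  obtain ⟨c, d, hcd⟩ := hcop
  obtain ⟨y, hy⟩ := hf x
  -- Bézout: the correction by a multiple of 2^j makes the i-th coordinate exactly 1 without
  -- changing the congruence f(v) ≡ v.
  refine ⟨c • f x + (d * 2 ^ j) • b i, b.coord i, ?_, ?_⟩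
  · simp [hcd]
  · refine ⟨c • y + d • f (b i) - d • b i, ?_⟩
    have : f (c • f x + (d * 2 ^ j) • b i) - (c • f x + (d * 2 ^ j) • b i)
        = c • (f (f x) - f x) + (d * 2 ^ j) • f (b i) - (d * 2 ^ j) • b i := by
      rw [map_add, map_smul, map_smul, smul_sub]; abel
    rw [this, hy]
    module

/-- An endomorphism of a lattice that is idempotent modulo `2^j` is congruent to an idempotent. -/
theorem exists_idempotent_lift (r : ℕ) : ∀ {M : Type*} [AddCommGroup M] [Module.Free ℤ M]
    [Module.Finite ℤ M], Module.finrank ℤ M = r → ∀ {j : ℕ} {f : M →ₗ[ℤ] M},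
    (∀ x, ∃ y, f (f x) - f x = (2 ^ j : ℤ) • y) →
    ∃ e : M →ₗ[ℤ] M, (∀ x, e (e x) = e x) ∧ ∀ x, ∃ y, e x - f x = (2 ^ j : ℤ) • y := by
  induction r with
  | zero =>
    intro M _ _ _ hM j f _
    have := Module.finrank_zero_iff.1 hM
    exact ⟨0, fun x => Subsingleton.elim _ _, fun x => ⟨0, Subsingleton.elim _ _⟩⟩
  | succ r ih =>
    intro M _ _ _ hM j f hf
    by_cases h : ∃ x, ∀ y, f x ≠ (2 : ℤ) • y
    -- The lattice splits as ℤv ⊕ ker φ. Because f(v) ≡ v, compressing f to ker φ along v is still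
    -- idempotent modulo 2^j, so the induction applies there.
    · obtain ⟨v, φ, hφ, yv, hyv⟩ := exists_fixed_covector hf h
      set K := LinearMap.ker φ with hK
      have hproj : ∀ x, x - φ x • v ∈ K := fun x => by
        rw [hK, LinearMap.mem_ker, map_sub, map_smul, hφ]; simp
      set π : M →ₗ[ℤ] K := LinearMap.codRestrict K
        (LinearMap.id - (LinearMap.toSpanSingleton ℤ M v).comp φ) (fun x => hproj x) with hπ
      have hπv : ∀ x, ((π x : K) : M) = x - φ x • v := fun x => rfl
      have hrank : Module.finrank ℤ K = r := by
        have hsurj : Function.Surjective φ := fun z => ⟨z • v, by rw [map_smul, hφ]; simp⟩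
        have h1 := Submodule.finrank_quotient_add_finrank K
        rw [(φ.quotKerEquivOfSurjective hsurj).finrank_eq, hM, Module.finrank_self] at h1
        omega
      have key : ∀ x : K, ∃ y : K, π (f (π (f x))) - π (f x) = (2 ^ j : ℤ) • y := by
        intro x
        obtain ⟨y, hy⟩ := hf x
        refine ⟨π (y - φ (f x) • yv), ?_⟩
        have h1 : f (π (f x)) - f x = (2 ^ j : ℤ) • (y - φ (f x) • yv) - φ (f x) • v := by
          rw [hπv, map_sub, map_smul, eq_add_of_sub_eq hy, eq_add_of_sub_eq hyv]
          module
        have hπv0 : π v = 0 := by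
          apply Subtype.ext; rw [hπv, hφ]; simp
        rw [← map_sub, h1, map_sub, map_smul, map_smul, hπv0, smul_zero, sub_zero]
      obtain ⟨e, he, hef⟩ := ih hrank (f := π.comp (f.comp K.subtype)) key
      -- The component of f along v that the compression loses. Composing with 1 - e gives ρ ∘ e =
      -- 0, which makes E idempotent; this leaves the congruence intact because φ ∘ f ∘ e is
      -- divisible by 2^j.
      set ρ : K →ₗ[ℤ] ℤ := φ.comp (f.comp (K.subtype.comp (LinearMap.id - e))) with hρ
      have hρe : ∀ x : K, ρ (e x) = 0 := fun x => by
        simp [hρ, he]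
      set E : M →ₗ[ℤ] M := (LinearMap.toSpanSingleton ℤ M v).comp φ
        + (K.subtype.comp (e.comp π)) + (LinearMap.toSpanSingleton ℤ M v).comp (ρ.comp π) with hE
      have hEa : ∀ x, E x = φ x • v + (e (π x) : M) + ρ (π x) • v := fun x => rfl
      have hφK : ∀ x : K, φ x = 0 := fun x => x.2
      have hπK : ∀ x : K, π x = x := fun x => by
        apply Subtype.ext; rw [hπv, hφK]; simp
      have hπv0 : π v = 0 := by
        apply Subtype.ext; rw [hπv, hφ]; simp
      refine ⟨E, fun x => ?_, fun x => ?_⟩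
      · have hφE : φ (E x) = φ x + ρ (π x) := by
          rw [hEa, map_add, map_add, map_smul, map_smul, hφ, hφK]; simp
        have hπE : π (E x) = e (π x) := by
          rw [hEa, map_add, map_add, map_smul, map_smul, hπv0, hπK]; simp
        rw [hEa (E x), hφE, hπE, he, hρe, hEa]
        module
      · obtain ⟨y1, hy1⟩ := hef (π x)
        obtain ⟨y2, hy2⟩ := hf (π x)
        have hy1' : ((e (π x) : K) : M) = (f (π x) - φ (f (π x)) • v) + (2 ^ j : ℤ) • (y1 : M) := by
          have := congrArg (Subtype.val) (eq_add_of_sub_eq hy1)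
          rw [this]
          simp only [LinearMap.comp_apply, Submodule.subtype_apply, Submodule.coe_add,
            Submodule.coe_smul, hπv]
          abel
        have hfx : f x = φ x • f v + f (π x) := by
          conv_lhs => rw [show x = φ x • v + (π x : M) by rw [hπv]; abel]
          rw [map_add, map_smul]
        have hρx : ρ (π x) = φ (f (π x)) - φ (f (e (π x))) := by
          simp [hρ]
        have hfe : φ (f (e (π x))) = 2 ^ j * (φ y2 - φ (f (π x)) * φ yv + φ (f y1)) := by
          rw [hy1', map_add, map_sub, map_smul, map_smul, eq_add_of_sub_eq hy2,
            eq_add_of_sub_eq hyv]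
          simp only [map_add, map_sub, map_smul, smul_eq_mul, hφ]
          ring
        refine ⟨(y1 : M) - φ x • yv -
          (φ y2 - φ (f (π x)) * φ yv + φ (f y1)) • v, ?_⟩
        rw [hEa, hρx, hfe, hy1', hfx, eq_add_of_sub_eq hyv]
        module
    · push Not at h
      refine ⟨0, fun x => rfl, fun x => ?_⟩
      -- If all values of f are even, f ≡ f² doubles the known power of two one factor at a time up
      -- to 2^j, so zero is a lift.
      have hdiv : ∀ i : ℕ, i ≤ j → ∀ x, ∃ y, f x = (2 ^ i : ℤ) • y := by
        intro i
        induction i with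
        | zero => exact fun _ x => ⟨f x, by simp⟩
        | succ i ihi =>
          intro hi x
          obtain ⟨z, hz⟩ := hf x
          obtain ⟨y, hy⟩ := h x
          obtain ⟨y', hy'⟩ := ihi (by omega) y
          obtain ⟨m, rfl⟩ := Nat.exists_eq_add_of_le hi
          refine ⟨y' - (2 ^ m : ℤ) • z, ?_⟩
          have : f x = f (f x) - (2 ^ (i + 1 + m) : ℤ) • z := by rw [← hz]; abel
          rw [this, hy, map_smul, hy', smul_smul, smul_sub, smul_smul]
          ring_nf
      obtain ⟨y, hy⟩ := hdiv j le_rfl x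
      exact ⟨-y, by simp [hy]⟩

/-- The lift is made on the range of p, a free lattice, so that the result stays in the corner cut
out by p. -/
theorem exists_idempotent_matrix_lift {ι : Type*} [Fintype ι] [DecidableEq ι] {j : ℕ}
    {p M R : Matrix ι ι ℤ} (hp : p * p = p) (hpM : p * M * p = M)
    (hM : M * M = M + (2 ^ j : ℤ) • R) :
    ∃ α R' : Matrix ι ι ℤ, α * α = α ∧ p * α * p = α ∧ α = M + (2 ^ j : ℤ) • R' := by
  have hpM1 : p * M = M := by rw [← hpM, ← Matrix.mul_assoc, ← Matrix.mul_assoc, hp]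
  have hpM2 : M * p = M := by rw [← hpM, Matrix.mul_assoc, hp]
  set K := LinearMap.range p.mulVecLin with hK
  have hfix : ∀ x ∈ K, p *ᵥ x = x := by
    rintro _ ⟨y, rfl⟩
    rw [Matrix.mulVecLin_apply, Matrix.mulVec_mulVec, hp]
  set π := p.mulVecLin.rangeRestrict with hπ
  have hπa : ∀ x, ((π x : K) : ι → ℤ) = p *ᵥ x := fun x => rfl
  set f : K →ₗ[ℤ] K := π.comp (M.mulVecLin.comp K.subtype) with hf
  have hfa : ∀ x : K, ((f x : K) : ι → ℤ) = M *ᵥ x := fun x => by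
    change p *ᵥ (M *ᵥ x) = _
    rw [Matrix.mulVec_mulVec, hpM1]
  obtain ⟨e, he, hef⟩ := exists_idempotent_lift _ (M := K) rfl (j := j) (f := f) (fun x => by
    refine ⟨π (R *ᵥ x), ?_⟩
    apply Subtype.ext
    have h1 : M *ᵥ (M *ᵥ (x : ι → ℤ)) - M *ᵥ x = (2 ^ j : ℤ) • (R *ᵥ x) := by
      rw [Matrix.mulVec_mulVec, hM, Matrix.add_mulVec, Matrix.smul_mulVec]; abel
    rw [Submodule.coe_sub, Submodule.coe_smul, hfa, hfa, hπa, ← Matrix.mulVec_smul, ← h1]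
    simp only [Matrix.mulVec_sub, Matrix.mulVec_mulVec, ← Matrix.mul_assoc, hpM1])
  set α : Matrix ι ι ℤ := LinearMap.toMatrix' (K.subtype.comp (e.comp π)) with hα
  have hαa : ∀ x, α *ᵥ x = (e (π x) : K) := fun x => by
    rw [hα, LinearMap.toMatrix'_mulVec]; rfl
  have hπK : ∀ x : K, π x = x := fun x => Subtype.ext (hfix x x.2)
  have hπp : ∀ x, π (p *ᵥ x) = π x := fun x => Subtype.ext (by
    rw [hπa, hπa, Matrix.mulVec_mulVec, hp])
  have hdiff : ∀ x, ∃ y, α *ᵥ x - M *ᵥ x = (2 ^ j : ℤ) • y := fun x => by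
    obtain ⟨y, hy⟩ := hef (π x)
    refine ⟨y, ?_⟩
    rw [hαa, ← Submodule.coe_smul, ← hy, Submodule.coe_sub, hfa, hπa, Matrix.mulVec_mulVec, hpM2]
  choose y hy using fun i => hdiff (Pi.single i 1)
  refine ⟨α, Matrix.of fun a i => y i a, ?_, ?_, ?_⟩
  · refine Matrix.ext_of_mulVec_single fun i => ?_
    rw [← Matrix.mulVec_mulVec, hαa, hαa, hπK, he]
  · refine Matrix.ext_of_mulVec_single fun i => ?_
    rw [← Matrix.mulVec_mulVec, ← Matrix.mulVec_mulVec, hαa, hαa, hπp]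
    exact hfix _ (e _).2
  · ext a i
    have := congrFun (hy i) a
    simp only [Matrix.mulVec_single_one, Pi.sub_apply, Matrix.col_apply, Pi.smul_apply] at this
    simp only [Matrix.add_apply, Matrix.smul_apply, Matrix.of_apply]
    rw [← this]; abel

/-- Reflecting the upper triangle symmetrizes without dividing by 2. The last clause keeps the
support inside the block where B lives. -/
theorem exists_symm_lift {n : ℕ} {N : ℤ} {B R : Matrix (Fin n) (Fin n) ℤ}
    (h : B = Bᵀ + N • R) : ∃ B' R' : Matrix (Fin n) (Fin n) ℤ, B'ᵀ = B' ∧ B' = B + N • R' ∧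
      ∀ i j, B i j = 0 → B j i = 0 → B' i j = 0 := by
  refine ⟨Matrix.of fun i j => if i ≤ j then B i j else B j i,
    Matrix.of fun i j => if i ≤ j then 0 else R j i,
    ?_, ?_, ?_⟩
  · ext i j
    simp only [transpose_apply, Matrix.of_apply]
    rcases lt_trichotomy i j with h1 | rfl | h1
    · simp [h1.le, not_le.2 h1]
    · rfl
    · simp [h1.le, not_le.2 h1]
  · ext i j
    have h2 := congrFun (congrFun h j) i
    simp only [Matrix.add_apply, Matrix.smul_apply, transpose_apply, Matrix.of_apply] at h2 ⊢
    split_ifs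
    · simp
    · exact h2
  · intro i j h1 h2
    simp only [Matrix.of_apply, h1, h2, ite_self]

/-! ### Integral matrices congruent to the identity modulo four -/

/-- With X = 1 + 4S, the equation X² = 1 says S = -2S². Iterating, S is divisible by every power of
2 and therefore vanishes. -/
theorem eq_one_of_sq_eq_one {ι : Type*} [Fintype ι] [DecidableEq ι] {X S : Matrix ι ι ℤ}
    (hX : X = 1 + (4 : ℤ) • S) (h : X * X = 1) : X = 1 := by
  have h1 : S = (-2 : ℤ) • (S * S) := by
    have h2 : (8 : ℤ) • (S + (2 : ℤ) • (S * S)) = 0 := by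
      have : X * X = 1 + (8 : ℤ) • (S + (2 : ℤ) • (S * S)) := by
        rw [hX]
        simp only [mul_add, add_mul, mul_one, one_mul, Matrix.smul_mul, Matrix.mul_smul]
        module
      rw [h] at this
      exact (left_eq_add.1 this)
    have h3 : S + (2 : ℤ) • (S * S) = 0 := by
      ext i j
      have := congrFun (congrFun h2 i) j
      simpa using this
    rw [neg_smul]
    exact eq_neg_of_add_eq_zero_left h3
  have h2 : ∀ r : ℕ, ∃ Q, S = (2 ^ r : ℤ) • Q := by
    intro r
    induction r with
    | zero => exact ⟨S, by simp⟩
    | succ r ih =>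
      obtain ⟨Q, hQ⟩ := ih
      refine ⟨(-(2 ^ r) : ℤ) • (Q * Q), ?_⟩
      rw [h1, hQ]
      simp only [Matrix.smul_mul, Matrix.mul_smul, smul_smul]
      ring_nf
  have h3 : S = 0 := by
    ext i j
    obtain ⟨Q, hQ⟩ := h2 (S i j).natAbs
    have h4 := congrFun (congrFun hQ i) j
    simp only [Matrix.smul_apply, smul_eq_mul] at h4
    refine Int.eq_zero_of_abs_lt_dvd (m := 2 ^ (S i j).natAbs) ⟨_, h4⟩ ?_
    rw [Int.abs_eq_natAbs]
    exact_mod_cast Nat.lt_two_pow_self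
  rw [hX, h3]; simp

theorem exists_pow_two_pow_eq {ι : Type*} [Fintype ι] [DecidableEq ι] {X S : Matrix ι ι ℤ}
    (hX : X = 1 + (4 : ℤ) • S) (r : ℕ) :
    ∃ Q, X ^ 2 ^ r = 1 + (2 ^ (r + 2) : ℤ) • Q := by
  induction r with
  | zero => exact ⟨S, by simpa using hX⟩
  | succ r ih =>
    obtain ⟨Q, hQ⟩ := ih
    refine ⟨Q + (2 ^ (r + 1) : ℤ) • (Q * Q), ?_⟩
    rw [pow_succ, pow_mul, hQ, sq]
    simp only [mul_add, add_mul, mul_one, one_mul, Matrix.smul_mul, Matrix.mul_smul, smul_add,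
      smul_smul]
    have h1 : (2 ^ (r + 1 + 2) : ℤ) = 2 * 2 ^ (r + 2) := by ring
    have h2 : (2 ^ (r + 1 + 2) * 2 ^ (r + 1) : ℤ) = 2 ^ (r + 2) * 2 ^ (r + 2) := by ring
    rw [h2, h1]
    module

/-- An integral matrix that is congruent to the identity modulo four and has bounded powers is the
identity. -/
theorem eq_one_of_bounded_powers {ι : Type*} [Fintype ι] [DecidableEq ι] {X S : Matrix ι ι ℤ}
    (hX : X = 1 + (4 : ℤ) • S) {K : ℤ} (hK : ∀ r i j, |(X ^ r) i j| ≤ K) : X = 1 := by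
  -- The iterated squares of X are bounded and congruent to 1 modulo growing powers of 2, so one of
  -- them is 1; `eq_one_of_sq_eq_one` then takes square roots back down to X.
  have hfin : ∃ r, X ^ 2 ^ r = 1 := by
    refine ⟨K.natAbs + 1, ?_⟩
    obtain ⟨Q, hQ⟩ := exists_pow_two_pow_eq hX (K.natAbs + 1)
    have hQ0 : Q = 0 := by
      ext i j
      have h1 := hK (2 ^ (K.natAbs + 1)) i j
      have hone : |(1 : Matrix ι ι ℤ) i j| ≤ 1 := by
        rw [Matrix.one_apply]; split_ifs <;> simp
      have h2 : |(2 ^ (K.natAbs + 1 + 2) : ℤ) * Q i j| ≤ K + 1 := by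
        have : (2 ^ (K.natAbs + 1 + 2) : ℤ) * Q i j
            = (X ^ 2 ^ (K.natAbs + 1)) i j - (1 : Matrix ι ι ℤ) i j := by
          rw [hQ]
          simp only [Matrix.add_apply, Matrix.smul_apply, smul_eq_mul, add_sub_cancel_left]
        rw [this]
        exact (abs_sub _ _).trans (add_le_add h1 hone)
      have h3 : K + 1 < 2 ^ (K.natAbs + 1 + 2) := by
        have h4 : (K.natAbs + 1 + 2 : ℕ) < 2 ^ (K.natAbs + 1 + 2) := Nat.lt_two_pow_self
        have h5 : ((K.natAbs + 1 + 2 : ℕ) : ℤ) < 2 ^ (K.natAbs + 1 + 2) := by exact_mod_cast h4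
        push_cast at h5
        have := le_abs_self K
        linarith
      have h6 := Int.eq_zero_of_abs_lt_dvd (Dvd.intro _ rfl) (h2.trans_lt h3)
      simpa using h6
    rw [hQ, hQ0]; simp
  obtain ⟨r, hr⟩ := hfin
  induction r with
  | zero => simpa using hr
  | succ r ih =>
    refine ih ?_
    obtain ⟨Q, hQ⟩ := exists_pow_two_pow_eq hX r
    refine eq_one_of_sq_eq_one (S := (2 ^ r : ℤ) • Q) ?_ ?_
    · rw [hQ, smul_smul]; ring_nf
    · rw [← hr, pow_succ, pow_mul, sq]

/-! ### Integral symplectic matrices adapted to a rational flag -/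

/-- The quotient of a lattice by a saturated sublattice is free. -/
theorem exists_basis_quotient {M : Type*} [AddCommGroup M] [Module.Free ℤ M] [Module.Finite ℤ M]
    {N : Submodule ℤ M} (hN : ∀ (k : ℤ) (x : M), k ≠ 0 → k • x ∈ N → x ∈ N) :
    Nonempty (Module.Basis (Fin (Module.finrank ℤ M - Module.finrank ℤ N)) ℤ (M ⧸ N)) := by
  have htf : Module.IsTorsionFree ℤ (M ⧸ N) := by
    refine Module.isTorsionFree_iff_smul_eq_zero.2 ?_
    intro k x hkx
    obtain ⟨y, rfl⟩ := N.mkQ_surjective x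
    rw [← map_smul, Submodule.mkQ_apply, Submodule.Quotient.mk_eq_zero] at hkx
    by_cases hk : k = 0
    · exact Or.inl hk
    · right
      rw [Submodule.mkQ_apply, Submodule.Quotient.mk_eq_zero]
      exact hN k y hk hkx
  have hfr : Module.finrank ℤ (M ⧸ N) = Module.finrank ℤ M - Module.finrank ℤ N := by
    have := Submodule.finrank_quotient_add_finrank N
    omega
  exact ⟨Module.finBasisOfFinrankEq ℤ _ hfr⟩

/-- The vectors of `ℤ^{2n}` lying in the span of the columns of `g` with index in `P`. -/
def flagLattice {n : ℕ} (g : Sp n ℚ) (P : Fin n ⊕ Fin n → Prop) :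
    Submodule ℤ (Fin n ⊕ Fin n → ℤ) where
  carrier := {v | ∀ a, ¬P a → ((g⁻¹).1 *ᵥ (fun i => (v i : ℚ))) a = 0}
  zero_mem' a _ := by simp [mulVec, dotProduct]
  add_mem' {u v} hu hv a ha := by
    have : (fun i => (((u + v) i : ℤ) : ℚ)) = (fun i => (u i : ℚ)) + (fun i => (v i : ℚ)) := by
      ext i; simp
    rw [this, mulVec_add, Pi.add_apply, hu a ha, hv a ha, add_zero]
  smul_mem' c u hu a ha := by
    have : (fun i => (((c • u) i : ℤ) : ℚ)) = (c : ℚ) • (fun i => (u i : ℚ)) := by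
      ext i; simp
    rw [this, mulVec_smul, Pi.smul_apply, hu a ha, smul_zero]

theorem flagLattice_saturated {n : ℕ} {g : Sp n ℚ} {P : Fin n ⊕ Fin n → Prop} {k : ℤ}
    {v : Fin n ⊕ Fin n → ℤ} (hk : k ≠ 0) (h : k • v ∈ flagLattice g P) : v ∈ flagLattice g P := by
  intro a ha
  have h1 := h a ha
  have : (fun i => (((k • v) i : ℤ) : ℚ)) = (k : ℚ) • (fun i => (v i : ℚ)) := by
    ext i; simp
  rw [this, mulVec_smul, Pi.smul_apply, smul_eq_mul] at h1
  exact (mul_eq_zero.1 h1).resolve_left (by exact_mod_cast hk)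

theorem map_cast_mulVec {ι : Type*} [Fintype ι] (G : Matrix ι ι ℤ) (v : ι → ℤ) :
    (G.map (Int.castRingHom ℚ)) *ᵥ (fun i => (v i : ℚ)) = fun i => ((G *ᵥ v) i : ℚ) := by
  ext i; simp [mulVec, dotProduct]

theorem sp_mulVec_inv {n : ℕ} (g : Sp n ℚ) (u : Fin n ⊕ Fin n → ℚ) :
    g.1 *ᵥ ((g⁻¹).1 *ᵥ u) = u := by
  have h : g.1 * (g⁻¹).1 = 1 := congrArg Subtype.val (mul_inv_cancel g)
  rw [mulVec_mulVec, h, one_mulVec]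

/-- After clearing denominators, g⁻¹ embeds the lattice in the coordinate lattice of P, and g embeds
that coordinate lattice in it. -/
theorem finrank_flagLattice {n : ℕ} (g : Sp n ℚ) (P : Fin n ⊕ Fin n → Prop) [DecidablePred P] :
    Module.finrank ℤ (flagLattice g P) = Fintype.card {a // P a} := by
  obtain ⟨d, hd, G, hG⟩ := exists_common_denominator g.1
  obtain ⟨d', hd', G', hG'⟩ := exists_common_denominator (g⁻¹).1
  have hdQ : (d : ℚ) ≠ 0 := by exact_mod_cast hd.ne'
  have hdQ' : (d' : ℚ) ≠ 0 := by exact_mod_cast hd'.ne'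
  have hGv : ∀ v : Fin n ⊕ Fin n → ℤ, (fun i => ((G *ᵥ v) i : ℚ))
      = (d : ℚ) • (g.1 *ᵥ fun i => (v i : ℚ)) := fun v => by
    rw [← map_cast_mulVec, ← hG, smul_mulVec]
  have hGv' : ∀ v : Fin n ⊕ Fin n → ℤ, (fun i => ((G' *ᵥ v) i : ℚ))
      = (d' : ℚ) • ((g⁻¹).1 *ᵥ fun i => (v i : ℚ)) := fun v => by
    rw [← map_cast_mulVec, ← hG', smul_mulVec]
  apply le_antisymm
  · rw [← Module.finrank_pi ℤ (ι := {a // P a})]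
    refine LinearMap.finrank_le_finrank_of_injective
      (f := (LinearMap.funLeft ℤ ℤ (Subtype.val : {a // P a} → _)).comp
        (G'.mulVecLin.comp (flagLattice g P).subtype)) ?_
    rw [injective_iff_map_eq_zero]
    rintro ⟨v, hv⟩ h
    have h1 : ∀ a, ((g⁻¹).1 *ᵥ fun i => (v i : ℚ)) a = 0 := by
      intro a
      by_cases ha : P a
      · have h2 : (G' *ᵥ v) a = 0 := congrFun h ⟨a, ha⟩
        have h3 := congrFun (hGv' v) a
        simp only [h2, Int.cast_zero, Pi.smul_apply, smul_eq_mul] at h3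
        exact (mul_eq_zero.1 h3.symm).resolve_left hdQ'
      · exact hv a ha
    apply Subtype.ext
    ext a
    have h2 := sp_mulVec_inv g (fun i => (v i : ℚ))
    rw [funext h1] at h2
    have h3 := congrFun h2 a
    simp only [mulVec, dotProduct, mul_zero, Finset.sum_const_zero] at h3
    exact_mod_cast h3.symm
  · rw [← Module.finrank_pi ℤ (ι := {a // P a})]
    set ext0 : ({a // P a} → ℤ) →ₗ[ℤ] (Fin n ⊕ Fin n → ℤ) :=
      { toFun := fun c a => if h : P a then c ⟨a, h⟩ else 0
        map_add' := fun c c' => by ext a; simp only [Pi.add_apply]; split_ifs <;> simp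
        map_smul' := fun k c => by
          ext a; simp only [Pi.smul_apply, RingHom.id_apply]; split_ifs <;> simp } with hext
    have hinv : ∀ c, (g⁻¹).1 *ᵥ (fun i => ((G *ᵥ ext0 c) i : ℚ))
        = (d : ℚ) • fun a => (ext0 c a : ℚ) := fun c => by
      have h : (g⁻¹).1 * g.1 = 1 := congrArg Subtype.val (inv_mul_cancel g)
      rw [hGv, mulVec_smul, mulVec_mulVec, h, one_mulVec]
    refine LinearMap.finrank_le_finrank_of_injective
      (f := LinearMap.codRestrict (flagLattice g P) (G.mulVecLin.comp ext0) fun c a ha => ?_) ?_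
    · change ((g⁻¹).1 *ᵥ (fun i => ((G *ᵥ ext0 c) i : ℚ))) a = 0
      rw [hinv]
      simp [hext, ha]
    · rw [injective_iff_map_eq_zero]
      intro c hc
      have h1 : G *ᵥ ext0 c = 0 := congrArg Subtype.val hc
      have h2 := hinv c
      rw [h1] at h2
      ext ⟨a, ha⟩
      have h3 := congrFun h2 a
      simp only [mulVec, dotProduct, Pi.zero_apply, Int.cast_zero, mul_zero,
        Finset.sum_const_zero, Pi.smul_apply, smul_eq_mul] at h3
      have h4 := (mul_eq_zero.1 h3.symm).resolve_left hdQ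
      simpa [hext, ha] using h4

/-- A primitive isotropic integral `n`-frame extends to an integral symplectic matrix. -/
theorem exists_sp_of_isotropic {n : ℕ} {w : Matrix (Fin n ⊕ Fin n) (Fin n) ℤ}
    {c : Matrix (Fin n) (Fin n ⊕ Fin n) ℤ} (hc : c * w = 1)
    (hw : wᵀ * Matrix.J (Fin n) ℤ * w = 0) :
    ∃ g : Sp n ℤ, ∀ a i, g.1 a (Sum.inl i) = w a i := by
  set J := Matrix.J (Fin n) ℤ with hJ
  have hJJ : J * J = -1 := J_squared _ _
  have hJt : Jᵀ = -J := J_transpose _ _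
  set A := c * J * cᵀ with hA
  have hAt : Aᵀ = -A := by
    rw [hA, transpose_mul, transpose_mul, transpose_transpose, hJt]
    simp [Matrix.mul_assoc]
  -- The strict upper triangle of -A solves T - Tᵀ = -A over ℤ, since A is alternating.
  set T : Matrix (Fin n) (Fin n) ℤ := Matrix.of fun i j => if i < j then -A i j else 0 with hT
  have hTA : T - Tᵀ = -A := by
    ext i j
    have h1 := congrFun (congrFun hAt i) j
    simp only [transpose_apply, Matrix.neg_apply] at h1
    simp only [hT, Matrix.sub_apply, transpose_apply, Matrix.of_apply, Matrix.neg_apply]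
    rcases lt_trichotomy i j with h | rfl | h
    · simp [h, h.le.not_gt]
    · simp; omega
    · simp [h, h.le.not_gt]; omega
  -- J cᵀ pairs with w as the dual frame should; adding w T keeps that pairing, as w is isotropic,
  -- and makes the new frame isotropic.
  set w' := J * cᵀ + w * T with hw'
  have hwc : wᵀ * cᵀ = 1 := by rw [← transpose_mul, hc, transpose_one]
  have h12 : wᵀ * J * w' = -1 := by
    rw [hw', Matrix.mul_add, ← Matrix.mul_assoc, ← Matrix.mul_assoc, hw, Matrix.mul_assoc wᵀ, hJJ]
    simp [hwc]
  have h21 : w'ᵀ * J * w = 1 := by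
    have := congrArg Matrix.transpose h12
    rw [transpose_mul, transpose_mul, transpose_transpose, hJt, transpose_neg, transpose_one]
      at this
    rw [← neg_inj, ← this]
    simp [Matrix.mul_assoc]
  have h22 : w'ᵀ * J * w' = 0 := by
    have h3 : w'ᵀ * J * (J * cᵀ) = A - Tᵀ := by
      rw [hw', transpose_add, transpose_mul, transpose_mul, transpose_transpose, hJt]
      have e1 : (c * -J + Tᵀ * wᵀ) * J * (J * cᵀ) = -(c * (J * J) * J * cᵀ)
          + Tᵀ * (wᵀ * (J * J) * cᵀ) := by
        simp only [Matrix.add_mul, Matrix.mul_assoc, Matrix.neg_mul, Matrix.mul_neg]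
      rw [e1, hJJ]
      simp only [Matrix.mul_neg, Matrix.neg_mul, Matrix.mul_one, hwc, neg_neg, ← hA]
      abel
    have h4 : w'ᵀ * J * w' = w'ᵀ * J * (J * cᵀ) + (w'ᵀ * J * w) * T := by
      conv_lhs => rw [hw']
      rw [Matrix.mul_add, ← Matrix.mul_assoc (w'ᵀ * J) w T]
    rw [h4, h3, h21, Matrix.one_mul]
    have : A - Tᵀ + T = A + (T - Tᵀ) := by abel
    rw [this, hTA]; abel
  refine ⟨⟨fromCols w w', ?_⟩, fun a i => rfl⟩
  rw [SymplecticGroup.mem_iff', transpose_fromCols, ← hJ, fromRows_mul, fromRows_mul_fromCols, hw,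
    h12, h21, h22]
  rfl

/-- Every rational boundary component is an integral translate of F_q. The rational flag g₀W_q
inside the Lagrangian spanned by the first n columns of g₀ is intersected with ℤ^{2n}. These
sublattices are saturated, so an adapted basis exists, and it extends to an integral symplectic
basis. -/
theorem exists_integral_flag {n q : ℕ} (hq : q ≤ n) (g₀ : Sp n ℚ) : ∃ g : Sp n ℤ,
    actSub (g₀⁻¹ * toRat g) (stdIsotropic n q) = stdIsotropic n q := by
  set K := flagLattice g₀ (fun a => a.isLeft = true) with hK
  set Kq := flagLattice g₀ (fun a => lev n q a = 0) with hKq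
  have hle : Kq ≤ K := by
    intro v hv a ha
    refine hv a fun h => ha ?_
    rcases a with i | i
    · rfl
    · simp only [lev, Sum.elim_inr] at h; split_ifs at h
  have hKr : Module.finrank ℤ K = n := by
    rw [hK, finrank_flagLattice, Fintype.card_subtype, Finset.card_filter, Fintype.sum_sum_type]
    simp
  have hKqr : Module.finrank ℤ Kq = n - q := by
    have h1 : ∀ i : Fin n, (if lev n q (Sum.inl i) = 0 then 1 else 0 : ℕ)
        = (fun k : ℕ => if q ≤ k then 1 else 0) i := fun i => by
      simp only [lev, Sum.elim_inl]; split_ifs <;> omega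
    have h2 : ∀ i : Fin n, (if lev n q (Sum.inr i) = 0 then 1 else 0 : ℕ) = 0 := fun i => by
      simp only [lev, Sum.elim_inr]; split_ifs <;> omega
    rw [hKq, finrank_flagLattice, Fintype.card_subtype, Finset.card_filter, Fintype.sum_sum_type]
    simp only [h1, h2, Finset.sum_const_zero, add_zero]
    rw [Fin.sum_univ_eq_sum_range (fun k : ℕ => if q ≤ k then 1 else 0), ← Finset.card_filter]
    have h3 : (Finset.range n).filter (fun k => q ≤ k) = Finset.Ico q n := by
      ext k; simp [and_comm]
    rw [h3, Nat.card_Ico]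
  set N := Kq.comap K.subtype with hN
  have hNr : Module.finrank ℤ N = n - q := by
    rw [← hKqr]
    exact (Submodule.comapSubtypeEquivOfLe hle).finrank_eq
  obtain ⟨bQ⟩ := exists_basis_quotient (N := N) fun k x hk hx => flagLattice_saturated hk hx
  have bN : Module.Basis (Fin (n - q)) ℤ N := Module.finBasisOfFinrankEq ℤ _ hNr
  rw [hKr, hNr] at bQ
  obtain ⟨bK, hbK⟩ : ∃ b : Module.Basis (Fin n) ℤ K, ∀ i : Fin n, q ≤ (i : ℕ) →
      (b i : Fin n ⊕ Fin n → ℤ) ∈ Kq := by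
    -- The summands are exchanged because W_q corresponds to the last n - q indices.
    let e : Fin (n - q) ⊕ Fin (n - (n - q)) ≃ Fin n :=
      (Equiv.sumComm _ _).trans (finSumFinEquiv.trans (finCongr (by omega)))
    refine ⟨(bN.sumQuot bQ).reindex e, fun i hi => ?_⟩
    have : e.symm i = Sum.inl ⟨i - q, by omega⟩ := by
      rw [Equiv.symm_apply_eq]
      ext
      simp [e]
      omega
    rw [Module.Basis.reindex_apply, this, Module.Basis.sumQuot_inl]
    exact (bN _).2
  obtain ⟨bL⟩ := exists_basis_quotient (N := K) fun k x hk hx => flagLattice_saturated hk hx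
  set w : Matrix (Fin n ⊕ Fin n) (Fin n) ℤ := Matrix.of fun a i => (bK i : Fin n ⊕ Fin n → ℤ) a
    with hw
  -- A basis of the saturated lattice K extends to ℤ^{2n}; the coordinate functionals along K form a
  -- left inverse of w, which expresses its primitivity.
  set c : Matrix (Fin n) (Fin n ⊕ Fin n) ℤ := Matrix.of fun i a =>
    (bK.sumQuot bL).repr (Pi.single a 1) (Sum.inl i) with hc
  have hcv : ∀ i (v : Fin n ⊕ Fin n → ℤ), ∑ a, c i a * v a = (bK.sumQuot bL).repr v (Sum.inl i) := by
    intro i v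
    conv_rhs => rw [pi_eq_sum_univ' v]
    simp only [map_sum, map_smul, Finsupp.coe_finsetSum, Finset.sum_apply, Finsupp.smul_apply, hc,
      Matrix.of_apply, smul_eq_mul]
    refine Finset.sum_congr rfl fun a _ => ?_
    rw [mul_comm]
  have hcw : c * w = 1 := by
    ext i j
    rw [Matrix.mul_apply]
    change ∑ a, c i a * (bK j : Fin n ⊕ Fin n → ℤ) a = _
    rw [hcv, Module.Basis.sumQuot_repr_left, Finsupp.single_apply, Matrix.one_apply]
    simp [eq_comm]
  have hiso : wᵀ * Matrix.J (Fin n) ℤ * w = 0 := by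
    set wQ := w.map (Int.castRingHom ℚ) with hwQ
    set X := (g₀⁻¹).1 * wQ with hX
    have hgX : wQ = g₀.1 * X := by
      have h : g₀.1 * (g₀⁻¹).1 = 1 := congrArg Subtype.val (mul_inv_cancel g₀)
      rw [hX, ← Matrix.mul_assoc, h, Matrix.one_mul]
    have hX2 : X = fromRows X.toRows₁ 0 := by
      conv_lhs => rw [← fromRows_toRows X]
      congr 1
      ext i j
      exact (bK j).2 (Sum.inr i) (by simp)
    have hQ : wQᵀ * Matrix.J (Fin n) ℚ * wQ = 0 := by
      have hg := SymplecticGroup.mem_iff'.1 g₀.2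
      have e1 : wQᵀ * Matrix.J (Fin n) ℚ * wQ
          = Xᵀ * ((g₀.1)ᵀ * Matrix.J (Fin n) ℚ * g₀.1) * X := by
        conv_lhs => rw [hgX]
        simp only [transpose_mul, Matrix.mul_assoc]
      rw [e1, hg, hX2, transpose_fromRows, Matrix.J, fromCols_mul_fromBlocks,
        fromCols_mul_fromRows]
      simp
    have hmap : (wᵀ * Matrix.J (Fin n) ℤ * w).map (Int.castRingHom ℚ) = 0 := by
      rw [Matrix.map_mul, Matrix.map_mul, map_J, transpose_map]
      exact hQ
    ext i j
    have := congrFun (congrFun hmap i) j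
    simpa using this
  obtain ⟨g, hg⟩ := exists_sp_of_isotropic hcw hiso
  refine ⟨g, actSub_eq_of_le ?_⟩
  rintro _ ⟨u, hu, rfl⟩
  change cLin _ u ∈ _
  have hu := mem_stdIsotropic.1 hu
  rw [mem_stdIsotropic]
  intro a ha
  rw [cLin_apply]
  refine Finset.sum_eq_zero fun b _ => ?_
  by_cases hb : lev n q b = 0
  · rcases b with i | i
    · have h1 : ((g₀⁻¹ * toRat g).1 a (Sum.inl i)) = 0 := by
        refine Eq.trans ?_ (hbK i ?_ a ha)
        · change ((g₀⁻¹).1 * g.1.map (Int.castRingHom ℚ)) a (Sum.inl i) = _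
          simp [Matrix.mul_apply, mulVec, dotProduct, hg, hw]
        · simpa [lev] using hb
      rw [h1]; simp
    · simp only [lev, Sum.elim_inr] at hb; split_ifs at hb
  · rw [hu b hb, mul_zero]

/-! ### The symplectic adjoint -/

/-- The adjoint of a matrix for the standard symplectic form. -/
def adj {n : ℕ} {R : Type*} [CommRing R] (X : Matrix (Fin n ⊕ Fin n) (Fin n ⊕ Fin n) R) :
    Matrix (Fin n ⊕ Fin n) (Fin n ⊕ Fin n) R :=
  -(Matrix.J (Fin n) R * Xᵀ * Matrix.J (Fin n) R)

section adj

variable {n : ℕ} {R : Type*} [CommRing R] (X Y : Matrix (Fin n ⊕ Fin n) (Fin n ⊕ Fin n) R)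

theorem adj_mul : adj (X * Y) = adj Y * adj X := by
  unfold adj
  rw [transpose_mul]
  calc -(Matrix.J (Fin n) R * (Yᵀ * Xᵀ) * Matrix.J (Fin n) R)
      = Matrix.J (Fin n) R * Yᵀ * (Matrix.J (Fin n) R * Matrix.J (Fin n) R) * Xᵀ
        * Matrix.J (Fin n) R := by rw [J_squared]; simp [Matrix.mul_assoc]
    _ = _ := by simp [Matrix.mul_assoc]

theorem adj_adj : adj (adj X) = X := by
  unfold adj
  simp only [transpose_neg, transpose_mul, J_transpose, transpose_transpose]
  calc _ = (Matrix.J (Fin n) R * Matrix.J (Fin n) R) * X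
        * (Matrix.J (Fin n) R * Matrix.J (Fin n) R) := by simp [Matrix.mul_assoc]
    _ = X := by rw [J_squared]; simp

theorem adj_add : adj (X + Y) = adj X + adj Y := by
  simp [adj, Matrix.mul_add, Matrix.add_mul]; abel

theorem adj_sub : adj (X - Y) = adj X - adj Y := by
  simp [adj, Matrix.mul_sub, Matrix.sub_mul]; abel

theorem adj_one : adj (1 : Matrix (Fin n ⊕ Fin n) (Fin n ⊕ Fin n) R) = 1 := by
  simp [adj, J_squared]

theorem adj_zero : adj (0 : Matrix (Fin n ⊕ Fin n) (Fin n ⊕ Fin n) R) = 0 := by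
  simp [adj]

theorem adj_smul (c : R) : adj (c • X) = c • adj X := by
  simp [adj]

theorem adj_map {S : Type*} [CommRing S] (f : R →+* S) : adj (X.map f) = (adj X).map f := by
  unfold adj
  rw [Matrix.map_neg _ (map_neg f), Matrix.map_mul, Matrix.map_mul, map_J, transpose_map]

theorem mem_symplecticGroup_iff_mul_adj :
    X ∈ Matrix.symplecticGroup (Fin n) R ↔ X * adj X = 1 := by
  rw [SymplecticGroup.mem_iff]
  unfold adj
  constructor
  · intro h
    calc X * -(Matrix.J (Fin n) R * Xᵀ * Matrix.J (Fin n) R)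
        = -((X * Matrix.J (Fin n) R * Xᵀ) * Matrix.J (Fin n) R) := by simp [Matrix.mul_assoc]
      _ = 1 := by rw [h, J_squared]; simp
  · intro h
    calc X * Matrix.J (Fin n) R * Xᵀ
        = -(X * Matrix.J (Fin n) R * Xᵀ * (Matrix.J (Fin n) R * Matrix.J (Fin n) R)) := by
          rw [J_squared]; simp
      _ = (X * -(Matrix.J (Fin n) R * Xᵀ * Matrix.J (Fin n) R)) * Matrix.J (Fin n) R := by
          simp [Matrix.mul_assoc]
      _ = _ := by rw [h, Matrix.one_mul]

theorem adj_fromBlocks (A B C D : Matrix (Fin n) (Fin n) R) :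
    adj (fromBlocks A B C D) = fromBlocks Dᵀ (-Bᵀ) (-Cᵀ) Aᵀ := by
  simp [adj, Matrix.J, fromBlocks_transpose, fromBlocks_multiply, fromBlocks_neg]

end adj

theorem coe_inv_eq_adj {n : ℕ} {R : Type} [CommRing R] (g : Sp n R) : (g⁻¹).1 = adj g.1 := by
  rw [SymplecticGroup.coe_inv, adj]
  simp

theorem adj_mul_self {n : ℕ} {R : Type} [CommRing R] (g : Sp n R) : adj g.1 * g.1 = 1 := by
  rw [← coe_inv_eq_adj]
  exact congrArg Subtype.val (inv_mul_cancel g)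

theorem self_mul_adj {n : ℕ} {R : Type} [CommRing R] (g : Sp n R) : g.1 * adj g.1 = 1 :=
  (mem_symplecticGroup_iff_mul_adj _).1 g.2

theorem adj_Iminus (n : ℕ) (R : Type) [CommRing R] : adj (Iminus n R) = -Iminus n R := by
  simp [Iminus, adj_fromBlocks, fromBlocks_neg]

/-! ### Peirce decomposition along the flag -/

/-- The projector to the coordinates in position `k` of the flag. -/
def pj (n q : ℕ) (R : Type*) [CommRing R] (k : ℕ) : Matrix (Fin n ⊕ Fin n) (Fin n ⊕ Fin n) R :=
  diagonal fun a => if lev n q a = k then 1 else 0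

section pj

variable {n q : ℕ} {R : Type*} [CommRing R]

theorem pj_mul_self (k : ℕ) : pj n q R k * pj n q R k = pj n q R k := by
  rw [pj, diagonal_mul_diagonal]
  congr 1
  ext a
  split_ifs <;> simp

theorem pj_mul_of_ne {k l : ℕ} (h : k ≠ l) : pj n q R k * pj n q R l = 0 := by
  rw [pj, pj, diagonal_mul_diagonal, ← diagonal_zero]
  congr 1
  ext a
  split_ifs with h1 h2 <;> simp
  omega

theorem pj_sum : pj n q R 0 + pj n q R 1 + pj n q R 2 = 1 := by
  rw [pj, pj, pj, diagonal_add, diagonal_add, ← diagonal_one]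
  congr 1
  ext a
  have h := lev_le_two (q := q) a
  obtain h | h | h : lev n q a = 0 ∨ lev n q a = 1 ∨ lev n q a = 2 := by omega
  all_goals simp [h]

theorem pj_mul_mul_apply (k l : ℕ) (X : Matrix (Fin n ⊕ Fin n) (Fin n ⊕ Fin n) R)
    (a b : Fin n ⊕ Fin n) :
    (pj n q R k * X * pj n q R l) a b = if lev n q a = k ∧ lev n q b = l then X a b else 0 := by
  rw [pj, pj, mul_diagonal, diagonal_mul]
  split_ifs <;> simp_all

theorem pj_eq_fromBlocks (k : ℕ) : pj n q R k =
    fromBlocks (diagonal fun i => if lev n q (Sum.inl i) = k then 1 else 0) 0 0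
      (diagonal fun i => if lev n q (Sum.inr i) = k then 1 else 0) := by
  rw [pj, fromBlocks_diagonal]
  congr 1
  ext (a | a) <;> rfl

/-- The symplectic form pairs level 0 with level 2 and level 1 with itself. -/
theorem adj_pj (k : ℕ) (hk : k ≤ 2) : adj (pj n q R k) = pj n q R (2 - k) := by
  rw [pj_eq_fromBlocks, pj_eq_fromBlocks, adj_fromBlocks]
  simp only [diagonal_transpose, transpose_zero, neg_zero]
  congr 2 <;> ext i <;> congr 1 <;> simp only [lev, Sum.elim_inl, Sum.elim_inr] <;>
    split_ifs <;> apply propext <;> omega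

theorem blockTriangular_iff_pj {X : Matrix (Fin n ⊕ Fin n) (Fin n ⊕ Fin n) R} :
    X.BlockTriangular (lev n q) ↔ ∀ k l, l < k → pj n q R k * X * pj n q R l = 0 := by
  constructor
  · intro h k l hkl
    ext a b
    rw [pj_mul_mul_apply]
    split_ifs with h1
    · exact h (by omega)
    · rfl
  · intro h a b hab
    have := congrFun (congrFun (h _ _ hab) a) b
    rw [pj_mul_mul_apply, if_pos ⟨rfl, rfl⟩] at this
    exact this

theorem eq_peirce {X : Matrix (Fin n ⊕ Fin n) (Fin n ⊕ Fin n) R}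
    (h : X.BlockTriangular (lev n q)) :
    X = pj n q R 0 * X * pj n q R 0 + pj n q R 0 * X * pj n q R 1 + pj n q R 0 * X * pj n q R 2
      + pj n q R 1 * X * pj n q R 1 + pj n q R 1 * X * pj n q R 2
      + pj n q R 2 * X * pj n q R 2 := by
  rw [blockTriangular_iff_pj] at h
  conv_lhs => rw [← Matrix.one_mul X, ← Matrix.mul_one (1 * X), ← pj_sum (n := n) (q := q)]
  simp only [Matrix.add_mul, Matrix.mul_add]
  rw [h 1 0 (by omega), h 2 0 (by omega), h 2 1 (by omega)]
  abel

/-- In the product, an intermediate index at another level meets a zero entry of X or of Y, so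
passing to a diagonal block is multiplicative. -/
theorem pj_mul_of_blockTriangular {X Y : Matrix (Fin n ⊕ Fin n) (Fin n ⊕ Fin n) R}
    (hX : X.BlockTriangular (lev n q)) (hY : Y.BlockTriangular (lev n q)) (k : ℕ) :
    pj n q R k * (X * Y) * pj n q R k
      = (pj n q R k * X * pj n q R k) * (pj n q R k * Y * pj n q R k) := by
  ext a b
  rw [pj_mul_mul_apply]
  refine Eq.trans ?_ Matrix.mul_apply.symm
  simp only [pj_mul_mul_apply]
  split_ifs with h
  · rw [Matrix.mul_apply]
    refine Finset.sum_congr rfl fun c _ => ?_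
    simp only [h, true_and, and_true]
    split_ifs with hc
    · rfl
    · rcases lt_or_gt_of_ne hc with h1 | h1
      · rw [hX (i := a) (j := c) (by omega)]; simp
      · rw [hY (i := c) (j := b) (by omega)]; simp
  · symm
    refine Finset.sum_eq_zero fun c _ => ?_
    by_cases ha : lev n q a = k
    · have hb : lev n q b ≠ k := fun hb => h ⟨ha, hb⟩
      simp [hb]
    · simp [ha]

end pj

/-- The data of a Levi decomposition of an upper triangular idempotent: orthogonal idempotents
`p`, `r`, `s`, diagonal blocks `α`, `ε`, `A` and off-diagonal blocks `b`, `B`, `D`. -/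
structure LeviData {S : Type*} [Ring S] (p r s α ε A b B D : S) : Prop where
  pr : p * r = 0
  ps : p * s = 0
  rp : r * p = 0
  rs : r * s = 0
  sp : s * p = 0
  sr : s * r = 0
  ss : s * s = s
  pα : p * α = α
  αp : α * p = α
  rε : r * ε = ε
  εr : ε * r = ε
  sA : s * A = A
  As : A * s = A
  pb : p * b = b
  br : b * r = b
  rB : r * B = B
  Bs : B * s = B
  pD : p * D = D
  Ds : D * s = D
  αα : α * α = α
  εε : ε * ε = ε
  AA : A * A = A

theorem mul_eq_zero_of_peirce {S : Type*} [Ring S] {x y e f : S} (hx : x * e = x) (hy : f * y = y)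
    (h : e * f = 0) : x * y = 0 := by
  rw [← hx, ← hy, mul_assoc, ← mul_assoc e, h, zero_mul, mul_zero]

namespace LeviData

variable {S : Type*} [Ring S] {p r s α ε A b B D : S}

/-- The part of the conjugating element in the centre of the unipotent radical. -/
def tPart (α ε A b B D : S) : S :=
  α * b * B - α * b * ε * B - α * b * B * A + α * b * ε * B * A + D - α * D - D * A

/-- The adjoint of `tPart`. -/
def tPartAdj (α ε A b B D : S) : S :=
  b * ε * B * A - α * b * ε * B * A - D + D * A + α * D

/-- The unipotent element that conjugates an upper triangular idempotent to its diagonal part. -/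
def uPart (α ε A b B D : S) : S :=
  1 + (b * ε - α * b) - (B - ε * B - B * A) + tPart α ε A b B D

/-- The adjoint of `uPart`. -/
def uPartAdj (α ε A b B D : S) : S :=
  1 - (b * ε - α * b) + (B - ε * B - B * A) + tPartAdj α ε A b B D

theorem mul_eq_zero (h : LeviData p r s α ε A b B D) :
    α * ε = 0 ∧ α * A = 0 ∧ α * B = 0 ∧ α * s = 0 ∧ ε * α = 0 ∧ ε * A = 0 ∧ ε * b = 0 ∧
    ε * D = 0 ∧ ε * s = 0 ∧ A * α = 0 ∧ A * ε = 0 ∧ A * b = 0 ∧ A * B = 0 ∧ A * D = 0 ∧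
    b * α = 0 ∧ b * A = 0 ∧ b * b = 0 ∧ b * D = 0 ∧ b * s = 0 ∧ B * α = 0 ∧ B * ε = 0 ∧
    B * b = 0 ∧ B * B = 0 ∧ B * D = 0 ∧ D * α = 0 ∧ D * ε = 0 ∧ D * b = 0 ∧ D * B = 0 ∧
    D * D = 0 ∧ s * α = 0 ∧ s * ε = 0 ∧ s * b = 0 ∧ s * B = 0 ∧ s * D = 0 :=
  ⟨mul_eq_zero_of_peirce h.αp h.rε h.pr, mul_eq_zero_of_peirce h.αp h.sA h.ps,
    mul_eq_zero_of_peirce h.αp h.rB h.pr, mul_eq_zero_of_peirce h.αp h.ss h.ps,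
    mul_eq_zero_of_peirce h.εr h.pα h.rp, mul_eq_zero_of_peirce h.εr h.sA h.rs,
    mul_eq_zero_of_peirce h.εr h.pb h.rp, mul_eq_zero_of_peirce h.εr h.pD h.rp,
    mul_eq_zero_of_peirce h.εr h.ss h.rs, mul_eq_zero_of_peirce h.As h.pα h.sp,
    mul_eq_zero_of_peirce h.As h.rε h.sr, mul_eq_zero_of_peirce h.As h.pb h.sp,
    mul_eq_zero_of_peirce h.As h.rB h.sr, mul_eq_zero_of_peirce h.As h.pD h.sp,
    mul_eq_zero_of_peirce h.br h.pα h.rp, mul_eq_zero_of_peirce h.br h.sA h.rs,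
    mul_eq_zero_of_peirce h.br h.pb h.rp, mul_eq_zero_of_peirce h.br h.pD h.rp,
    mul_eq_zero_of_peirce h.br h.ss h.rs, mul_eq_zero_of_peirce h.Bs h.pα h.sp,
    mul_eq_zero_of_peirce h.Bs h.rε h.sr, mul_eq_zero_of_peirce h.Bs h.pb h.sp,
    mul_eq_zero_of_peirce h.Bs h.rB h.sr, mul_eq_zero_of_peirce h.Bs h.pD h.sp,
    mul_eq_zero_of_peirce h.Ds h.pα h.sp, mul_eq_zero_of_peirce h.Ds h.rε h.sr,
    mul_eq_zero_of_peirce h.Ds h.pb h.sp, mul_eq_zero_of_peirce h.Ds h.rB h.sr,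
    mul_eq_zero_of_peirce h.Ds h.pD h.sp, mul_eq_zero_of_peirce h.ss h.pα h.sp,
    mul_eq_zero_of_peirce h.ss h.rε h.sr, mul_eq_zero_of_peirce h.ss h.pb h.sp,
    mul_eq_zero_of_peirce h.ss h.rB h.sr, mul_eq_zero_of_peirce h.ss h.pD h.sp⟩

theorem mul_mul_eq_zero (h : LeviData p r s α ε A b B D) (z : S) :
    α * (ε * z) = 0 ∧ α * (A * z) = 0 ∧ α * (B * z) = 0 ∧ α * (s * z) = 0 ∧ ε * (α * z) = 0 ∧
    ε * (A * z) = 0 ∧ ε * (b * z) = 0 ∧ ε * (D * z) = 0 ∧ ε * (s * z) = 0 ∧ A * (α * z) = 0 ∧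
    A * (ε * z) = 0 ∧ A * (b * z) = 0 ∧ A * (B * z) = 0 ∧ A * (D * z) = 0 ∧ b * (α * z) = 0 ∧
    b * (A * z) = 0 ∧ b * (b * z) = 0 ∧ b * (D * z) = 0 ∧ b * (s * z) = 0 ∧ B * (α * z) = 0 ∧
    B * (ε * z) = 0 ∧ B * (b * z) = 0 ∧ B * (B * z) = 0 ∧ B * (D * z) = 0 ∧ D * (α * z) = 0 ∧
    D * (ε * z) = 0 ∧ D * (b * z) = 0 ∧ D * (B * z) = 0 ∧ D * (D * z) = 0 ∧ s * (α * z) = 0 ∧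
    s * (ε * z) = 0 ∧ s * (b * z) = 0 ∧ s * (B * z) = 0 ∧ s * (D * z) = 0 := by
  simp only [← mul_assoc, h.mul_eq_zero, zero_mul, and_self]

theorem mul_mul_eq (h : LeviData p r s α ε A b B D) (z : S) :
    α * (α * z) = α * z ∧ ε * (ε * z) = ε * z ∧ A * (A * z) = A * z ∧ s * (A * z) = A * z ∧
    A * (s * z) = A * z ∧ B * (s * z) = B * z ∧ D * (s * z) = D * z := by
  simp only [← mul_assoc, h.αα, h.εε, h.AA, h.sA, h.As, h.Bs, h.Ds, and_self]

/-- The relations linking different blocks, which hold only modulo 2^j in the application, are not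
involved. Thus u is symplectic over ℤ, although it diagonalizes the idempotent only modulo 2^j. -/
theorem uPart_mul_uPartAdj (h : LeviData p r s α ε A b B D) :
    uPart α ε A b B D * uPartAdj α ε A b B D = 1 := by
  simp only [uPart, uPartAdj, tPart, tPartAdj, mul_add, add_mul, mul_sub, sub_mul, mul_one,
    one_mul, mul_assoc, h.mul_eq_zero, h.mul_mul_eq_zero, h.mul_mul_eq,
    mul_zero, sub_zero, add_zero]
  abel

/-- The upper triangular idempotent is conjugate to its diagonal part. -/
theorem mul_uPart (h : LeviData p r s α ε A b B D) (h1 : b * ε = b - α * b)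
    (h2 : D * A = α * D - b * B) (h3 : B * A = ε * B) :
    (α + b + D + ε - B + (s - A)) * uPart α ε A b B D
      = uPart α ε A b B D * (α + ε + (s - A)) := by
  have h1' : ∀ z, b * (ε * z) = b * z - α * (b * z) := fun z => by
    rw [← mul_assoc, h1, sub_mul, mul_assoc]
  simp only [uPart, tPart, mul_add, add_mul, mul_sub, sub_mul, mul_one,
    one_mul, mul_assoc, h.mul_eq_zero, h.mul_mul_eq_zero, h.mul_mul_eq,
    h.Bs, h.Ds, h1, h2, h3, h1',
    mul_zero, zero_mul, sub_zero, zero_sub, add_zero, zero_add, sub_self]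
  abel

end LeviData

/-! ### Congruences and reduction of the block data. -/

theorem map_eq_map_iff {ι : Type*} {N : ℕ} {X Y : Matrix ι ι ℤ} :
    X.map (Int.castRingHom (ZMod N)) = Y.map (Int.castRingHom (ZMod N)) ↔
      ∃ R : Matrix ι ι ℤ, X = Y + (N : ℤ) • R := by
  constructor
  · intro h
    have h1 : ∀ a b, ∃ r, X a b = Y a b + N * r := by
      intro a b
      have h2 := congrFun (congrFun h a) b
      simp only [Matrix.map_apply, eq_intCast] at h2
      obtain ⟨r, hr⟩ := (ZMod.intCast_eq_intCast_iff_dvd_sub _ _ _).1 h2.symm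
      exact ⟨r, by rw [← hr]; ring⟩
    choose R hR using h1
    exact ⟨R, by ext a b; exact hR a b⟩
  · rintro ⟨R, rfl⟩
    ext a b
    simp

namespace LeviData

variable {S T : Type*} [Ring S] [Ring T] {p r s α ε A b B D : S}

/-- Allows `mul_uPart` to be applied after reduction modulo 2^j. -/
theorem map (h : LeviData p r s α ε A b B D) (f : S →+* T) :
    LeviData (f p) (f r) (f s) (f α) (f ε) (f A) (f b) (f B) (f D) := by
  constructor <;> rw [← map_mul]
  · rw [h.pr, map_zero]
  · rw [h.ps, map_zero]
  · rw [h.rp, map_zero]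
  · rw [h.rs, map_zero]
  · rw [h.sp, map_zero]
  · rw [h.sr, map_zero]
  · rw [h.ss]
  · rw [h.pα]
  · rw [h.αp]
  · rw [h.rε]
  · rw [h.εr]
  · rw [h.sA]
  · rw [h.As]
  · rw [h.pb]
  · rw [h.br]
  · rw [h.rB]
  · rw [h.Bs]
  · rw [h.pD]
  · rw [h.Ds]
  · rw [h.αα]
  · rw [h.εε]
  · rw [h.AA]

theorem map_uPart (f : S →+* T) :
    f (uPart α ε A b B D) = uPart (f α) (f ε) (f A) (f b) (f B) (f D) := by
  simp [uPart, tPart]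

/-- The correction terms of u have no middle block, so u will act trivially on F_q. -/
theorem mul_uPart_mul (h : LeviData p r s α ε A b B D) (hr : r * r = r) :
    r * uPart α ε A b B D * r = r := by
  have h1 : r * b = 0 := by rw [← h.pb, ← mul_assoc, h.rp, zero_mul]
  have h2 : r * α = 0 := by rw [← h.pα, ← mul_assoc, h.rp, zero_mul]
  have h3 : r * D = 0 := by rw [← h.pD, ← mul_assoc, h.rp, zero_mul]
  have h4 : B * r = 0 := by rw [← h.Bs, mul_assoc, h.sr, mul_zero]
  have h5 : A * r = 0 := by rw [← h.As, mul_assoc, h.sr, mul_zero]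
  have h1' : ∀ z, r * (b * z) = 0 := fun z => by rw [← mul_assoc, h1, zero_mul]
  have h2' : ∀ z, r * (α * z) = 0 := fun z => by rw [← mul_assoc, h2, zero_mul]
  have h3' : ∀ z, r * (D * z) = 0 := fun z => by rw [← mul_assoc, h3, zero_mul]
  simp only [uPart, tPart, mul_add, add_mul, mul_sub, sub_mul, mul_one, mul_assoc,
    h1', h2', h3', h4, h5, hr, mul_zero, zero_mul, sub_zero, add_zero]

end LeviData

theorem lev_inl_eq_zero_iff {n q : ℕ} {i : Fin n} : lev n q (Sum.inl i) = 0 ↔ q ≤ i := by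
  simp [lev]

theorem lev_inr_eq_two_iff {n q : ℕ} {i : Fin n} : lev n q (Sum.inr i) = 2 ↔ q ≤ i := by
  simp [lev]

theorem lev_inl_ne_two {n q : ℕ} (i : Fin n) : lev n q (Sum.inl i) ≠ 2 := by
  simp only [lev, Sum.elim_inl]
  split_ifs <;> omega

theorem lev_inr_ne_zero {n q : ℕ} (i : Fin n) : lev n q (Sum.inr i) ≠ 0 := by
  simp only [lev, Sum.elim_inr]
  split_ifs <;> omega

theorem blockTriangular_pj_mul_mul {n q : ℕ} {R : Type*} [CommRing R] {k l : ℕ} (hkl : k ≤ l)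
    (X : Matrix (Fin n ⊕ Fin n) (Fin n ⊕ Fin n) R) :
    (pj n q R k * X * pj n q R l).BlockTriangular (lev n q) := by
  intro a b hab
  rw [pj_mul_mul_apply, if_neg (by omega)]

theorem pj_mul_mul_eq_sum {n q : ℕ} {R : Type*} [CommRing R] (k l : ℕ)
    (X Y : Matrix (Fin n ⊕ Fin n) (Fin n ⊕ Fin n) R) :
    pj n q R k * (X * Y) * pj n q R l
      = (pj n q R k * X * pj n q R 0) * (pj n q R 0 * Y * pj n q R l)
      + (pj n q R k * X * pj n q R 1) * (pj n q R 1 * Y * pj n q R l)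
      + (pj n q R k * X * pj n q R 2) * (pj n q R 2 * Y * pj n q R l) := by
  have h : ∀ m, (pj n q R k * X * pj n q R m) * (pj n q R m * Y * pj n q R l)
      = pj n q R k * X * pj n q R m * (Y * pj n q R l) := fun m => by
    rw [Matrix.mul_assoc (pj n q R m) Y, ← Matrix.mul_assoc _ (pj n q R m),
      Matrix.mul_assoc _ (pj n q R m) (pj n q R m), pj_mul_self]
  rw [h, h, h, ← Matrix.add_mul, ← Matrix.add_mul, ← Matrix.mul_add, ← Matrix.mul_add, pj_sum]
  simp only [Matrix.mul_one, Matrix.mul_assoc]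

/-- An integral matrix that stabilizes the flag and that modulo `2^j` is an idempotent compatible
with the symplectic form is congruent modulo `2^j`, up to conjugation by the unipotent radical, to a
block diagonal idempotent. -/
theorem exists_levi {n q j : ℕ} {M : Matrix (Fin n ⊕ Fin n) (Fin n ⊕ Fin n) ℤ}
    (hbt : M.BlockTriangular (lev n q))
    (hεε : (pj n q ℤ 1 * M * pj n q ℤ 1) * (pj n q ℤ 1 * M * pj n q ℤ 1)
      = pj n q ℤ 1 * M * pj n q ℤ 1)
    (hε : adj (pj n q ℤ 1 * M * pj n q ℤ 1) = pj n q ℤ 1 - pj n q ℤ 1 * M * pj n q ℤ 1)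
    (hM : (M * M).map (Int.castRingHom (ZMod (2 ^ j))) = M.map (Int.castRingHom (ZMod (2 ^ j))))
    (hMa : (adj M).map (Int.castRingHom (ZMod (2 ^ j)))
      = (1 - M).map (Int.castRingHom (ZMod (2 ^ j)))) :
    ∃ (u : Sp n ℤ) (α : Matrix (Fin n ⊕ Fin n) (Fin n ⊕ Fin n) ℤ),
      u.1.BlockTriangular (lev n q) ∧ pj n q ℤ 1 * u.1 * pj n q ℤ 1 = pj n q ℤ 1 ∧
      α * α = α ∧ pj n q ℤ 0 * α * pj n q ℤ 0 = α ∧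
      (M * u.1).map (Int.castRingHom (ZMod (2 ^ j)))
        = (u.1 * (α + pj n q ℤ 1 * M * pj n q ℤ 1 + (pj n q ℤ 2 - adj α))).map
          (Int.castRingHom (ZMod (2 ^ j))) := by
  set φ : Matrix (Fin n ⊕ Fin n) (Fin n ⊕ Fin n) ℤ →+*
    Matrix (Fin n ⊕ Fin n) (Fin n ⊕ Fin n) (ZMod (2 ^ j)) :=
      (Int.castRingHom (ZMod (2 ^ j))).mapMatrix with hφ
  have hφa : ∀ X, X.map (Int.castRingHom (ZMod (2 ^ j))) = φ X := fun X => rfl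
  have hφadj : ∀ X Y, φ X = φ Y → φ (adj X) = φ (adj Y) := fun X Y h => by
    rw [← hφa, ← hφa, ← adj_map, ← adj_map, hφa, hφa, h]
  rw [hφa, hφa] at hM hMa
  simp only [hφa]
  set p := pj n q ℤ 0 with hp
  set r := pj n q ℤ 1 with hr
  set s := pj n q ℤ 2 with hs
  have hpp : p * p = p := pj_mul_self 0
  have hrr : r * r = r := pj_mul_self 1
  have hss : s * s = s := pj_mul_self 2
  have hadjp : adj p = s := adj_pj 0 (by omega)
  have hadjr : adj r = r := adj_pj 1 (by omega)
  have hadjs : adj s = p := adj_pj 2 (by omega)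
  set ε := r * M * r with hεdef
  have hbtpj := blockTriangular_iff_pj.1 hbt
  have hMM : ∀ k l, φ (pj n q ℤ k * (M * M) * pj n q ℤ l) = φ (pj n q ℤ k * M * pj n q ℤ l) := by
    intro k l
    rw [map_mul, map_mul, hM, ← map_mul, ← map_mul]
  have hMad : ∀ k l, φ (pj n q ℤ k * adj M * pj n q ℤ l)
      = φ (pj n q ℤ k * pj n q ℤ l - pj n q ℤ k * M * pj n q ℤ l) := by
    intro k l
    rw [map_mul, map_mul, hMa, ← map_mul, ← map_mul, Matrix.mul_sub, Matrix.sub_mul,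
      Matrix.mul_one]
  obtain ⟨R, hR⟩ := map_eq_map_iff.1 (show
    ((p * M * p) * (p * M * p)).map (Int.castRingHom (ZMod (2 ^ j)))
      = (p * M * p).map (Int.castRingHom (ZMod (2 ^ j))) by
    rw [hφa, hφa, ← hMM, ← pj_mul_of_blockTriangular hbt hbt])
  -- Block triangularity makes the corner of M on W_q idempotent modulo 2^j, hence congruent to an
  -- exact idempotent.
  obtain ⟨α, R', hαα, hpα, hαM⟩ := exists_idempotent_matrix_lift (j := j) hpp
    (M := p * M * p) (R := R) (by
      rw [← Matrix.mul_assoc, ← Matrix.mul_assoc, hpp, Matrix.mul_assoc, Matrix.mul_assoc,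
        Matrix.mul_assoc, hpp]) (by rw [hR]; push_cast; rfl)
  have hφα : φ α = φ (p * M * p) := by
    rw [← hφa, ← hφa]
    exact map_eq_map_iff.2 ⟨R', by rw [hαM]; push_cast; rfl⟩
  set b := p * M * r with hb
  set B₀ := (p * M * s).toBlocks₁₂ with hB₀
  have hB₀a : ∀ i k, ¬(lev n q (Sum.inl i) = 0 ∧ lev n q (Sum.inr k) = 2) → B₀ i k = 0 := by
    intro i k h
    change (p * M * s) (Sum.inl i) (Sum.inr k) = 0
    rw [hp, hs, pj_mul_mul_apply, if_neg h]
  have hpMs : p * M * s = fromBlocks 0 B₀ 0 0 := by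
    ext (i | i) (k | k)
    · rw [hp, hs, pj_mul_mul_apply, if_neg]
      · rfl
      · exact fun h => lev_inl_ne_two k h.2
    · rfl
    · rw [hp, hs, pj_mul_mul_apply, if_neg]
      · rfl
      · exact fun h => lev_inr_ne_zero i h.1
    · rw [hp, hs, pj_mul_mul_apply, if_neg]
      · rfl
      · exact fun h => lev_inr_ne_zero i h.1
  -- In the upper right corner, adj M ≡ 1 - M says that B₀ is symmetric modulo 2^j. An exactly
  -- symmetric lift gives adj D = -D, which is needed for u to be symplectic.
  obtain ⟨R₂, hR₂⟩ : ∃ R, B₀ = B₀ᵀ + ((2 ^ j : ℕ) : ℤ) • R := by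
    rw [← map_eq_map_iff]
    have h1 := hMad 0 2
    have h2 : pj n q ℤ 0 * adj M * pj n q ℤ 2 = adj (p * M * s) := by
      rw [adj_mul, adj_mul, hadjp, hadjs, Matrix.mul_assoc]
    rw [h2, ← hp, ← hs, hpMs, adj_fromBlocks, pj_mul_of_ne (by omega), zero_sub, ← hφa, ← hφa] at h1
    ext i k
    have h3 := congrFun (congrFun h1 (Sum.inl i)) (Sum.inr k)
    simp only [Matrix.map_apply, fromBlocks_apply₁₂, Matrix.neg_apply, map_neg, neg_inj] at h3 ⊢
    exact h3.symm
  obtain ⟨B₁, R₃, hB₁t, hB₁, hB₁0⟩ := exists_symm_lift hR₂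
  set D : Matrix (Fin n ⊕ Fin n) (Fin n ⊕ Fin n) ℤ := fromBlocks 0 B₁ 0 0 with hD
  have hadjD : adj D = -D := by
    rw [hD, adj_fromBlocks, hB₁t, fromBlocks_neg]; simp
  have hφD : φ D = φ (p * M * s) := by
    rw [hpMs, ← hφa, ← hφa, hD, fromBlocks_map, fromBlocks_map,
      map_eq_map_iff.2 ⟨R₃, hB₁⟩]
  have hpDs : p * D * s = D := by
    ext a c
    rw [hp, hs, pj_mul_mul_apply]
    split_ifs with h
    · rfl
    · rcases a with i | i <;> rcases c with k | k
      · rfl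
      · refine (hB₁0 i k (hB₀a i k h) (hB₀a k i fun h' => h ?_)).symm
        exact ⟨lev_inl_eq_zero_iff.2 (lev_inr_eq_two_iff.1 h'.2), lev_inr_eq_two_iff.2 (lev_inl_eq_zero_iff.1 h'.1)⟩
      · rfl
      · rfl
  have hpα1 : p * α = α := by rw [← hpα, ← Matrix.mul_assoc, ← Matrix.mul_assoc, hpp]
  have hαp1 : α * p = α := by rw [← hpα, Matrix.mul_assoc, hpp]
  set A := adj α with hA
  set B := adj b with hB
  have hadjA : adj A = α := adj_adj α
  have hadjB : adj B = b := adj_adj b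
  have hpb : p * b = b := by rw [hb, ← Matrix.mul_assoc, ← Matrix.mul_assoc, hpp]
  have hbr : b * r = b := by rw [hb, Matrix.mul_assoc, hrr]
  have hrB : r * B = B := by rw [hB, ← hadjr, ← adj_mul, hbr]
  have hBs : B * s = B := by rw [hB, ← hadjp, ← adj_mul, hpb]
  have hL : LeviData p r s α ε A b B D :=
    { pr := pj_mul_of_ne (by omega)
      ps := pj_mul_of_ne (by omega)
      rp := pj_mul_of_ne (by omega)
      rs := pj_mul_of_ne (by omega)
      sp := pj_mul_of_ne (by omega)
      sr := pj_mul_of_ne (by omega)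
      ss := hss
      pα := hpα1
      αp := hαp1
      rε := by rw [hεdef, ← Matrix.mul_assoc, ← Matrix.mul_assoc, hrr]
      εr := by rw [hεdef, Matrix.mul_assoc, hrr]
      sA := by rw [hA, ← hadjp, ← adj_mul, hαp1]
      As := by rw [hA, ← hadjp, ← adj_mul, hpα1]
      pb := hpb
      br := hbr
      rB := hrB
      Bs := hBs
      pD := by rw [← hpDs, ← Matrix.mul_assoc, ← Matrix.mul_assoc, hpp]
      Ds := by rw [← hpDs, Matrix.mul_assoc, hss]
      αα := hαα
      εε := hεε
      AA := by rw [hA, ← adj_mul, hαα] }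
  have hadju : adj (LeviData.uPart α ε A b B D) = LeviData.uPartAdj α ε A b B D := by
    simp only [LeviData.uPart, LeviData.tPart, LeviData.uPartAdj, LeviData.tPartAdj, adj_add,
      adj_sub, adj_mul, adj_one, ← hA, ← hB, hadjA, hadjB, hadjD, hε, Matrix.mul_sub,
      Matrix.sub_mul, hbr, hrB, Matrix.mul_assoc,
      Matrix.mul_neg, Matrix.neg_mul]
    abel
  have hsp : LeviData.uPart α ε A b B D ∈ Matrix.symplecticGroup (Fin n) ℤ := by
    rw [mem_symplecticGroup_iff_mul_adj, hadju]
    exact hL.uPart_mul_uPartAdj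
  -- The blocks mapping out of level 2 are determined modulo 2^j by adj M ≡ 1 - M: they are -adj b
  -- and s - adj α.
  have hrMs : φ (r * M * s) = -φ B := by
    have h1 := hMad 1 2
    have h2 : pj n q ℤ 1 * adj M * pj n q ℤ 2 = B := by
      rw [hB, hb, adj_mul, adj_mul, hadjp, hadjr, Matrix.mul_assoc]
    rw [h2, pj_mul_of_ne (by omega), zero_sub, map_neg] at h1
    rw [h1, neg_neg]
  have hsMs : φ (s * M * s) = φ s - φ A := by
    have h1 := hMad 2 2
    have h2 : pj n q ℤ 2 * adj M * pj n q ℤ 2 = adj (p * M * p) := by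
      rw [adj_mul, adj_mul, hadjp, Matrix.mul_assoc]
    rw [h2, pj_mul_self, map_sub] at h1
    rw [hA, hφadj _ _ hφα, h1]; abel
  -- The next two identities are the (0,1) and (0,2) blocks of M² ≡ M; the third is the adjoint of
  -- the first.
  have h1 : φ b * φ ε = φ b - φ α * φ b := by
    have h2 := hMM 0 1
    rw [pj_mul_mul_eq_sum, hbtpj 2 1 (by omega), Matrix.mul_zero, add_zero, map_add,
      map_mul φ (p * M * p) b, map_mul φ b ε] at h2
    rw [hφα, eq_sub_iff_add_eq']
    exact h2
  have h2 : φ D * φ A = φ α * φ D - φ b * φ B := by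
    have h3 := hMM 0 2
    rw [pj_mul_mul_eq_sum, map_add, map_add, map_mul φ (p * M * p) (p * M * s),
      map_mul φ b (r * M * s), map_mul φ (p * M * s) (s * M * s), hrMs,
      hsMs, ← hφα, ← hφD, mul_sub, ← map_mul φ D s, hL.Ds, mul_neg] at h3
    rw [← sub_eq_zero, ← neg_eq_zero]
    refine Eq.trans ?_ (sub_eq_zero.2 h3)
    abel
  have h3 : φ B * φ A = φ ε * φ B := by
    rw [← map_mul, ← map_mul, ← map_sub] at h1
    have h4 := hφadj _ _ h1
    rw [adj_mul b ε, hε, adj_sub, adj_mul α b, Matrix.sub_mul, hrB, map_sub, map_sub,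
      sub_right_inj, map_mul φ (adj b) (adj α), map_mul φ ε (adj b)] at h4
    exact h4.symm
  refine ⟨⟨LeviData.uPart α ε A b B D, hsp⟩, α, ?_, hL.mul_uPart_mul hrr, hαα, hpα, ?_⟩
  · have tα : α.BlockTriangular (lev n q) := hpα ▸ blockTriangular_pj_mul_mul le_rfl α
    have tε : ε.BlockTriangular (lev n q) := blockTriangular_pj_mul_mul le_rfl M
    have tb : b.BlockTriangular (lev n q) := blockTriangular_pj_mul_mul (by omega) M
    have tD : D.BlockTriangular (lev n q) := hpDs ▸ blockTriangular_pj_mul_mul (by omega) D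
    have tA : A.BlockTriangular (lev n q) := by
      have : s * A * s = A := by rw [hL.sA, hL.As]
      exact this ▸ blockTriangular_pj_mul_mul le_rfl A
    have tB : B.BlockTriangular (lev n q) := by
      have : r * B * s = B := by rw [hL.rB, hL.Bs]
      exact this ▸ blockTriangular_pj_mul_mul (by omega) B
    have t1 := (tα.mul tb).mul tB
    have t2 := ((tα.mul tb).mul tε).mul tB
    exact ((blockTriangular_one.add ((tb.mul tε).sub (tα.mul tb))).sub
      ((tB.sub (tε.mul tB)).sub (tB.mul tA))).add
      ((((((t1.sub t2).sub (t1.mul tA)).add (t2.mul tA)).add tD).sub (tα.mul tD)).sub (tD.mul tA))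
  · change φ (M * LeviData.uPart α ε A b B D) = φ (LeviData.uPart α ε A b B D * _)
    have hMdec : φ M = φ α + φ b + φ D + φ ε - φ B + (φ s - φ A) := by
      rw [eq_peirce hbt, map_add, map_add, map_add, map_add, map_add, ← hp, ← hr, ← hs, hrMs,
        hsMs, ← hφα, ← hφD]
      abel
    rw [map_mul, map_mul, LeviData.map_uPart, hMdec, map_add, map_add, map_sub]
    exact (hL.map φ).mul_uPart h1 h2 h3

/-! ### Integral points of a boundary component -/

theorem toRat_tauSp {n : ℕ} (g : Sp n ℤ) : toRat (tauSp g) = tauSp (toRat g) := by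
  apply Subtype.ext
  change (Iminus n ℤ * g.1 * Iminus n ℤ).map _ = Iminus n ℚ * g.1.map _ * Iminus n ℚ
  have hI : (Iminus n ℤ).map (Int.castRingHom ℚ) = Iminus n ℚ := by
    simp [Iminus, Matrix.fromBlocks_map, Matrix.map_neg]
  rw [Matrix.map_mul, Matrix.map_mul, hI]

theorem tau_smul_stdPoint_iff {n q : ℕ} (hq : q ≤ n) (g γ : Sp n ℤ) (Z : Siegel q) :
    (toRat g • stdPoint hq Z).tau = γ • toRat g • stdPoint hq Z ↔
      actSub (toRat ((tauSp g)⁻¹ * γ * g)) (phi hq Z) = phi hq Z.tau := by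
  rw [tau_smul_eq_iff, ← toRat_tauSp, ← map_inv, ← map_mul, ← map_mul, ← tauSub_phi]
  rfl

theorem blockTriangular_toRat_iff {n q : ℕ} {g : Sp n ℤ} :
    (toRat g).1.BlockTriangular (lev n q) ↔ g.1.BlockTriangular (lev n q) := by
  have h : ∀ a b, (toRat g).1 a b = (g.1 a b : ℚ) := fun a b => rfl
  constructor <;> intro hg a b hab
  · have := hg hab
    rw [h] at this
    exact_mod_cast this
  · rw [h, hg hab]; simp

theorem actSub_toRat_phi_iff {n q : ℕ} (hq : q ≤ n) {g : Sp n ℤ}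
    (h : g.1.BlockTriangular (lev n q)) (Z₁ Z₂ : Siegel q) :
    actSub (toRat g) (phi hq Z₁) = phi hq Z₂ ↔
      Rel ((blk hq g.1).map (Int.castRingHom ℂ)) Z₁ Z₂ := by
  rw [actSub_phi_iff hq (blockTriangular_toRat_iff.2 h)]
  have : (blk hq (toRat g).1).map (algebraMap ℚ ℂ) = (blk hq g.1).map (Int.castRingHom ℂ) := by
    ext i j; simp [blk, toRat]
  rw [this]

/-- A component depends on its translating element only through the translate of W_q. -/
theorem range_smul_stdPoint_eq {n q : ℕ} (hq : q ≤ n) {g₀ g : Sp n ℚ}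
    (h : actSub (g₀⁻¹ * g) (stdIsotropic n q) = stdIsotropic n q) :
    Set.range (fun Z : Siegel q => g₀ • stdPoint hq Z)
      = Set.range (fun Z : Siegel q => g • stdPoint hq Z) := by
  have key : ∀ g₀ g : Sp n ℚ, actSub (g₀⁻¹ * g) (stdIsotropic n q) = stdIsotropic n q →
      Set.range (fun Z : Siegel q => g • stdPoint hq Z)
        ⊆ Set.range (fun Z : Siegel q => g₀ • stdPoint hq Z) := by
    rintro g₀ g h _ ⟨Z, rfl⟩
    obtain ⟨Z', hZ'⟩ := exists_actSub_phi hq h Z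
    have h1 : (g₀⁻¹ * g) • stdPoint hq Z = stdPoint hq Z' := Subtype.ext hZ'
    refine ⟨Z', ?_⟩
    change g₀ • stdPoint hq Z' = g • stdPoint hq Z
    rw [← h1, smul_smul, mul_inv_cancel_left]
  refine (key g g₀ ?_).antisymm (key g₀ g h)
  have h2 := actSub_inv_actSub (g₀⁻¹ * g) (stdIsotropic n q)
  rwa [h, _root_.mul_inv_rev, inv_inv] at h2

theorem blk_mul {n q : ℕ} (hq : q ≤ n) {R : Type*} [CommRing R]
    {X Y : Matrix (Fin n ⊕ Fin n) (Fin n ⊕ Fin n) R} (hX : X.BlockTriangular (lev n q))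
    (hY : Y.BlockTriangular (lev n q)) : blk hq (X * Y) = blk hq X * blk hq Y := by
  ext i j
  change (X * Y) (hIdx hq i) (hIdx hq j) = ∑ k, X (hIdx hq i) (hIdx hq k) * Y (hIdx hq k) (hIdx hq j)
  rw [Matrix.mul_apply]
  refine sum_hIdx hq _ fun c hc => ?_
  have h1 := lev_hIdx hq i
  have h2 := lev_hIdx hq j
  rcases lt_or_gt_of_ne hc with h | h
  · rw [hX (i := hIdx hq i) (j := c) (by omega), zero_mul]
  · rw [hY (i := c) (j := hIdx hq j) (by omega), mul_zero]

theorem blk_eq_iff {n q : ℕ} (hq : q ≤ n) {R : Type*} [CommRing R]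
    {X Y : Matrix (Fin n ⊕ Fin n) (Fin n ⊕ Fin n) R} :
    blk hq X = blk hq Y ↔ pj n q R 1 * X * pj n q R 1 = pj n q R 1 * Y * pj n q R 1 := by
  constructor
  · intro h
    ext a b
    rw [pj_mul_mul_apply, pj_mul_mul_apply]
    split_ifs with h1
    · obtain ⟨i, rfl⟩ := exists_hIdx hq h1.1
      obtain ⟨j, rfl⟩ := exists_hIdx hq h1.2
      exact congrFun (congrFun h i) j
    · rfl
  · intro h
    ext i j
    have h1 := congrFun (congrFun h (hIdx hq i)) (hIdx hq j)
    rwa [pj_mul_mul_apply, pj_mul_mul_apply, if_pos ⟨lev_hIdx hq i, lev_hIdx hq j⟩,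
      if_pos ⟨lev_hIdx hq i, lev_hIdx hq j⟩] at h1

theorem blk_one {n q : ℕ} (hq : q ≤ n) {R : Type*} [CommRing R] :
    blk hq (1 : Matrix (Fin n ⊕ Fin n) (Fin n ⊕ Fin n) R) = 1 :=
  submatrix_one _ (hIdx_injective hq)

/-- An integral symplectic matrix that is congruent to `1` modulo `4` and fixes a point of the
standard boundary component acts trivially on the component. -/
theorem blk_eq_one_of_fixes {n q : ℕ} (hq : q ≤ n) {g : Sp n ℤ}
    {S : Matrix (Fin n ⊕ Fin n) (Fin n ⊕ Fin n) ℤ} (hg : g.1 = 1 + (4 : ℤ) • S) {Z : Siegel q}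
    (hZ : actSub (toRat g) (phi hq Z) = phi hq Z) : blk hq g.1 = 1 := by
  have hbt : g.1.BlockTriangular (lev n q) :=
    blockTriangular_toRat_iff.1 (blockTriangular_of_actSub_phi hZ)
  -- All powers of g fix the same point, so one constant bounds all their middle blocks: the
  -- stabilizer of a point of F_q is compact modulo its action elsewhere.
  have hpow : ∀ r : ℕ, actSub (toRat (g ^ r)) (phi hq Z) = phi hq Z := by
    intro r
    induction r with
    | zero => rw [pow_zero, map_one, actSub_one]
    | succ r ih => rw [pow_succ, map_mul, actSub_mul, hZ, ih]
  have hpowbt : ∀ r : ℕ, (g ^ r).1.BlockTriangular (lev n q) := fun r =>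
    blockTriangular_toRat_iff.1 (blockTriangular_of_actSub_phi (hpow r))
  have hblk : ∀ r : ℕ, blk hq (g ^ r).1 = blk hq g.1 ^ r := by
    intro r
    induction r with
    | zero => exact blk_one hq
    | succ r ih => rw [pow_succ, pow_succ, ← ih]; exact blk_mul hq (hpowbt r) hbt
  obtain ⟨b, hb, hgood⟩ := eventually_good hq Z
  have hZg := hgood.self_of_nhds
  refine eq_one_of_bounded_powers (S := blk hq S) (K := ⌈4 * b⌉) ?_ ?_
  · rw [hg, ← blk_one hq]; rfl
  · intro r i j
    rw [← hblk]
    have h1 := norm_entry_le hb.le hZg (fun u hu i => hZg.norm_sq_le hu i) (hpow r).le i j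
    have h2 : |(((g ^ r).1 (hIdx hq i) (hIdx hq j) : ℤ) : ℝ)| ≤ 4 * b := by
      have h3 : (((toRat (g ^ r)).1 (hIdx hq i) (hIdx hq j) : ℚ) : ℝ)
          = (((g ^ r).1 (hIdx hq i) (hIdx hq j) : ℤ) : ℝ) := Rat.cast_intCast _
      rwa [h3] at h1
    have h4 := h2.trans (Int.le_ceil _)
    exact_mod_cast h4

/-! ### Replacing the real structure by a block diagonal one -/

theorem blockTriangular_adj {n q : ℕ} {R : Type*} [CommRing R]
    {X : Matrix (Fin n ⊕ Fin n) (Fin n ⊕ Fin n) R} (hX : X.BlockTriangular (lev n q)) :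
    (adj X).BlockTriangular (lev n q) := by
  rw [← fromBlocks_toBlocks X, adj_fromBlocks]
  rintro (i | i) (k | k) h
  · refine hX (i := Sum.inr k) (j := Sum.inr i) ?_
    simp only [lev, Sum.elim_inl, Sum.elim_inr] at h ⊢
    split_ifs at h ⊢ <;> omega
  · change -X (Sum.inl k) (Sum.inr i) = 0
    rw [hX (i := Sum.inl k) (j := Sum.inr i), neg_zero]
    simp only [lev, Sum.elim_inl, Sum.elim_inr] at h ⊢
    split_ifs at h ⊢ <;> omega
  · change -X (Sum.inr k) (Sum.inl i) = 0
    rw [hX (i := Sum.inr k) (j := Sum.inl i), neg_zero]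
    simp only [lev, Sum.elim_inl, Sum.elim_inr] at h ⊢
    split_ifs at h ⊢ <;> omega
  · refine hX (i := Sum.inl k) (j := Sum.inl i) ?_
    simp only [lev, Sum.elim_inl, Sum.elim_inr] at h ⊢
    split_ifs at h ⊢ <;> omega

theorem Iminus_eq_diagonal (n : ℕ) (R : Type) [CommRing R] :
    Iminus n R = diagonal (Sum.elim (fun _ => -1) fun _ => 1) := by
  rw [Iminus, ← fromBlocks_diagonal]
  congr 1
  rw [← diagonal_one, diagonal_neg]

theorem blockTriangular_Iminus_mul {n q : ℕ} {R : Type} [CommRing R]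
    {X : Matrix (Fin n ⊕ Fin n) (Fin n ⊕ Fin n) R} (hX : X.BlockTriangular (lev n q)) :
    (Iminus n R * X).BlockTriangular (lev n q) := by
  refine BlockTriangular.mul ?_ hX
  rw [Iminus_eq_diagonal]
  exact blockTriangular_diagonal _

theorem pj_mul_Iminus {n q : ℕ} {R : Type} [CommRing R] (k : ℕ) :
    pj n q R k * Iminus n R = Iminus n R * pj n q R k := by
  rw [Iminus_eq_diagonal, pj, diagonal_mul_diagonal, diagonal_mul_diagonal]
  simp only [mul_comm]

/-- The symplectic idempotent with image the last `n` coordinates. -/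
def halfProj (n : ℕ) (R : Type) [CommRing R] : Matrix (Fin n ⊕ Fin n) (Fin n ⊕ Fin n) R :=
  fromBlocks 0 0 0 1

theorem two_smul_halfProj (n : ℕ) : (2 : ℤ) • halfProj n ℤ = 1 + Iminus n ℤ := by
  rw [halfProj, Iminus, ← fromBlocks_one, fromBlocks_add, fromBlocks_smul]
  congr 1 <;> simp [two_smul]

theorem halfProj_mul_self (n : ℕ) (R : Type) [CommRing R] :
    halfProj n R * halfProj n R = halfProj n R := by
  simp [halfProj, fromBlocks_multiply]

theorem adj_halfProj (n : ℕ) (R : Type) [CommRing R] :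
    adj (halfProj n R) = 1 - halfProj n R := by
  rw [halfProj, adj_fromBlocks, ← fromBlocks_one, sub_eq_add_neg, fromBlocks_neg, fromBlocks_add]
  simp

theorem smul_left_injective_int {ι : Type*} {m : ℤ} (hm : m ≠ 0) {X Y : Matrix ι ι ℤ}
    (h : m • X = m • Y) : X = Y := by
  ext i j
  have := congrFun (congrFun h i) j
  exact mul_left_cancel₀ hm this

theorem four_smul {M : Type*} [AddCommGroup M] (x : M) : (4 : ℤ) • x = x + x + (x + x) := by
  rw [show (4 : ℤ) = 2 + 2 by norm_num, add_smul, two_smul]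

/-- The relative position `τ(g)⁻¹ γ g` of a real structure and an integral basis, for `γ` congruent
to `1` modulo `2^(j+1)`. -/
theorem exists_half {n j : ℕ} (g : Sp n ℤ) {γ : Sp n ℤ} (hγ : γ ∈ Gam n (2 ^ (j + 1))) :
    ∃ M : Matrix (Fin n ⊕ Fin n) (Fin n ⊕ Fin n) ℤ,
      Iminus n ℤ * ((tauSp g)⁻¹ * γ * g).1 = (2 : ℤ) • M - 1 ∧
      M.map (Int.castRingHom (ZMod (2 ^ j)))
        = (adj g.1 * halfProj n ℤ * g.1).map (Int.castRingHom (ZMod (2 ^ j))) := by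
  have h1 : γ.1.map (Int.castRingHom (ZMod (2 ^ (j + 1))))
      = (1 : Matrix (Fin n ⊕ Fin n) (Fin n ⊕ Fin n) ℤ).map
        (Int.castRingHom (ZMod (2 ^ (j + 1)))) := by
    rw [Matrix.map_one _ (map_zero _) (map_one _)]
    exact hγ
  obtain ⟨S, hS⟩ := map_eq_map_iff.1 h1
  -- Writing γ = 1 + 2^(j+1)S, one has I₋δ = g⁻¹I₋γg. Adding 1 and halving costs one power of 2 in
  -- the congruence.
  refine ⟨adj g.1 * halfProj n ℤ * g.1 + ((2 ^ j : ℕ) : ℤ) • (adj g.1 * (Iminus n ℤ * S) * g.1),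
    ?_, map_eq_map_iff.2 ⟨_, rfl⟩⟩
  have h2 : ((tauSp g)⁻¹ * γ * g).1 = Iminus n ℤ * adj g.1 * Iminus n ℤ * γ.1 * g.1 := by
    rw [← map_inv, ← coe_inv_eq_adj]; rfl
  have h3 : (2 : ℤ) • (adj g.1 * halfProj n ℤ * g.1) = 1 + adj g.1 * Iminus n ℤ * g.1 := by
    rw [← Matrix.smul_mul, ← Matrix.mul_smul, two_smul_halfProj, Matrix.mul_add, Matrix.add_mul,
      Matrix.mul_one, adj_mul_self]
  rw [h2, smul_add, h3, smul_smul, hS]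
  have h4 : (2 : ℤ) * ((2 ^ j : ℕ) : ℤ) = ((2 ^ (j + 1) : ℕ) : ℤ) := by push_cast; ring
  rw [h4]
  have h5 : Iminus n ℤ * (Iminus n ℤ * adj g.1 * Iminus n ℤ
      * (1 + ((2 ^ (j + 1) : ℕ) : ℤ) • S) * g.1)
      = (Iminus n ℤ * Iminus n ℤ) * (adj g.1 * Iminus n ℤ
      * (1 + ((2 ^ (j + 1) : ℕ) : ℤ) • S) * g.1) := by
    simp only [Matrix.mul_assoc]
  rw [h5, Iminus_mul_self, Matrix.one_mul, Matrix.mul_add, Matrix.add_mul, Matrix.mul_one,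
    Matrix.mul_smul, Matrix.smul_mul]
  simp only [Matrix.mul_assoc]
  abel

/-- A converse to `exists_half`: a symplectic involution built from an idempotent comes from an
element of the congruence subgroup. -/
theorem exists_mem_Gam {n j : ℕ} (g : Sp n ℤ)
    {E : Matrix (Fin n ⊕ Fin n) (Fin n ⊕ Fin n) ℤ} (hE : E * E = E) (hEa : adj E = 1 - E)
    (hmod : (g.1 * E * adj g.1).map (Int.castRingHom (ZMod (2 ^ j)))
      = (halfProj n ℤ).map (Int.castRingHom (ZMod (2 ^ j)))) :
    ∃ γ ∈ Gam n (2 ^ (j + 1)), Iminus n ℤ * ((tauSp g)⁻¹ * γ * g).1 = (2 : ℤ) • E - 1 := by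
  set e := (2 : ℤ) • E - 1 with he
  have hae : adj e = -e := by
    rw [he, adj_sub, adj_smul, adj_one, hEa, smul_sub, two_smul ℤ (1 : Matrix _ _ ℤ)]
    abel
  have hee : e * e = 1 := by
    simp only [he, two_smul, Matrix.mul_sub, Matrix.sub_mul, Matrix.mul_add, Matrix.add_mul,
      Matrix.mul_one, Matrix.one_mul, hE]
    abel
  have hsp : Iminus n ℤ * e ∈ Matrix.symplecticGroup (Fin n) ℤ := by
    rw [mem_symplecticGroup_iff_mul_adj, adj_mul, hae, adj_Iminus]
    calc Iminus n ℤ * e * (-e * -Iminus n ℤ) = Iminus n ℤ * (e * e) * Iminus n ℤ := by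
          simp [Matrix.mul_assoc]
      _ = 1 := by rw [hee, Matrix.mul_one, Iminus_mul_self]
  set δ : Sp n ℤ := ⟨Iminus n ℤ * e, hsp⟩ with hδ
  -- The prescribed relative position I₋(2E - 1) determines γ.
  refine ⟨tauSp g * δ * g⁻¹, ?_, ?_⟩
  · obtain ⟨R, hR⟩ := map_eq_map_iff.1 hmod
    have h1 : (tauSp g * δ * g⁻¹).1 = 1 + ((2 ^ (j + 1) : ℕ) : ℤ) • (Iminus n ℤ * R) := by
      have h2 : (tauSp g * δ * g⁻¹).1
          = Iminus n ℤ * g.1 * (Iminus n ℤ * Iminus n ℤ) * e * adj g.1 := by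
        rw [← coe_inv_eq_adj]
        change Iminus n ℤ * g.1 * Iminus n ℤ * (Iminus n ℤ * e) * (g⁻¹).1 = _
        simp only [Matrix.mul_assoc]
      have h3 : g.1 * e * adj g.1 = (2 : ℤ) • (g.1 * E * adj g.1) - 1 := by
        rw [he, Matrix.mul_sub, Matrix.sub_mul, Matrix.mul_smul, Matrix.smul_mul, Matrix.mul_one,
          self_mul_adj]
      rw [h2, Iminus_mul_self, Matrix.mul_one, Matrix.mul_assoc (Iminus n ℤ), Matrix.mul_assoc,
        h3, hR, smul_add, two_smul_halfProj, smul_smul]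
      have h4 : (2 : ℤ) * ((2 ^ j : ℕ) : ℤ) = ((2 ^ (j + 1) : ℕ) : ℤ) := by push_cast; ring
      rw [h4, add_sub_right_comm, add_sub_cancel_left, Matrix.mul_add, Iminus_mul_self,
        Matrix.mul_smul]
    change (tauSp g * δ * g⁻¹).1.map _ = 1
    rw [h1, map_eq_map_iff.2 ⟨_, rfl⟩, Matrix.map_one _ (map_zero _) (map_one _)]
  · have h1 : (tauSp g)⁻¹ * (tauSp g * δ * g⁻¹) * g = δ := by group
    rw [h1]
    change Iminus n ℤ * (Iminus n ℤ * e) = e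
    rw [← Matrix.mul_assoc, Iminus_mul_self, Matrix.one_mul]

theorem Siegel.tau_tau {n : ℕ} (Z : Siegel n) : Z.tau.tau = Z := by
  apply Subtype.ext
  ext i j
  simp [Siegel.tau]

/-- On a boundary component that contains a real point, the middle block of the half of the real
structure is an idempotent compatible with the symplectic form. -/
theorem mid_block_idempotent {n q : ℕ} (hq : q ≤ n) {δ : Sp n ℤ}
    {M : Matrix (Fin n ⊕ Fin n) (Fin n ⊕ Fin n) ℤ} (hM : Iminus n ℤ * δ.1 = (2 : ℤ) • M - 1)
    {Z : Siegel q} (hZ : actSub (toRat δ) (phi hq Z) = phi hq Z.tau) :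
    M.BlockTriangular (lev n q) ∧
    (pj n q ℤ 1 * M * pj n q ℤ 1) * (pj n q ℤ 1 * M * pj n q ℤ 1) = pj n q ℤ 1 * M * pj n q ℤ 1 ∧
    adj (pj n q ℤ 1 * M * pj n q ℤ 1) = pj n q ℤ 1 - pj n q ℤ 1 * M * pj n q ℤ 1 := by
  have hδ : δ.1.BlockTriangular (lev n q) :=
    blockTriangular_toRat_iff.1 (blockTriangular_of_actSub_phi hZ)
  set σ := (2 : ℤ) • M - 1 with hσ
  have hσbt : σ.BlockTriangular (lev n q) := hM ▸ blockTriangular_Iminus_mul hδ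
  have hMbt : M.BlockTriangular (lev n q) := by
    intro a b hab
    have h1 := hσbt hab
    have hne : a ≠ b := by rintro rfl; omega
    simp only [hσ, Matrix.sub_apply, Matrix.smul_apply, Matrix.one_apply_ne hne, smul_eq_mul] at h1
    omega
  set r := pj n q ℤ 1 with hr
  have hrr : r * r = r := pj_mul_self 1
  have hadjr : adj r = r := adj_pj 1 (by omega)
  -- The square of the real structure δ twisted by τ is the ordinary square of σ = I₋δ.
  have hT : (tauSp δ * δ).1 = σ * σ := by
    rw [← hM]
    change Iminus n ℤ * δ.1 * Iminus n ℤ * δ.1 = _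
    simp only [Matrix.mul_assoc]
  have hTS : (tauSp δ * δ).1 = 1 + (4 : ℤ) • (M * M - M) := by
    simp only [hT, hσ, two_smul, four_smul, Matrix.mul_sub, Matrix.sub_mul, Matrix.mul_add,
      Matrix.add_mul, Matrix.mul_one, Matrix.one_mul]
    abel
  -- Going from Z to τZ by δ and back by τ(δ) fixes Z, so `blk_eq_one_of_fixes` applies to σ².
  have hfix : actSub (toRat (tauSp δ * δ)) (phi hq Z) = phi hq Z := by
    rw [map_mul, actSub_mul, hZ, toRat_tauSp, ← tauSub_phi, ← tauSub_actSub, hZ, tauSub_phi,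
      Siegel.tau_tau]
  have hone := (blk_eq_iff hq).1 ((blk_eq_one_of_fixes hq hTS hfix).trans (blk_one hq).symm)
  rw [← hr, hT, Matrix.mul_one, hrr, pj_mul_of_blockTriangular hσbt hσbt] at hone
  have hrσ : r * σ * r = (2 : ℤ) • (r * M * r) - r := by
    rw [hσ, Matrix.mul_sub, Matrix.sub_mul, Matrix.mul_smul, Matrix.smul_mul, Matrix.mul_one, hrr]
  set ε := r * M * r with hε
  have hrε : r * ε = ε := by rw [hε, ← Matrix.mul_assoc, ← Matrix.mul_assoc, hrr]
  have hεr : ε * r = ε := by rw [hε, Matrix.mul_assoc, hrr]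
  have hσadj : σ * adj σ = -1 := by
    rw [← hM, adj_mul, adj_Iminus]
    calc Iminus n ℤ * δ.1 * (adj δ.1 * -Iminus n ℤ)
        = -(Iminus n ℤ * (δ.1 * adj δ.1) * Iminus n ℤ) := by simp [Matrix.mul_assoc]
      _ = -1 := by rw [self_mul_adj, Matrix.mul_one, Iminus_mul_self]
  refine ⟨hMbt, ?_, ?_⟩
  · rw [← hr, hrσ] at hone
    simp only [two_smul, Matrix.mul_sub, Matrix.sub_mul, Matrix.mul_add, Matrix.add_mul,
      hrε, hεr, hrr] at hone
    refine smul_left_injective_int (m := 4) (by norm_num) ?_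
    rw [four_smul, four_smul, ← sub_eq_zero]
    refine Eq.trans ?_ (sub_eq_zero.2 hone)
    abel
  · have h1 := pj_mul_of_blockTriangular (q := q) hσbt (blockTriangular_adj hσbt) 1
    rw [hσadj, ← hr, Matrix.mul_neg, Matrix.mul_one, Matrix.neg_mul, hrr] at h1
    have h2 : r * adj σ * r = adj (r * σ * r) := by
      rw [adj_mul, adj_mul, hadjr, Matrix.mul_assoc]
    rw [h2] at h1
    have h3 : adj (r * σ * r) = r * adj (r * σ * r) := by
      rw [← h2, ← Matrix.mul_assoc, ← Matrix.mul_assoc, hrr]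
    -- On the middle block x² = r and x · adj x = -r; multiplying the second identity by x gives adj
    -- x = -x.
    have h4 : adj (r * σ * r) = -(r * σ * r) := by
      calc adj (r * σ * r) = (r * σ * r * (r * σ * r)) * adj (r * σ * r) := by rw [hone, ← h3]
        _ = (r * σ * r) * (r * σ * r * adj (r * σ * r)) := Matrix.mul_assoc _ _ _
        _ = -(r * σ * r) := by rw [← h1, Matrix.mul_neg, Matrix.mul_assoc (r * σ), hrr]
    rw [hrσ, adj_sub, adj_smul, hadjr] at h4
    refine smul_left_injective_int (m := 2) (by norm_num) ?_
    rw [smul_sub, sub_eq_iff_eq_add.1 h4, two_smul ℤ r]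
    abel

theorem blockDiagonal_idempotent {n q : ℕ} {α ε : Matrix (Fin n ⊕ Fin n) (Fin n ⊕ Fin n) ℤ}
    (hαα : α * α = α) (hpα : pj n q ℤ 0 * α * pj n q ℤ 0 = α) (hεε : ε * ε = ε)
    (hrεr : pj n q ℤ 1 * ε * pj n q ℤ 1 = ε) (hε : adj ε = pj n q ℤ 1 - ε) :
    (α + ε + (pj n q ℤ 2 - adj α)) * (α + ε + (pj n q ℤ 2 - adj α))
      = α + ε + (pj n q ℤ 2 - adj α) ∧
    adj (α + ε + (pj n q ℤ 2 - adj α)) = 1 - (α + ε + (pj n q ℤ 2 - adj α)) ∧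
    (α + ε + (pj n q ℤ 2 - adj α)).BlockTriangular (lev n q) ∧
    pj n q ℤ 1 * (α + ε + (pj n q ℤ 2 - adj α)) * pj n q ℤ 1 = ε := by
  have hp : pj n q ℤ 0 * pj n q ℤ 0 = pj n q ℤ 0 := pj_mul_self 0
  have hr : pj n q ℤ 1 * pj n q ℤ 1 = pj n q ℤ 1 := pj_mul_self 1
  have hs : pj n q ℤ 2 * pj n q ℤ 2 = pj n q ℤ 2 := pj_mul_self 2
  have hadjp : adj (pj n q ℤ 0) = pj n q ℤ 2 := adj_pj 0 (by omega)
  have hadjs : adj (pj n q ℤ 2) = pj n q ℤ 0 := adj_pj 2 (by omega)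
  have hpα1 : pj n q ℤ 0 * α = α := by
    rw [← hpα, ← Matrix.mul_assoc, ← Matrix.mul_assoc, hp]
  have hαp1 : α * pj n q ℤ 0 = α := by rw [← hpα, Matrix.mul_assoc, hp]
  have hsA : pj n q ℤ 2 * adj α = adj α := by rw [← hadjp, ← adj_mul, hαp1]
  have hAs : adj α * pj n q ℤ 2 = adj α := by rw [← hadjp, ← adj_mul, hpα1]
  have hrε : pj n q ℤ 1 * ε = ε := by rw [← hrεr, ← Matrix.mul_assoc, ← Matrix.mul_assoc, hr]
  have hεr : ε * pj n q ℤ 1 = ε := by rw [← hrεr, Matrix.mul_assoc, hr]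
  have hAA : adj α * adj α = adj α := by rw [← adj_mul, hαα]
  have hpr : pj n q ℤ 0 * pj n q ℤ 1 = 0 := pj_mul_of_ne (by omega)
  have hps : pj n q ℤ 0 * pj n q ℤ 2 = 0 := pj_mul_of_ne (by omega)
  have hrp : pj n q ℤ 1 * pj n q ℤ 0 = 0 := pj_mul_of_ne (by omega)
  have hrs : pj n q ℤ 1 * pj n q ℤ 2 = 0 := pj_mul_of_ne (by omega)
  have hsp : pj n q ℤ 2 * pj n q ℤ 0 = 0 := pj_mul_of_ne (by omega)
  have hsr : pj n q ℤ 2 * pj n q ℤ 1 = 0 := pj_mul_of_ne (by omega)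
  refine ⟨?_, ?_, ?_, ?_⟩
  · simp only [Matrix.mul_add, Matrix.add_mul, Matrix.mul_sub, Matrix.sub_mul, hαα, hεε, hs, hsA,
      hAs, hAA, mul_eq_zero_of_peirce hαp1 hrε hpr, mul_eq_zero_of_peirce hαp1 hs hps,
      mul_eq_zero_of_peirce hαp1 hsA hps, mul_eq_zero_of_peirce hεr hpα1 hrp,
      mul_eq_zero_of_peirce hεr hs hrs, mul_eq_zero_of_peirce hεr hsA hrs,
      mul_eq_zero_of_peirce hs hpα1 hsp, mul_eq_zero_of_peirce hs hrε hsr,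
      mul_eq_zero_of_peirce hAs hpα1 hsp, mul_eq_zero_of_peirce hAs hrε hsr]
    abel
  · rw [adj_add, adj_add, adj_sub, adj_adj, hε, hadjs, ← pj_sum (n := n) (q := q)]
    abel
  · have t1 : α.BlockTriangular (lev n q) := hpα ▸ blockTriangular_pj_mul_mul le_rfl α
    have t2 : ε.BlockTriangular (lev n q) := hrεr ▸ blockTriangular_pj_mul_mul le_rfl ε
    have t3 : (pj n q ℤ 2).BlockTriangular (lev n q) := blockTriangular_diagonal _
    exact (t1.add t2).add (t3.sub (blockTriangular_adj t1))
  · rw [Matrix.mul_add, Matrix.add_mul, Matrix.mul_add, Matrix.mul_sub, hrε, hrs,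
      mul_eq_zero_of_peirce hr hpα1 hrp, mul_eq_zero_of_peirce hr hsA hrs, zero_add, hεr, sub_zero,
      Matrix.zero_mul, add_zero]

/-- Every real boundary component is, after changing the real structure by an element of the
congruence subgroup, in block diagonal position with respect to some integral symplectic basis. -/
theorem exists_blockDiagonal {n k : ℕ} (hk : 2 ≤ k) {F : Set (Satake n)} {γ : Sp n ℤ}
    (h : IsRealBoundaryPair (2 ^ k) F γ) :
    ∃ (q : ℕ) (hq : q ≤ n) (g γ₁ : Sp n ℤ) (α ε : Matrix (Fin n ⊕ Fin n) (Fin n ⊕ Fin n) ℤ),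
      γ₁ ∈ Gam n (2 ^ k) ∧ F = Set.range (fun Z : Siegel q => toRat g • stdPoint hq Z) ∧
      realPoints F γ = realPoints F γ₁ ∧ α * α = α ∧ pj n q ℤ 0 * α * pj n q ℤ 0 = α ∧
      pj n q ℤ 1 * ε * pj n q ℤ 1 = ε ∧
      Iminus n ℤ * ((tauSp g)⁻¹ * γ₁ * g).1
        = (2 : ℤ) • (α + ε + (pj n q ℤ 2 - adj α)) - 1 := by
  obtain ⟨j, rfl⟩ : ∃ j, k = j + 1 := ⟨k - 1, by omega⟩
  obtain ⟨⟨q, hq, g₀, rfl⟩, hγ, x, hxF, hx⟩ := h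
  obtain ⟨g, hg⟩ := exists_integral_flag hq g₀
  rw [range_smul_stdPoint_eq hq hg] at hxF ⊢
  obtain ⟨Z, rfl⟩ := hxF
  obtain ⟨M, hM, hmod⟩ := exists_half g hγ
  have hZ := (tau_smul_stdPoint_iff hq g γ Z).1 hx
  obtain ⟨hMbt, hεε, hε⟩ := mid_block_idempotent hq hM hZ
  have hmodM : (M * M).map (Int.castRingHom (ZMod (2 ^ j)))
      = M.map (Int.castRingHom (ZMod (2 ^ j))) := by
    rw [Matrix.map_mul, hmod, ← Matrix.map_mul]
    congr 1
    calc adj g.1 * halfProj n ℤ * g.1 * (adj g.1 * halfProj n ℤ * g.1)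
        = adj g.1 * halfProj n ℤ * (g.1 * adj g.1) * (halfProj n ℤ * g.1) := by
          simp only [Matrix.mul_assoc]
      _ = adj g.1 * (halfProj n ℤ * halfProj n ℤ) * g.1 := by
          rw [self_mul_adj]; simp [Matrix.mul_assoc]
      _ = _ := by rw [halfProj_mul_self]
  have hmodadj : (adj M).map (Int.castRingHom (ZMod (2 ^ j)))
      = (1 - M).map (Int.castRingHom (ZMod (2 ^ j))) := by
    rw [← adj_map, hmod, adj_map, Matrix.map_sub _ (map_sub _), hmod, ← Matrix.map_sub _ (map_sub _)]
    congr 1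
    rw [adj_mul, adj_mul, adj_adj, adj_halfProj, Matrix.sub_mul, Matrix.mul_sub, Matrix.one_mul,
      adj_mul_self, Matrix.mul_assoc]
  obtain ⟨u, α, hu, hur, hαα, hpα, hMu⟩ := exists_levi hMbt hεε hε hmodM hmodadj
  set ε := pj n q ℤ 1 * M * pj n q ℤ 1 with hεdef
  set E := α + ε + (pj n q ℤ 2 - adj α) with hEdef
  have hr : pj n q ℤ 1 * pj n q ℤ 1 = pj n q ℤ 1 := pj_mul_self 1
  have hrεr : pj n q ℤ 1 * ε * pj n q ℤ 1 = ε := by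
    rw [hεdef, Matrix.mul_assoc, Matrix.mul_assoc, hr, ← Matrix.mul_assoc, ← Matrix.mul_assoc, hr]
  obtain ⟨hE, hEa, hEbt, hEr⟩ := blockDiagonal_idempotent hαα hpα hεε hrεr hε
  rw [← hEdef] at hE hEa hEbt hEr
  -- Modulo 2^j, E is u⁻¹Mu and M is g⁻¹Pg with P = `halfProj`, so conjugating E by gu returns P.
  -- This is what puts γ₁ in the congruence subgroup.
  have hmodE : ((g * u).1 * E * adj (g * u).1).map (Int.castRingHom (ZMod (2 ^ j)))
      = (halfProj n ℤ).map (Int.castRingHom (ZMod (2 ^ j))) := by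
    have h1 : (g * u).1 * E * adj (g * u).1 = g.1 * (u.1 * E) * adj u.1 * adj g.1 := by
      change g.1 * u.1 * E * adj (g.1 * u.1) = _
      rw [adj_mul]
      simp only [Matrix.mul_assoc]
    rw [h1, Matrix.map_mul, Matrix.map_mul, Matrix.map_mul, ← hMu, ← Matrix.map_mul,
      ← Matrix.map_mul, ← Matrix.mul_assoc, Matrix.mul_assoc _ u.1, self_mul_adj, Matrix.mul_one,
      Matrix.map_mul, hmod, ← Matrix.map_mul, ← Matrix.map_mul]
    congr 1
    calc g.1 * (adj g.1 * halfProj n ℤ * g.1) * adj g.1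
        = (g.1 * adj g.1) * halfProj n ℤ * (g.1 * adj g.1) := by simp only [Matrix.mul_assoc]
      _ = _ := by rw [self_mul_adj, Matrix.one_mul, Matrix.mul_one]
  obtain ⟨γ₁, hγ₁, hE₁⟩ := exists_mem_Gam (g * u) hE hEa hmodE
  have hufix : ∀ Z : Siegel q, toRat u • stdPoint hq Z = stdPoint hq Z := by
    intro Z
    refine Subtype.ext ((actSub_toRat_phi_iff hq hu Z Z).2 ?_)
    have h1 : blk hq u.1 = 1 := by
      rw [← blk_one hq, blk_eq_iff, hur, Matrix.mul_one, hr]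
    have h2 : (1 : Matrix (Fin q ⊕ Fin q) (Fin q ⊕ Fin q) ℂ) = fromBlocks 1 0 0 1 :=
      fromBlocks_one.symm
    rw [h1, Rel, Matrix.map_one _ (map_zero _) (map_one _), h2]
    simp only [toBlocks_fromBlocks₁₁, toBlocks_fromBlocks₁₂, toBlocks_fromBlocks₂₁,
      toBlocks_fromBlocks₂₂, Matrix.one_mul, Matrix.zero_mul, add_zero, zero_add, Matrix.mul_one]
  have hgu : ∀ Z : Siegel q, toRat (g * u) • stdPoint hq Z = toRat g • stdPoint hq Z := by
    intro Z
    rw [map_mul, mul_smul, hufix]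
  have hδ : ((tauSp g)⁻¹ * γ * g).1 = Iminus n ℤ * ((2 : ℤ) • M - 1) := by
    rw [← hM, ← Matrix.mul_assoc, Iminus_mul_self, Matrix.one_mul]
  have hδ₁ : ((tauSp (g * u))⁻¹ * γ₁ * (g * u)).1 = Iminus n ℤ * ((2 : ℤ) • E - 1) := by
    rw [← hE₁, ← Matrix.mul_assoc, Iminus_mul_self, Matrix.one_mul]
  -- E and M share their middle block, and reality on F_q depends on nothing else.
  have hblk : blk hq ((tauSp g)⁻¹ * γ * g).1 = blk hq ((tauSp (g * u))⁻¹ * γ₁ * (g * u)).1 := by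
    have h1 : ∀ X : Matrix (Fin n ⊕ Fin n) (Fin n ⊕ Fin n) ℤ,
        pj n q ℤ 1 * (Iminus n ℤ * ((2 : ℤ) • X - 1)) * pj n q ℤ 1
          = Iminus n ℤ * ((2 : ℤ) • (pj n q ℤ 1 * X * pj n q ℤ 1) - pj n q ℤ 1) := fun X => by
      rw [← Matrix.mul_assoc, pj_mul_Iminus, Matrix.mul_assoc, Matrix.mul_assoc,
        ← Matrix.mul_assoc (pj n q ℤ 1), Matrix.mul_sub, Matrix.sub_mul, Matrix.mul_smul,
        Matrix.smul_mul, Matrix.mul_one, hr]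
    rw [hδ, hδ₁, blk_eq_iff, h1, h1, hEr]
  have hbt₁ : ((tauSp (g * u))⁻¹ * γ₁ * (g * u)).1.BlockTriangular (lev n q) := by
    rw [hδ₁, two_smul]
    exact blockTriangular_Iminus_mul ((hEbt.add hEbt).sub blockTriangular_one)
  have hbt : ((tauSp g)⁻¹ * γ * g).1.BlockTriangular (lev n q) :=
    blockTriangular_toRat_iff.1 (blockTriangular_of_actSub_phi hZ)
  refine ⟨q, hq, g * u, γ₁, α, ε, hγ₁, ?_, ?_, hαα, hpα, ?_, hE₁⟩
  · simp only [hgu]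
  · ext y
    refine and_congr_right ?_
    rintro ⟨Z', rfl⟩
    change (toRat g • stdPoint hq Z').tau = γ • toRat g • stdPoint hq Z' ↔
      (toRat g • stdPoint hq Z').tau = γ₁ • toRat g • stdPoint hq Z'
    rw [tau_smul_stdPoint_iff, ← hgu, tau_smul_stdPoint_iff, actSub_toRat_phi_iff hq hbt,
      actSub_toRat_phi_iff hq hbt₁, hblk]
  · exact hrεr

/-! ### Approximating a boundary point by real points of the Siegel space -/

/-- The inclusion of the first `q` coordinates. -/
def incM {n q : ℕ} (hq : q ≤ n) (R : Type*) [CommRing R] : Matrix (Fin n) (Fin q) R :=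
  (1 : Matrix (Fin n) (Fin n) R).submatrix id (Fin.castLE hq)

/-- The projector to the last `n - q` coordinates. -/
def tailProj (n q : ℕ) (R : Type*) [CommRing R] : Matrix (Fin n) (Fin n) R :=
  diagonal fun i => if (i : ℕ) < q then 0 else 1

section incM

variable {n q : ℕ} (hq : q ≤ n) {R : Type*} [CommRing R]

theorem incM_mul_apply {ι : Type*} (X : Matrix (Fin q) ι R) (i : Fin n) (j : ι) :
    (incM hq R * X) i j = if h : (i : ℕ) < q then X ⟨i, h⟩ j else 0 := by
  simp only [incM, Matrix.mul_apply, submatrix_apply, id_eq, Matrix.one_apply, ite_mul, one_mul,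
    zero_mul]
  split_ifs with h
  · rw [Finset.sum_eq_single ⟨i, h⟩]
    · rw [if_pos]; exact Fin.ext rfl
    · intro k _ hk
      rw [if_neg]
      rintro rfl
      exact hk (Fin.ext rfl)
    · simp
  · refine Finset.sum_eq_zero fun k _ => ?_
    rw [if_neg]
    rintro rfl
    exact h k.2

theorem incM_mulVec_apply (c : Fin q → R) (i : Fin n) :
    (incM hq R *ᵥ c) i = if h : (i : ℕ) < q then c ⟨i, h⟩ else 0 := by
  exact incM_mul_apply hq (replicateCol Unit c) i ()

theorem transpose_incM_mulVec (v : Fin n → R) :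
    (incM hq R)ᵀ *ᵥ v = fun i => v (Fin.castLE hq i) := by
  rw [incM, transpose_submatrix, transpose_one]
  ext i
  simp [mulVec, dotProduct, submatrix_apply, Matrix.one_apply]

theorem transpose_incM_mul_mul (X : Matrix (Fin n) (Fin n) R) :
    (incM hq R)ᵀ * X * incM hq R = X.submatrix (Fin.castLE hq) (Fin.castLE hq) := by
  ext i j
  simp [incM, Matrix.mul_apply, Matrix.one_apply]

theorem transpose_incM_mul_self : (incM hq R)ᵀ * incM hq R = 1 := by
  have h := transpose_incM_mul_mul hq (1 : Matrix (Fin n) (Fin n) R)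
  rwa [Matrix.mul_one, submatrix_one _ (Fin.castLE_injective hq)] at h

theorem incM_mul_mul_apply (X : Matrix (Fin q) (Fin q) R) (i j : Fin n) :
    (incM hq R * X * (incM hq R)ᵀ) i j
      = if h : (i : ℕ) < q ∧ (j : ℕ) < q then X ⟨i, h.1⟩ ⟨j, h.2⟩ else 0 := by
  have h1 : (incM hq R * X * (incM hq R)ᵀ) i j = (incM hq R * (incM hq R * X)ᵀ) j i := by
    change _ = (incM hq R * (incM hq R * X)ᵀ)ᵀ i j
    rw [Matrix.transpose_mul, transpose_transpose]
  rw [h1, incM_mul_apply]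
  split_ifs with hj h h
  · rw [transpose_apply, incM_mul_apply, dif_pos h.1]
  · rw [transpose_apply, incM_mul_apply, dif_neg fun hi => h ⟨hi, hj⟩]
  · exact absurd h.2 hj
  · rfl

theorem incM_mul_transpose : incM hq R * (incM hq R)ᵀ = 1 - tailProj n q R := by
  ext i j
  have h := incM_mul_mul_apply hq (1 : Matrix (Fin q) (Fin q) R) i j
  rw [Matrix.mul_one] at h
  rw [h, tailProj, Matrix.sub_apply, diagonal_apply, Matrix.one_apply]
  by_cases hij : i = j
  · subst hij
    by_cases hi : (i : ℕ) < q <;> simp [hi]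
  · have : ∀ h : (i : ℕ) < q ∧ (j : ℕ) < q, (⟨i, h.1⟩ : Fin q) ≠ ⟨j, h.2⟩ := fun _ h' =>
      hij (Fin.ext (Fin.mk.inj h'))
    by_cases h : (i : ℕ) < q ∧ (j : ℕ) < q
    · rw [dif_pos h, Matrix.one_apply_ne (this h)]; simp [hij]
    · rw [dif_neg h]; simp [hij]

theorem incM_map {S : Type*} [CommRing S] (f : R →+* S) : (incM hq R).map f = incM hq S := by
  change ((1 : Matrix (Fin n) (Fin n) R).map f).submatrix id (Fin.castLE hq) = _
  rw [Matrix.map_one _ (map_zero f) (map_one f), incM]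

theorem tailProj_map {S : Type*} [CommRing S] (f : R →+* S) :
    (tailProj n q R).map f = tailProj n q S := by
  rw [tailProj, tailProj, diagonal_map (map_zero f)]
  congr 1
  ext i
  split_ifs <;> simp

theorem tailProj_mul_self : tailProj n q R * tailProj n q R = tailProj n q R := by
  rw [tailProj, diagonal_mul_diagonal]
  congr 1
  ext i
  split_ifs <;> simp

theorem tailProj_transpose : (tailProj n q R)ᵀ = tailProj n q R := diagonal_transpose _

theorem tailProj_mul_incM : tailProj n q R * incM hq R = 0 := by
  have h1 : tailProj n q R = 1 - incM hq R * (incM hq R)ᵀ := by rw [incM_mul_transpose]; abel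
  rw [h1, Matrix.sub_mul, Matrix.one_mul, Matrix.mul_assoc, transpose_incM_mul_self, Matrix.mul_one,
    sub_self]

theorem transpose_incM_mul_tailProj : (incM hq R)ᵀ * tailProj n q R = 0 := by
  rw [← tailProj_transpose, ← transpose_mul, tailProj_mul_incM, transpose_zero]

end incM

/-- The form `1 + A ᵗA` on the last coordinates, which is invariant under the involution `A`. -/
def invForm (n q : ℕ) {R : Type*} [CommRing R] (A : Matrix (Fin n) (Fin n) R) :
    Matrix (Fin n) (Fin n) R :=
  tailProj n q R + A * Aᵀ

theorem invForm_transpose {n q : ℕ} {R : Type*} [CommRing R] (A : Matrix (Fin n) (Fin n) R) :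
    (invForm n q A)ᵀ = invForm n q A := by
  rw [invForm, transpose_add, transpose_mul, transpose_transpose, tailProj_transpose]

theorem invForm_map {n q : ℕ} {R S : Type*} [CommRing R] [CommRing S] (f : R →+* S)
    (A : Matrix (Fin n) (Fin n) R) : (invForm n q A).map f = invForm n q (A.map f) := by
  rw [invForm, invForm, Matrix.map_add _ (map_add f), Matrix.map_mul, tailProj_map, transpose_map]

theorem quad_self_mul_transpose {m : ℕ} (A : Matrix (Fin m) (Fin m) ℝ) (x : Fin m → ℝ) :
    x ⬝ᵥ ((A * Aᵀ) *ᵥ x) = (Aᵀ *ᵥ x) ⬝ᵥ (Aᵀ *ᵥ x) := by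
  rw [← mulVec_mulVec, dotProduct_mulVec, ← mulVec_transpose]

/-- A vector either has a nonzero head, where Y is positive, or is entirely tail, where `tailProj`
acts as the identity. All other terms are nonnegative. -/
theorem invForm_posDef {n q : ℕ} (hq : q ≤ n) (A : Matrix (Fin n) (Fin n) ℝ)
    {Y : Matrix (Fin q) (Fin q) ℝ} (hY : Y.PosDef) {t : ℝ} (ht : 0 < t) :
    (incM hq ℝ * Y * (incM hq ℝ)ᵀ + t • invForm n q A).PosDef := by
  refine PosDef.of_dotProduct_mulVec_pos ?_ fun x hx => ?_
  · have hYt : Yᵀ = Y := by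
      have h := hY.1
      rwa [IsHermitian, conjTranspose_eq_transpose_of_trivial] at h
    rw [IsHermitian, conjTranspose_eq_transpose_of_trivial, transpose_add, transpose_smul,
      invForm_transpose, transpose_mul, transpose_mul, transpose_transpose, hYt, Matrix.mul_assoc]
  · have h1 : x ⬝ᵥ ((incM hq ℝ * Y * (incM hq ℝ)ᵀ) *ᵥ x)
        = ((incM hq ℝ)ᵀ *ᵥ x) ⬝ᵥ (Y *ᵥ ((incM hq ℝ)ᵀ *ᵥ x)) := by
      rw [← mulVec_mulVec, ← mulVec_mulVec, dotProduct_mulVec, ← mulVec_transpose]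
    have h2 : x ⬝ᵥ (tailProj n q ℝ *ᵥ x) = (tailProj n q ℝ *ᵥ x) ⬝ᵥ (tailProj n q ℝ *ᵥ x) := by
      have := quad_self_mul_transpose (tailProj n q ℝ) x
      rwa [tailProj_transpose, tailProj_mul_self] at this
    have hnn : ∀ y : Fin n → ℝ, 0 ≤ y ⬝ᵥ y := fun y =>
      Finset.sum_nonneg fun i _ => mul_self_nonneg _
    rw [star_trivial, add_mulVec, dotProduct_add, smul_mulVec, dotProduct_smul, invForm, add_mulVec,
      dotProduct_add, h1, h2, quad_self_mul_transpose, smul_eq_mul]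
    by_cases hc : (incM hq ℝ)ᵀ *ᵥ x = 0
    · have h3 : tailProj n q ℝ *ᵥ x = x := by
        have h4 : tailProj n q ℝ = 1 - incM hq ℝ * (incM hq ℝ)ᵀ := by
          rw [incM_mul_transpose]; abel
        rw [h4, sub_mulVec, ← mulVec_mulVec, hc, mulVec_zero, one_mulVec, sub_zero]
      have h5 : 0 < x ⬝ᵥ x := lt_of_le_of_ne (hnn x) fun h => hx (dotProduct_self_eq_zero.1 h.symm)
      rw [hc, h3, zero_dotProduct, zero_add]
      exact mul_pos ht (add_pos_of_pos_of_nonneg h5 (hnn _))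
    · have h5 := hY.dotProduct_mulVec_pos hc
      rw [star_trivial] at h5
      exact add_pos_of_pos_of_nonneg h5 (mul_nonneg ht.le (add_nonneg (hnn _) (hnn _)))

theorem map_im_incM {n q : ℕ} (hq : q ≤ n) (X : Matrix (Fin q) (Fin q) ℂ) (t : ℝ)
    (A : Matrix (Fin n) (Fin n) ℤ) :
    (incM hq ℂ * X * (incM hq ℂ)ᵀ + ((t : ℂ) * Complex.I) •
      (invForm n q A).map (Int.castRingHom ℂ)).map Complex.im
      = incM hq ℝ * X.map Complex.im * (incM hq ℝ)ᵀ + t • invForm n q (A.map (Int.castRingHom ℝ)) := by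
  rw [← invForm_map]
  ext i j
  simp only [Matrix.map_apply, Matrix.add_apply, Matrix.smul_apply, incM_mul_mul_apply,
    Complex.add_im]
  congr 1
  · split_ifs <;> simp
  · simp

/-- The points `diag(Z, i t Y)` that tend to `φ(Z)` as `t → ∞`. -/
noncomputable def conePoint {n q : ℕ} (hq : q ≤ n) (Z : Siegel q) (A : Matrix (Fin n) (Fin n) ℤ)
    {t : ℝ} (ht : 0 < t) : Siegel n :=
  ⟨incM hq ℂ * Z.1 * (incM hq ℂ)ᵀ + ((t : ℂ) * Complex.I) •
      (invForm n q A).map (Int.castRingHom ℂ), by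
    constructor
    · have hZ : Z.1ᵀ = Z.1 := Z.2.1
      rw [IsSymm, transpose_add, transpose_smul, ← transpose_map, invForm_transpose, transpose_mul,
        transpose_mul, transpose_transpose, hZ, Matrix.mul_assoc]
    · rw [map_im_incM]
      exact invForm_posDef hq _ Z.2.2 ht⟩

theorem conePoint_tau {n q : ℕ} (hq : q ≤ n) (Z : Siegel q) (A : Matrix (Fin n) (Fin n) ℤ)
    {t : ℝ} (ht : 0 < t) : (conePoint hq Z A ht).tau = conePoint hq Z.tau A ht := by
  apply Subtype.ext
  ext i j
  simp only [Siegel.tau, conePoint, Matrix.neg_apply, Matrix.map_apply, Matrix.add_apply,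
    Matrix.smul_apply, incM_mul_mul_apply, map_add, neg_add]
  congr 1
  · split_ifs <;> simp
  · simp

/-- The conditions on an involution of the last coordinates. -/
structure IsTailInvolution {n q : ℕ} (hq : q ≤ n) (A : Matrix (Fin n) (Fin n) ℤ) : Prop where
  mul_self : A * A = tailProj n q ℤ
  transpose_mul : (incM hq ℤ)ᵀ * A = 0
  mul_inc : A * incM hq ℤ = 0

section cone

variable {n q : ℕ} {hq : q ≤ n} {A : Matrix (Fin n) (Fin n) ℤ}

/-- Both sides equal A + Aᵀ, because A and Aᵀ are involutions on the tail. Equivalently, the sum of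
the standard form and its transform by A is invariant under A. -/
theorem IsTailInvolution.mul_invForm (hA : IsTailInvolution hq A) :
    A * invForm n q A = invForm n q A * Aᵀ := by
  have h1 : ∀ B : Matrix (Fin n) (Fin n) ℤ, B * incM hq ℤ = 0 → B * tailProj n q ℤ = B := by
    intro B hB
    have h4 : tailProj n q ℤ = 1 - incM hq ℤ * (incM hq ℤ)ᵀ := by rw [incM_mul_transpose]; abel
    rw [h4, Matrix.mul_sub, ← Matrix.mul_assoc, hB, Matrix.zero_mul, Matrix.mul_one, sub_zero]
  have h2 : A * tailProj n q ℤ = A := h1 A hA.mul_inc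
  have h3 : tailProj n q ℤ * Aᵀ = Aᵀ := by
    rw [← tailProj_transpose, ← Matrix.transpose_mul, h2]
  have h4 : Aᵀ * Aᵀ = tailProj n q ℤ := by
    rw [← Matrix.transpose_mul, hA.mul_self, tailProj_transpose]
  rw [invForm, Matrix.mul_add, Matrix.add_mul, ← Matrix.mul_assoc, hA.mul_self, h2, h3,
    Matrix.mul_assoc, h4, h2, add_comm]

theorem IsTailInvolution.invForm_mul_incM (hA : IsTailInvolution hq A) :
    invForm n q A * incM hq ℤ = 0 := by
  have h : Aᵀ * incM hq ℤ = 0 := by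
    rw [← transpose_transpose (incM hq ℤ), ← Matrix.transpose_mul, hA.transpose_mul, transpose_zero]
  rw [invForm, Matrix.add_mul, tailProj_mul_incM, Matrix.mul_assoc, h, Matrix.mul_zero, add_zero]

theorem IsTailInvolution.transpose_incM_mul_invForm (hA : IsTailInvolution hq A) :
    (incM hq ℤ)ᵀ * invForm n q A = 0 := by
  rw [← invForm_transpose, ← Matrix.transpose_mul, hA.invForm_mul_incM, transpose_zero]

theorem map_zero_matrix {ι κ : Type*} {X : Matrix ι κ ℤ} (h : X = 0) (R : Type*) [CommRing R] :
    X.map (Int.castRingHom R) = 0 := by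
  rw [h]; exact Matrix.map_zero _ (map_zero _)

/-- A block diagonal real structure maps the points `diag(Z, i t Y)` to their conjugates as soon as
it does so for `φ(Z)`. -/
theorem actSub_conePoint (hA : IsTailInvolution hq A) {δ : Sp n ℤ}
    (hδ : δ.1 = fromBlocks
      (incM hq ℤ * (blk hq δ.1).toBlocks₁₁ * (incM hq ℤ)ᵀ - A)
      (incM hq ℤ * (blk hq δ.1).toBlocks₁₂ * (incM hq ℤ)ᵀ)
      (incM hq ℤ * (blk hq δ.1).toBlocks₂₁ * (incM hq ℤ)ᵀ)
      (incM hq ℤ * (blk hq δ.1).toBlocks₂₂ * (incM hq ℤ)ᵀ - Aᵀ))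
    {Z : Siegel q} (hZ : actSub (toRat δ) (phi hq Z) = phi hq Z.tau) {t : ℝ} (ht : 0 < t) :
    actSub (toRat δ) (phi le_rfl (conePoint hq Z A ht))
      = phi le_rfl (conePoint hq Z A ht).tau := by
  have hbt : δ.1.BlockTriangular (lev n q) :=
    blockTriangular_toRat_iff.1 (blockTriangular_of_actSub_phi hZ)
  have hbtn : δ.1.BlockTriangular (lev n n) := by
    intro a b hab
    have h1 : ∀ c, lev n n c = 1 := by rintro (i | i) <;> simp [lev]
    rw [h1, h1] at hab
    omega
  rw [actSub_toRat_phi_iff hq hbt] at hZ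
  rw [actSub_toRat_phi_iff le_rfl hbtn, conePoint_tau]
  have hid : blk le_rfl δ.1 = δ.1 := by
    ext (i | i) (j | j) <;> rfl
  rw [hid]
  set b₁₁ := (blk hq δ.1).toBlocks₁₁
  set b₁₂ := (blk hq δ.1).toBlocks₁₂
  set b₂₁ := (blk hq δ.1).toBlocks₂₁
  set b₂₂ := (blk hq δ.1).toBlocks₂₂
  have hc : ∀ X : Matrix (Fin q) (Fin q) ℤ,
      (incM hq ℤ * X * (incM hq ℤ)ᵀ).map (Int.castRingHom ℂ)
        = incM hq ℂ * X.map (Int.castRingHom ℂ) * (incM hq ℂ)ᵀ := fun X => by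
    rw [Matrix.map_mul, Matrix.map_mul, transpose_map, incM_map]
  have hδC : δ.1.map (Int.castRingHom ℂ) = fromBlocks
      (incM hq ℂ * b₁₁.map (Int.castRingHom ℂ) * (incM hq ℂ)ᵀ - A.map (Int.castRingHom ℂ))
      (incM hq ℂ * b₁₂.map (Int.castRingHom ℂ) * (incM hq ℂ)ᵀ)
      (incM hq ℂ * b₂₁.map (Int.castRingHom ℂ) * (incM hq ℂ)ᵀ)
      (incM hq ℂ * b₂₂.map (Int.castRingHom ℂ) * (incM hq ℂ)ᵀ - Aᵀ.map (Int.castRingHom ℂ)) := by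
    rw [hδ, fromBlocks_map, Matrix.map_sub _ (map_sub _), Matrix.map_sub _ (map_sub _), hc, hc, hc,
      hc]
  rw [hδC]
  have hZ' : b₁₁.map (Int.castRingHom ℂ) * Z.1 + b₁₂.map (Int.castRingHom ℂ)
      = Z.tau.1 * (b₂₁.map (Int.castRingHom ℂ) * Z.1 + b₂₂.map (Int.castRingHom ℂ)) := hZ
  have e0 : (incM hq ℂ)ᵀ * incM hq ℂ = 1 := transpose_incM_mul_self hq
  have e1 : (incM hq ℂ)ᵀ * (invForm n q A).map (Int.castRingHom ℂ) = 0 := by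
    rw [← map_zero_matrix hA.transpose_incM_mul_invForm ℂ, Matrix.map_mul, transpose_map, incM_map]
  have e2 : (invForm n q A).map (Int.castRingHom ℂ) * incM hq ℂ = 0 := by
    rw [← map_zero_matrix hA.invForm_mul_incM ℂ, Matrix.map_mul, incM_map]
  have e3 : A.map (Int.castRingHom ℂ) * incM hq ℂ = 0 := by
    rw [← map_zero_matrix hA.mul_inc ℂ, Matrix.map_mul, incM_map]
  have e4 : (incM hq ℂ)ᵀ * Aᵀ.map (Int.castRingHom ℂ) = 0 := by
    rw [transpose_map, ← transpose_mul, e3, transpose_zero]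
  have e5 : A.map (Int.castRingHom ℂ) * (invForm n q A).map (Int.castRingHom ℂ)
      = (invForm n q A).map (Int.castRingHom ℂ) * Aᵀ.map (Int.castRingHom ℂ) := by
    rw [← Matrix.map_mul, hA.mul_invForm, Matrix.map_mul]
  rw [Rel, toBlocks_fromBlocks₁₁, toBlocks_fromBlocks₁₂, toBlocks_fromBlocks₂₁,
    toBlocks_fromBlocks₂₂]
  change _ * (incM hq ℂ * Z.1 * (incM hq ℂ)ᵀ + ((t : ℂ) * Complex.I) •
      (invForm n q A).map (Int.castRingHom ℂ)) + _
    = (incM hq ℂ * Z.tau.1 * (incM hq ℂ)ᵀ + ((t : ℂ) * Complex.I) •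
      (invForm n q A).map (Int.castRingHom ℂ)) * (_ * (incM hq ℂ * Z.1 * (incM hq ℂ)ᵀ
      + ((t : ℂ) * Complex.I) • (invForm n q A).map (Int.castRingHom ℂ)) + _)
  set C := incM hq ℂ
  set Y := (invForm n q A).map (Int.castRingHom ℂ)
  set c := (t : ℂ) * Complex.I
  have e0' : ∀ {m : ℕ} (X : Matrix (Fin q) (Fin m) ℂ), Cᵀ * (C * X) = X := fun X => by
    rw [← Matrix.mul_assoc, e0, Matrix.one_mul]
  have e2' : ∀ {m : ℕ} (X : Matrix (Fin q) (Fin m) ℂ), Y * (C * X) = 0 := fun X => by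
    rw [← Matrix.mul_assoc, e2, Matrix.zero_mul]
  have e3' : ∀ {m : ℕ} (X : Matrix (Fin q) (Fin m) ℂ),
      A.map (Int.castRingHom ℂ) * (C * X) = 0 := fun X => by
    rw [← Matrix.mul_assoc, e3, Matrix.zero_mul]
  have hZ'' : C * (b₁₁.map (Int.castRingHom ℂ) * Z.1 + b₁₂.map (Int.castRingHom ℂ)) * Cᵀ
      = C * (Z.tau.1 * (b₂₁.map (Int.castRingHom ℂ) * Z.1 + b₂₂.map (Int.castRingHom ℂ))) * Cᵀ := by
    rw [hZ']
  simp only [Matrix.mul_add, Matrix.add_mul, Matrix.mul_sub, Matrix.sub_mul, Matrix.mul_assoc,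
    Matrix.mul_smul, Matrix.smul_mul, e0', e1, e2', e3', e4, e5, Matrix.mul_zero, smul_zero] at hZ'' ⊢
  rw [add_zero, zero_sub, add_zero, sub_zero, add_right_comm, hZ'', smul_neg]
  abel

end cone

/-! ### Convergence of the cone points in the Satake topology. -/

theorem mem_phi_le_rfl {n : ℕ} {Z : Siegel n} {u : V n} :
    u ∈ phi le_rfl Z ↔ (fun i => u (Sum.inl i)) = Z.1 *ᵥ (fun j => u (Sum.inr j)) := by
  rw [mem_phi]
  refine and_iff_left ?_
  intro i hi
  exact absurd i.2 (by omega)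

section cone

variable {n q : ℕ} {hq : q ≤ n} {A : Matrix (Fin n) (Fin n) ℤ}

theorem conePoint_mul_incM (hA : IsTailInvolution hq A) (Z : Siegel q) {t : ℝ} (ht : 0 < t) :
    (conePoint hq Z A ht).1 * incM hq ℂ = incM hq ℂ * Z.1 := by
  have e2 : (invForm n q A).map (Int.castRingHom ℂ) * incM hq ℂ = 0 := by
    rw [← map_zero_matrix hA.invForm_mul_incM ℂ, Matrix.map_mul, incM_map]
  change (incM hq ℂ * Z.1 * (incM hq ℂ)ᵀ + ((t : ℂ) * Complex.I) •
      (invForm n q A).map (Int.castRingHom ℂ)) * incM hq ℂ = _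
  rw [Matrix.add_mul, Matrix.mul_assoc, transpose_incM_mul_self, Matrix.mul_one, Matrix.smul_mul, e2,
    smul_zero, add_zero]

/-- The cone point has no block mixing head and tail, so on head vectors its matrix acts as Z,
whatever t is. -/
theorem reduce_conePoint (hA : IsTailInvolution hq A) (Z : Siegel q) {t : ℝ} (ht : 0 < t) :
    reduce q (phi le_rfl (conePoint hq Z A ht)) = phi hq Z := by
  have hC : ∀ c : Fin q → ℂ, (conePoint hq Z A ht).1 *ᵥ (incM hq ℂ *ᵥ c)
      = incM hq ℂ *ᵥ (Z.1 *ᵥ c) := fun c => by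
    rw [mulVec_mulVec, conePoint_mul_incM hA, ← mulVec_mulVec]
  ext u
  rw [mem_reduce]
  constructor
  · rintro ⟨m, hm, hm', w, hw, rfl⟩
    refine Submodule.add_mem _ ?_ (stdIsotropic_le_phi hq Z hw)
    rw [mem_phi_le_rfl] at hm
    have h1 : (fun j => m (Sum.inr j)) = incM hq ℂ *ᵥ fun j => m (Sum.inr (Fin.castLE hq j)) := by
      ext i
      rw [incM_mulVec_apply]
      split_ifs with hi
      · rfl
      · exact hm' i (by omega)
    rw [h1, hC] at hm
    refine mem_phi.2 ⟨?_, hm'⟩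
    ext i
    rw [congrFun hm (Fin.castLE hq i), incM_mulVec_apply, dif_pos (by simp)]
    rfl
  · intro hu
    obtain ⟨hu1, hu2⟩ := mem_phi.1 hu
    set c : Fin q → ℂ := fun j => u (Sum.inr (Fin.castLE hq j)) with hc
    set m : V n := Sum.elim (incM hq ℂ *ᵥ (Z.1 *ᵥ c)) (incM hq ℂ *ᵥ c) with hm
    have hm' : m ∈ stdIsotropicPerp n q := by
      intro i hi
      simp only [hm, Sum.elim_inr]
      rw [incM_mulVec_apply, dif_neg (by omega)]
    refine ⟨m, mem_phi_le_rfl.2 (hC c).symm, hm', u - m, ⟨fun i hi => ?_, fun i => ?_⟩,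
      add_sub_cancel _ _⟩
    · simp only [hm, Pi.sub_apply, Sum.elim_inl]
      rw [incM_mulVec_apply, dif_pos hi, ← congrFun hu1 ⟨i, hi⟩]
      exact sub_self _
    · simp only [hm, Pi.sub_apply, Sum.elim_inr]
      rw [incM_mulVec_apply]
      split_ifs with hi
      · exact sub_self _
      · rw [sub_zero]; exact hu2 i (by omega)

theorem tailProj_mulVec_of_mem {u : V n} (hu : u ∈ stdIsotropic n q) :
    tailProj n q ℂ *ᵥ (fun i => u (Sum.inl i)) = fun i => u (Sum.inl i) := by
  ext i
  rw [tailProj, mulVec_diagonal]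
  split_ifs with h
  · rw [hu.1 i h, zero_mul]
  · rw [one_mul]

/-- The columns of the invariant form span the isotropic subspace. -/
theorem stdIsotropic_le_span (hA : IsTailInvolution hq A) :
    stdIsotropic n q ≤ Submodule.span ℂ (Set.range fun k : Fin n =>
      (Sum.elim (fun i => ((invForm n q A i k : ℤ) : ℂ)) 0 : V n)) := by
  set N : Matrix (Fin n) (Fin n) ℤ := 1 + A * Aᵀ with hN
  have hdet : IsUnit (N.map (Int.castRingHom ℂ)).det := by
    -- Invertibility over ℂ is read from the integral determinant, which is nonzero because N is
    -- positive definite over ℝ.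
    have h1 : (N.map (Int.castRingHom ℝ)).PosDef := by
      have h2 : N.map (Int.castRingHom ℝ) = 1 + A.map (Int.castRingHom ℝ)
          * (A.map (Int.castRingHom ℝ))ᴴ := by
        rw [hN, Matrix.map_add _ (map_add _), Matrix.map_mul, transpose_map,
          Matrix.map_one _ (map_zero _) (map_one _), conjTranspose_eq_transpose_of_trivial]
      rw [h2]
      exact PosDef.one.add_posSemidef (posSemidef_self_mul_conjTranspose _)
    have h3 := h1.det_pos.ne'
    rw [← RingHom.mapMatrix_apply, ← RingHom.map_det] at h3
    rw [isUnit_iff_ne_zero, ← RingHom.mapMatrix_apply, ← RingHom.map_det]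
    intro h4
    rw [eq_intCast, Int.cast_eq_zero] at h4
    exact h3 (by rw [h4, map_zero])
  have hwN : tailProj n q ℤ * N = invForm n q A := by
    have h4 : tailProj n q ℤ = 1 - incM hq ℤ * (incM hq ℤ)ᵀ := by rw [incM_mul_transpose]; abel
    have h5 : tailProj n q ℤ * A = A := by
      rw [h4, Matrix.sub_mul, Matrix.mul_assoc, hA.transpose_mul, Matrix.mul_zero, Matrix.one_mul,
        sub_zero]
    rw [hN, Matrix.mul_add, Matrix.mul_one, ← Matrix.mul_assoc, h5, invForm]
  intro u hu
  set x : Fin n → ℂ := fun i => u (Sum.inl i) with hx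
  set y : Fin n → ℂ := (N.map (Int.castRingHom ℂ))⁻¹ *ᵥ x with hy
  have hxy : x = (invForm n q A).map (Int.castRingHom ℂ) *ᵥ y := by
    rw [← hwN, Matrix.map_mul, tailProj_map, ← mulVec_mulVec, hy, mulVec_mulVec _ _ _⁻¹,
      Matrix.mul_nonsing_inv _ hdet, one_mulVec, tailProj_mulVec_of_mem hu]
  have hsum : u = ∑ k, y k • (Sum.elim (fun i => ((invForm n q A i k : ℤ) : ℂ)) 0 : V n) := by
    ext (i | i)
    · rw [show u (Sum.inl i) = x i from rfl, hxy]
      simp [mulVec, dotProduct, Finset.sum_apply, mul_comm]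
    · rw [hu.2 i]
      simp [Finset.sum_apply]
  rw [hsum]
  exact Submodule.sum_mem _ fun k _ => Submodule.smul_mem _ _ (Submodule.subset_span ⟨k, rfl⟩)

theorem invForm_col_mem (hA : IsTailInvolution hq A) (k : Fin n) :
    (Sum.elim (fun i => ((invForm n q A i k : ℤ) : ℂ)) 0 : V n) ∈ stdIsotropic n q := by
  refine ⟨fun i hi => ?_, fun i => rfl⟩
  have h := congrFun (congrFun hA.transpose_incM_mul_invForm ⟨i, hi⟩) k
  have h1 := congrFun (transpose_incM_mulVec hq (fun i => invForm n q A i k)) ⟨i, hi⟩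
  have h2 : invForm n q A i k = 0 := h1.symm.trans h
  simp [h2]

/-- The columns of the integral matrix `invForm` span W_q, and their size for the quadratic form of
the cone point is proportional to 1/t. For large t they are the short vectors required by
`basicNhd`. -/
theorem exists_conePoint_mem (hA : IsTailInvolution hq A) {Z : Siegel q} {U : Set (Siegel q)}
    (hU : Z ∈ U) {ε : ℝ} (hε : 0 < ε) :
    ∃ (t : ℝ) (ht : 0 < t), incl (conePoint hq Z A ht) ∈ basicNhd hq U ε := by
  set K : ℝ := ∑ k, |((invForm n q A k k : ℤ) : ℝ)| with hK
  have hK0 : 0 ≤ K := Finset.sum_nonneg fun k _ => abs_nonneg _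
  have ht : 0 < (1 + K) / ε := by positivity
  refine ⟨(1 + K) / ε, ht, ⟨Z, hU, reduce_conePoint hA Z ht⟩, ?_⟩
  refine le_antisymm (Submodule.span_le.2 fun v hv => hv.1)
    ((stdIsotropic_le_span hA).trans (Submodule.span_le.2 ?_))
  rintro _ ⟨k, rfl⟩
  by_cases hk : (k : ℕ) < q
  · have h0 : (Sum.elim (fun i => ((invForm n q A i k : ℤ) : ℂ)) 0 : V n) = 0 := by
      ext (i | i)
      · have h := congrFun (congrFun hA.transpose_incM_mul_invForm ⟨k, hk⟩) i
        have h1 := congrFun (transpose_incM_mulVec hq (fun j => invForm n q A j i)) ⟨k, hk⟩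
        have h2 : invForm n q A k i = 0 := h1.symm.trans h
        have h3 : invForm n q A i k = invForm n q A k i :=
          congrFun (congrFun (invForm_transpose (q := q) A) k) i
        simp [h3, h2]
      · rfl
    simp only [h0]
    exact Submodule.zero_mem _
  · refine Submodule.subset_span ⟨invForm_col_mem hA k,
      ⟨Sum.elim (fun i => invForm n q A i k) 0, by ext (i | i) <;> simp⟩, ?_⟩
    set t := (1 + K) / ε with htdef
    -- The second half -i e_k/(2t) is multiplied by itY to give Y e_k/2, so l + l̄ is the k-th
    -- column of Y and `herm l = Y_kk/(4t)`. The choice t = (1 + K)/ε makes this less than ε.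
    refine ⟨Sum.elim (fun i => ((invForm n q A i k : ℤ) : ℂ) / 2)
      (Pi.single k (((-(1 / (2 * t)) : ℝ) : ℂ) * Complex.I)), ?_, ?_, ?_⟩
    · refine mem_phi_le_rfl.2 ?_
      ext i
      simp only [Sum.elim_inl, Sum.elim_inr]
      rw [show (fun j => (Pi.single k (((-(1 / (2 * t)) : ℝ) : ℂ) * Complex.I) : Fin n → ℂ) j)
        = Pi.single k (((-(1 / (2 * t)) : ℝ) : ℂ) * Complex.I) from rfl, mulVec_single]
      change _ = ((incM hq ℂ * Z.1 * (incM hq ℂ)ᵀ + ((t : ℂ) * Complex.I) •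
        (invForm n q A).map (Int.castRingHom ℂ)) i k) * (((-(1 / (2 * t)) : ℝ) : ℂ) * Complex.I)
      rw [Matrix.add_apply, incM_mul_mul_apply, dif_neg (by tauto), zero_add, Matrix.smul_apply,
        Matrix.map_apply, eq_intCast, smul_eq_mul]
      have ht' : (t : ℂ) ≠ 0 := by exact_mod_cast ht.ne'
      push_cast
      field_simp
      rw [Complex.I_sq]
      ring
    · rintro (i | i)
      · simp only [Sum.elim_inl, map_div₀, Complex.conj_ofNat]
        rw [← Complex.ofReal_intCast, Complex.conj_ofReal]
        ring
      · simp only [Sum.elim_inr, Pi.zero_apply]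
        by_cases hi : i = k
        · subst hi
          rw [Pi.single_eq_same, map_mul, Complex.conj_ofReal, Complex.conj_I]
          ring
        · simp [hi]
    · have h1 : herm (Sum.elim (fun i => ((invForm n q A i k : ℤ) : ℂ) / 2)
          (Pi.single k (((-(1 / (2 * t)) : ℝ) : ℂ) * Complex.I)) : V n)
          = ((invForm n q A k k : ℤ) : ℝ) / (4 * t) := by
        simp only [herm, Sum.elim_inl, Sum.elim_inr]
        rw [Finset.sum_eq_single k]
        · rw [Pi.single_eq_same, map_mul, Complex.conj_ofReal, Complex.conj_I,
            ← Complex.ofReal_intCast, show ((((invForm n q A k k : ℤ) : ℝ) : ℂ) / 2)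
              * (((-(1 / (2 * t)) : ℝ) : ℂ) * -Complex.I)
              = ((((invForm n q A k k : ℤ) : ℝ) / (4 * t) : ℝ) : ℂ) * Complex.I by
            push_cast
            field_simp
            ring, Complex.im_ofReal_mul, Complex.I_im, mul_one]
        · intro i _ hi
          simp [hi]
        · simp
      rw [h1, div_lt_iff₀ (by positivity)]
      have h2 : ((invForm n q A k k : ℤ) : ℝ) ≤ K :=
        (le_abs_self _).trans (Finset.single_le_sum
          (f := fun k => |((invForm n q A k k : ℤ) : ℝ)|) (fun _ _ => abs_nonneg _)
          (Finset.mem_univ k))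
      have h3 : ε * (4 * t) = 4 * (1 + K) := by rw [htdef]; field_simp
      rw [h3]
      linarith

end cone

/-! ### Block form of the adjusted real structure and conclusion. -/

theorem pj_mid_eq_fromBlocks {n q : ℕ} (hq : q ≤ n)
    (X : Matrix (Fin n ⊕ Fin n) (Fin n ⊕ Fin n) ℤ) :
    pj n q ℤ 1 * X * pj n q ℤ 1 = fromBlocks
      (incM hq ℤ * (blk hq X).toBlocks₁₁ * (incM hq ℤ)ᵀ)
      (incM hq ℤ * (blk hq X).toBlocks₁₂ * (incM hq ℤ)ᵀ)
      (incM hq ℤ * (blk hq X).toBlocks₂₁ * (incM hq ℤ)ᵀ)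
      (incM hq ℤ * (blk hq X).toBlocks₂₂ * (incM hq ℤ)ᵀ) := by
  have h1 : ∀ i : Fin n, lev n q (Sum.inl i) = 1 ↔ (i : ℕ) < q := fun i => by simp [lev]
  have h2 : ∀ i : Fin n, lev n q (Sum.inr i) = 1 ↔ (i : ℕ) < q := fun i => by simp [lev]
  ext (i | i) (j | j) <;> rw [pj_mul_mul_apply]
  · rw [fromBlocks_apply₁₁, incM_mul_mul_apply]
    simp only [h1]
    split_ifs <;> rfl
  · rw [fromBlocks_apply₁₂, incM_mul_mul_apply]
    simp only [h1, h2]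
    split_ifs <;> rfl
  · rw [fromBlocks_apply₂₁, incM_mul_mul_apply]
    simp only [h2, h1]
    split_ifs <;> rfl
  · rw [fromBlocks_apply₂₂, incM_mul_mul_apply]
    simp only [h2]
    split_ifs <;> rfl

theorem pj_zero_eq_fromBlocks (n q : ℕ) : pj n q ℤ 0 = fromBlocks (tailProj n q ℤ) 0 0 0 := by
  rw [pj_eq_fromBlocks, tailProj]
  congr 1
  · congr 1
    ext i
    by_cases hi : (i : ℕ) < q <;> simp [lev, hi]
  · rw [← diagonal_zero]
    congr 1
    ext i
    rw [if_neg (lev_inr_ne_zero i)]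

/-- The idempotent on W_q gives the involution A = 2a - w, w being the tail projector. In δ = I₋(2E
- 1) the first tail block is -A because of I₋, the second is -Aᵀ because E carries w - aᵀ there. -/
theorem exists_tailInvolution {n q : ℕ} (hq : q ≤ n) {δ : Sp n ℤ}
    {α ε : Matrix (Fin n ⊕ Fin n) (Fin n ⊕ Fin n) ℤ} (hαα : α * α = α)
    (hpα : pj n q ℤ 0 * α * pj n q ℤ 0 = α) (hrε : pj n q ℤ 1 * ε * pj n q ℤ 1 = ε)
    (hδ : Iminus n ℤ * δ.1 = (2 : ℤ) • (α + ε + (pj n q ℤ 2 - adj α)) - 1) :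
    ∃ A : Matrix (Fin n) (Fin n) ℤ, IsTailInvolution hq A ∧ δ.1 = fromBlocks
      (incM hq ℤ * (blk hq δ.1).toBlocks₁₁ * (incM hq ℤ)ᵀ - A)
      (incM hq ℤ * (blk hq δ.1).toBlocks₁₂ * (incM hq ℤ)ᵀ)
      (incM hq ℤ * (blk hq δ.1).toBlocks₂₁ * (incM hq ℤ)ᵀ)
      (incM hq ℤ * (blk hq δ.1).toBlocks₂₂ * (incM hq ℤ)ᵀ - Aᵀ) := by
  set a := α.toBlocks₁₁ with ha
  set w := tailProj n q ℤ with hw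
  have hαa : α = fromBlocks (w * a * w) 0 0 0 := by
    conv_lhs => rw [← hpα, pj_zero_eq_fromBlocks, ← fromBlocks_toBlocks α]
    simp only [fromBlocks_multiply, Matrix.mul_zero, Matrix.zero_mul, add_zero]
    rfl
  have haw : w * a * w = a := by
    conv_rhs => rw [ha, hαa, toBlocks_fromBlocks₁₁]
  rw [haw] at hαa
  have hww : w * w = w := tailProj_mul_self
  have hwa : w * a = a := by rw [← haw, ← Matrix.mul_assoc, ← Matrix.mul_assoc, hww]
  have haw' : a * w = a := by rw [← haw, Matrix.mul_assoc, hww]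
  have haa : a * a = a := by
    have h := hαα
    rw [hαa, fromBlocks_multiply] at h
    simpa using (fromBlocks_inj.1 h).1
  refine ⟨a + a - w, ⟨?_, ?_, ?_⟩, ?_⟩
  · simp only [Matrix.mul_add, Matrix.add_mul, Matrix.mul_sub, Matrix.sub_mul, haa, hwa, haw', hww]
    abel
  · rw [← hwa, ← Matrix.mul_add, Matrix.mul_sub, ← Matrix.mul_assoc, transpose_incM_mul_tailProj,
      Matrix.zero_mul, sub_zero]
  · rw [← haw', ← Matrix.add_mul, Matrix.sub_mul, Matrix.mul_assoc, tailProj_mul_incM,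
      Matrix.mul_zero, sub_zero]
  · have hr : pj n q ℤ 1 * pj n q ℤ 1 = pj n q ℤ 1 := pj_mul_self 1
    have hδ' : δ.1 = Iminus n ℤ * ((2 : ℤ) • (α + ε + (pj n q ℤ 2 - adj α)) - 1) := by
      rw [← hδ, ← Matrix.mul_assoc, Iminus_mul_self, Matrix.one_mul]
    have hp2 : pj n q ℤ 2 = fromBlocks 0 0 0 w := by
      rw [← adj_pj 0 (by omega), pj_zero_eq_fromBlocks, adj_fromBlocks, tailProj_transpose,
        transpose_zero, neg_zero]
    have hadjα : adj α = fromBlocks 0 0 0 aᵀ := by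
      rw [hαa, adj_fromBlocks]; simp
    have hmid : pj n q ℤ 1 * δ.1 * pj n q ℤ 1 = Iminus n ℤ * ((2 : ℤ) • ε - pj n q ℤ 1) := by
      have h0 : pj n q ℤ 1 * α = 0 := by
        rw [← hpα, ← Matrix.mul_assoc, ← Matrix.mul_assoc, pj_mul_of_ne (by omega),
          Matrix.zero_mul, Matrix.zero_mul]
      have h2 : pj n q ℤ 1 * adj α = 0 := by
        have h3 : adj (pj n q ℤ 1) = pj n q ℤ 1 := adj_pj 1 (by omega)
        rw [← h3, ← adj_mul, ← hpα, Matrix.mul_assoc, pj_mul_of_ne (by omega),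
          Matrix.mul_zero, adj_zero]
      have h4 : pj n q ℤ 1 * pj n q ℤ 2 = 0 := pj_mul_of_ne (by omega)
      rw [hδ', ← Matrix.mul_assoc, pj_mul_Iminus, Matrix.mul_assoc, Matrix.mul_assoc,
        ← Matrix.mul_assoc (pj n q ℤ 1), Matrix.mul_sub, Matrix.mul_smul, Matrix.mul_add,
        Matrix.mul_add, Matrix.mul_sub, h0, h2, h4, zero_add, sub_zero, add_zero, Matrix.sub_mul,
        Matrix.smul_mul, hrε, Matrix.mul_one, hr]
    have hsplit : δ.1 = pj n q ℤ 1 * δ.1 * pj n q ℤ 1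
        + fromBlocks (-(a + a - w)) 0 0 (-(a + a - w)ᵀ) := by
      have h1 : fromBlocks (-(a + a - w)) 0 0 (-(a + a - w)ᵀ)
          = Iminus n ℤ * (α + α - pj n q ℤ 0 + (pj n q ℤ 2 - adj α - adj α)) := by
        rw [hadjα, hp2, hαa, pj_zero_eq_fromBlocks, Iminus]
        simp only [sub_eq_add_neg, fromBlocks_neg, fromBlocks_add, fromBlocks_multiply]
        congr 1
        · simp [hw]
        · simp
        · simp
        · simp [tailProj_transpose, hw]; abel
      rw [hmid, h1, ← Matrix.mul_add, hδ', ← pj_sum (n := n) (q := q)]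
      congr 1
      rw [two_smul, two_smul]
      abel
    rw [pj_mid_eq_fromBlocks hq, fromBlocks_add, add_zero, add_zero, ← sub_eq_add_neg,
      ← sub_eq_add_neg] at hsplit
    exact hsplit

/-- Every real point of a boundary component on which the real structure is block diagonal is a
limit of real points of the Siegel space. -/
theorem mem_closure_of_blockDiagonal {n q : ℕ} (hq : q ≤ n) {g γ : Sp n ℤ}
    {α ε : Matrix (Fin n ⊕ Fin n) (Fin n ⊕ Fin n) ℤ} (hαα : α * α = α)
    (hpα : pj n q ℤ 0 * α * pj n q ℤ 0 = α) (hrε : pj n q ℤ 1 * ε * pj n q ℤ 1 = ε)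
    (hδ : Iminus n ℤ * ((tauSp g)⁻¹ * γ * g).1
      = (2 : ℤ) • (α + ε + (pj n q ℤ 2 - adj α)) - 1)
    {Z : Siegel q} (hZ : (toRat g • stdPoint hq Z).tau = γ • toRat g • stdPoint hq Z) :
    toRat g • stdPoint hq Z ∈ closure (incl '' {Z' : Siegel n | (incl Z').tau = γ • incl Z'}) := by
  obtain ⟨A, hA, hδA⟩ := exists_tailInvolution hq hαα hpα hrε hδ
  rw [tau_smul_stdPoint_iff] at hZ
  rw [mem_closure_iff]
  intro O hO hx
  obtain ⟨U, hU, e, he, h⟩ := hO q hq (toRat g) Z hx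
  obtain ⟨t, ht, hmem⟩ := exists_conePoint_mem hA (mem_of_mem_nhds hU) he
  obtain ⟨Z', hZ'⟩ := exists_smul_incl (toRat g) (conePoint hq Z A ht)
  refine ⟨incl Z', hZ' ▸ h _ hmem, Z', ?_, rfl⟩
  have h1 := (tau_smul_stdPoint_iff le_rfl g γ (conePoint hq Z A ht)).2
    (actSub_conePoint hA hδA hZ ht)
  change (incl Z').tau = γ • incl Z'
  rw [← hZ']
  exact h1

/-- For every real boundary pair `(F, γ)` there is `γ₁` in the congruence subgroup with the same
real points on `F`, all of which are limits of `γ₁`-real points of the Siegel space. -/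
theorem exists_realPoints_subset_closure {n k : ℕ} (hk : 2 ≤ k) {F : Set (Satake n)} {γ : Sp n ℤ}
    (h : IsRealBoundaryPair (2 ^ k) F γ) :
    ∃ γ₁ ∈ Gam n (2 ^ k), realPoints F γ = realPoints F γ₁ ∧
      realPoints F γ₁ ⊆ closure (incl '' {Z : Siegel n | (incl Z).tau = γ₁ • incl Z}) := by
  obtain ⟨q, hq, g, γ₁, α, ε, hγ₁, rfl, hreal, hαα, hpα, hrε, hδ⟩ := exists_blockDiagonal hk h
  refine ⟨γ₁, hγ₁, hreal, ?_⟩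
  rintro _ ⟨⟨Z, rfl⟩, hZ⟩
  exact mem_closure_of_blockDiagonal hq hαα hpα hrε hδ hZ

/-- A point of V_ℝ lifts to some x with τ(x) = γx; the component containing x forms a real boundary
pair with γ. The approximation upstairs is pushed down by the continuous projection, and closedness
of V_ℝ gives the other inclusion. -/
theorem closure_XR {n k : ℕ} (hk : 2 ≤ k) : closure (XR n (2 ^ k)) = VR n (2 ^ k) := by
  refine (closure_minimal (fun v hv => hv.2) (isClosed_VR n (2 ^ k))).antisymm ?_
  intro v hv
  obtain ⟨x, rfl⟩ := Quotient.exists_rep v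
  change (proj (2 ^ k) x).tau = proj (2 ^ k) x at hv
  change proj (2 ^ k) x ∈ _
  obtain ⟨γ, hγ, hx⟩ := (proj_tau_eq_iff _).1 hv
  obtain ⟨q, hq, g, Z, hxZ⟩ := x.2
  have hxF : x ∈ Set.range fun Z : Siegel q => g • stdPoint hq Z := ⟨Z, Subtype.ext hxZ.symm⟩
  obtain ⟨γ₁, hγ₁, h1, h2⟩ := exists_realPoints_subset_closure hk
    (F := Set.range fun Z : Siegel q => g • stdPoint hq Z) ⟨⟨q, hq, g, rfl⟩, hγ, x, hxF, hx⟩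
  refine map_mem_closure (continuous_proj n (2 ^ k)) (h2 (h1 ▸ ⟨hxF, hx⟩)) ?_
  rintro _ ⟨Z', hZ', rfl⟩
  exact ⟨⟨Z', rfl⟩, (proj_tau_eq_iff _).2 ⟨γ₁, hγ₁, hZ'⟩⟩

end RealSiegel

theorem mainTheorem4 (n k : ℕ) (hk : 2 ≤ k) :
    (∀ (F : Set (RealSiegel.Satake n)) (γ : RealSiegel.Sp n ℤ),
      RealSiegel.IsRealBoundaryPair (2 ^ k) F γ →
        ∃ γ₁ ∈ RealSiegel.Gam n (2 ^ k),
          RealSiegel.realPoints F γ = RealSiegel.realPoints F γ₁ ∧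
          RealSiegel.realPoints F γ₁ ⊆
            closure (RealSiegel.incl '' RealSiegel.siegelRealPoints γ₁)) ∧
    closure (RealSiegel.XR n (2 ^ k)) = RealSiegel.VR n (2 ^ k) := by
  refine ⟨fun F γ h => ?_, RealSiegel.closure_XR hk⟩
  obtain ⟨γ₁, hγ₁, h1, h2⟩ := RealSiegel.exists_realPoints_subset_closure hk h
  exact ⟨γ₁, hγ₁, h1, h2.trans (closure_mono
    (Set.image_mono fun _ hZ => RealSiegel.mem_siegelRealPoints hZ))⟩
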